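/- **Proposition (soliton equations of the modified Laplacian coflow on warped products).** Let $N$ be a non-empty smooth $6$-manifold with an $SU(3)$-structure $(g_6,\omega,\Omega)$: a Riemannian metric $g_6$, a compatible Hermitian form $\omega=g_6(J\cdot,\cdot)$ of an orthogonal almost complex structure $J$, and a complex $3$-form $\Omega$ of type $(3,0)$ with $\Omega\wedge\omega=0$, $\omega^3=6\,\mathrm{vol}_6$, $\Omega\wedge\bar\Omega=-8i\,\mathrm{vol}_6$. Suppose that for a real constant $\lambda$ $$d\omega=-3\lambda\,\mathrm{Re}\,\Omega,\qquad d\Omega=2\lambda i\,\omega^2,\qquad d(\omega^2)=0$$ ($\lambda=0$: Calabi–Yau; $\lambda\neq0$: nearly Kähler). Let $L$ be a smooth $1$-manifold and $r$ a local coordinate on $L$. For smooth real functions $G>0$, $h>0$, $\theta$ of $r$ put $F=he^{i\theta/3}$ and consider, over the domain of $r$, the warped product $G_2$-structure $$\varphi=\mathrm{Re}(F^3\Omega)+Gh^2\,dr\wedge\omega,\qquad \psi=\tfrac12h^4\omega^2+\mathrm{Im}(F^3\Omega)\wedge G\,dr,$$ $$g_7=G^2dr^2+h^2g_6,\qquad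 \mathrm{vol}_7=Gh^6\,\mathrm{vol}_6\wedge dr .$$ Let $\Delta_\psi=dd^*+d^*d$ be the Hodge Laplacian of $(g_7,\mathrm{vol}_7)$, and let $T_{am}=\frac1{24}(\nabla_a\varphi_{bcd})\psi_m{}^{bcd}$ be the full torsion tensor ($\nabla$ the Levi-Civita connection of $g_7$). Let $k,C,\mu$ be real constants and let $l$ be a smooth function of $r$. Assume that the structure is co-closed, $d\psi=0$, and that it satisfies the soliton equation $$\Delta_\psi\psi+k\,d\big((C-\mathrm{Tr}\,T)\varphi\big)=d(X\lrcorner\psi)+4\mu\psi,\qquad X=l\,G^{-1}\frac{\partial}{\partial r}. \qquad (*)$$ Let a prime denote $G^{-1}\frac{d}{dr}$, i.e. the derivative with respect to the coordinate on $L$ normalized so that $G=1$ (so it is $\frac{d}{dr}$ if $G=1$), and let $$\alpha=\theta',\qquad \beta=\frac{\lambda\sin\theta}{h}.$$ Then, on the range of $r$, $$(1-k)\alpha^2+3\beta^2+6k\alpha\beta+kC\alpha=l'+\mu,$$ $$(k-1)(\alpha-6\beta)'=\alpha l,$$ $$3(1-2k)\beta^2+(k-1)\alpha\beta-kC\beta=-\frac{\beta'l}{\alpha+\beta}+\mu\qquad\text{wherever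 }\alpha+\beta\neq0,$$ and at every point, including those where $\alpha+\beta=0$, the third equation holds with $\frac{\beta'}{\alpha+\beta}$ replaced by $\frac{\lambda\cos\theta}{h}$: $$3(1-2k)\beta^2+(k-1)\alpha\beta-kC\beta=-\frac{\lambda\cos\theta}{h}\,l+\mu .$$ Consequently, if $(G_t,h_t,\theta_t)$, $t$ in an interval $J$ of positive length, is a soliton solution of the modified Laplacian coflow, i.e. a family of such co-closed structures with $\partial_t\psi=\Delta_\psi\psi+k\,d((C-\mathrm{Tr}\,T)\varphi)$ and $\partial_t\psi=d(X\lrcorner\psi)+4\mu\psi$, $X=l_tG_t^{-1}\partial_r$, for all $t\in J$, then these equations hold at every time $t\in J$. -/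

import Mathlib

open scoped Manifold ContDiff TensorProduct

noncomputable section

namespace WarpedCoflow

/-! ### Exterior algebra on a real topological vector space -/

section Algebra

variable {V : Type*} [AddCommGroup V] [Module ℝ V] [TopologicalSpace V]
variable {A : Type*} [NormedCommRing A] [NormedAlgebra ℝ A]
variable {F : Type*} [NormedAddCommGroup F] [NormedSpace ℝ F]

/-- The wedge product of alternating forms, as the signed sum over shuffles, so that
`(a ∧ b)(u, v) = a u * b v - a v * b u` for covectors. -/
def wedge {k m : ℕ} (a : V [⋀^Fin k]→L[ℝ] A) (b : V [⋀^Fin m]→L[ℝ] A) :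
    V [⋀^Fin (k + m)]→L[ℝ] A :=
  { (((LinearMap.mul' ℝ A).compAlternatingMap
      (a.toAlternatingMap.domCoprod b.toAlternatingMap)).domDomCongr finSumFinEquiv) with
    cont := by
      change Continuous fun v : Fin (k + m) → V =>
        LinearMap.mul' ℝ A ((a.toAlternatingMap.domCoprod b.toAlternatingMap)
          fun i => v (finSumFinEquiv i))
      simp only [AlternatingMap.domCoprod_apply, sum_apply, map_sum]
      refine continuous_finsetSum _ fun σ _ => ?_
      induction σ using Quotient.inductionOn' with
      | h σ =>
        simp only [AlternatingMap.domCoprod.summand_mk'']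
        change Continuous fun v : Fin (k + m) → V =>
          LinearMap.mul' ℝ A (Equiv.Perm.sign σ •
            ((a fun i => v (finSumFinEquiv (σ (Sum.inl i)))) ⊗ₜ[ℝ]
              (b fun i => v (finSumFinEquiv (σ (Sum.inr i))))))
        simp only [Units.smul_def, map_zsmul, LinearMap.mul'_apply]
        refine Continuous.zsmul (Continuous.mul ?_ ?_) _
        · exact a.cont.comp (continuous_pi fun i => continuous_apply _)
        · exact b.cont.comp (continuous_pi fun i => continuous_apply _) }

/-- The interior product `v ⌟ a = a(v, ·, …, ·)`. -/
def interiorProd {k : ℕ} (v : V) (a : V [⋀^Fin (k + 1)]→L[ℝ] F) : V [⋀^Fin k]→L[ℝ] F :=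
  { a.toAlternatingMap.curryLeft v with
    cont := a.cont.comp (continuous_const.finCons continuous_id) }

/-- `contract v a = a(v 0, …, v (k-1), ·, …, ·)`. -/
def contract {m : ℕ} : {k : ℕ} → (Fin k → V) → V [⋀^Fin (m + k)]→L[ℝ] F → V [⋀^Fin m]→L[ℝ] F
  | 0, _, a => a
  | _ + 1, v, a => contract (Fin.tail v) (interiorProd (v 0) a)

/-- The inverse metric `g^{ij}` in the standard basis of a finite-dimensional space. -/
def inverseMetric [FiniteDimensional ℝ V] (g : V →L[ℝ] V →L[ℝ] ℝ) :
    Matrix (Fin (Module.finrank ℝ V)) (Fin (Module.finrank ℝ V)) ℝ :=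
  (Matrix.of fun i j => g (Module.finBasis ℝ V i) (Module.finBasis ℝ V j))⁻¹

/-- The Hodge star of a metric `g` and a volume form `vol`:
`(*a)_{j_1 … j_m} = (1 / k!) a^{i_1 … i_k} vol_{i_1 … i_k j_1 … j_m}`,
equivalently `b ∧ *a = ⟨b, a⟩ vol`. -/
def hodgeStar [FiniteDimensional ℝ V] [IsTopologicalAddGroup V] [ContinuousSMul ℝ V] {k m : ℕ}
    (g : V →L[ℝ] V →L[ℝ] ℝ) (vol : V [⋀^Fin (m + k)]→L[ℝ] ℝ) (a : V [⋀^Fin k]→L[ℝ] ℝ) :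
    V [⋀^Fin m]→L[ℝ] ℝ :=
  ((k.factorial : ℝ)⁻¹) •
    ∑ i : Fin k → Fin (Module.finrank ℝ V), ∑ j : Fin k → Fin (Module.finrank ℝ V),
      ((∏ c, inverseMetric g (i c) (j c)) * a fun c => Module.finBasis ℝ V (j c)) •
        contract (fun c => Module.finBasis ℝ V (i c)) vol

end Algebra

/-! ### Differential forms and torsion on a manifold without boundary -/

section Manifold

variable {E : Type*} [NormedAddCommGroup E] [NormedSpace ℝ E]
variable {H : Type*} [TopologicalSpace H] (I : ModelWithCorners ℝ E H)
variable (M : Type*) [TopologicalSpace M] [ChartedSpace H M]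

/-- `F`-valued (not necessarily smooth) differential `k`-forms on `M`. -/
abbrev DForm (k : ℕ) (F : Type*) [NormedAddCommGroup F] [NormedSpace ℝ F] :=
  ∀ x : M, TangentSpace I x [⋀^Fin k]→L[ℝ] F

/-- Fields of bilinear forms on the tangent spaces of `M`. -/
abbrev BilinField := ∀ x : M, TangentSpace I x →L[ℝ] TangentSpace I x →L[ℝ] ℝ

variable {I M}
variable {F : Type*} [NormedAddCommGroup F] [NormedSpace ℝ F]

instance tangentFiniteDimensional [FiniteDimensional ℝ E] (x : M) :
    FiniteDimensional ℝ (TangentSpace I x) :=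
  inferInstanceAs (FiniteDimensional ℝ E)

/-- The form `a` in the preferred chart at `x₀` (its pullback by the inverse of the chart). -/
def chartForm {k : ℕ} (a : DForm I M k F) (x₀ : M) : E → E [⋀^Fin k]→L[ℝ] F := fun y =>
  (a ((extChartAt I x₀).symm y)).compContinuousLinearMap
    (mfderiv 𝓘(ℝ, E) I (extChartAt I x₀).symm y)

/-- The bilinear form field `g` in the preferred chart at `x₀`. -/
def chartBilin (g : BilinField I M) (x₀ : M) : E → E →L[ℝ] E →L[ℝ] ℝ := fun y =>
  (show E →L[ℝ] E →L[ℝ] ℝ from g ((extChartAt I x₀).symm y)).bilinearComp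
    (show E →L[ℝ] E from mfderiv 𝓘(ℝ, E) I (extChartAt I x₀).symm y)
    (show E →L[ℝ] E from mfderiv 𝓘(ℝ, E) I (extChartAt I x₀).symm y)

/-- Smoothness of a differential form. -/
def SmoothForm {k : ℕ} (a : DForm I M k F) : Prop :=
  ∀ x₀ : M, ContDiffOn ℝ ∞ (chartForm a x₀) (extChartAt I x₀).target

/-- The exterior derivative, computed at each point in the preferred chart at that point. -/
def d {k : ℕ} (a : DForm I M k F) : DForm I M (k + 1) F := fun x =>
  (show E [⋀^Fin (k + 1)]→L[ℝ] F from
    extDeriv (chartForm a x) (extChartAt I x x)).compContinuousLinearMap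
    (show TangentSpace I x →L[ℝ] E from mfderiv I 𝓘(ℝ, E) (extChartAt I x) x)

/-- Wedge product of differential forms. -/
def dwedge {A : Type*} [NormedCommRing A] [NormedAlgebra ℝ A] {k m : ℕ}
    (a : DForm I M k A) (b : DForm I M m A) : DForm I M (k + m) A := fun x => wedge (a x) (b x)

/-- Real part of a complex-valued form. -/
def reForm {k : ℕ} (a : DForm I M k ℂ) : DForm I M k ℝ := fun x =>
  Complex.reCLM.compContinuousAlternatingMap (a x)

/-- Imaginary part of a complex-valued form. -/
def imForm {k : ℕ} (a : DForm I M k ℂ) : DForm I M k ℝ := fun x =>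
  Complex.imCLM.compContinuousAlternatingMap (a x)

/-- Complex conjugate of a complex-valued form. -/
def conjForm {k : ℕ} (a : DForm I M k ℂ) : DForm I M k ℂ := fun x =>
  (Complex.conjCLE : ℂ →L[ℝ] ℂ).compContinuousAlternatingMap (a x)

/-- A real form regarded as a complex-valued form. -/
def complexForm {k : ℕ} (a : DForm I M k ℝ) : DForm I M k ℂ := fun x =>
  Complex.ofRealCLM.compContinuousAlternatingMap (a x)

variable {E' : Type*} [NormedAddCommGroup E'] [NormedSpace ℝ E']
variable {H' : Type*} [TopologicalSpace H'] {I' : ModelWithCorners ℝ E' H'}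
variable {M' : Type*} [TopologicalSpace M'] [ChartedSpace H' M']

/-- Pullback of a differential form by a map. -/
def pullForm {k : ℕ} (f : M → M') (a : DForm I' M' k F) : DForm I M k F := fun x =>
  (a (f x)).compContinuousLinearMap (mfderiv I I' f x)

/-- Pullback of a field of bilinear forms by a map. -/
def pullBilin (f : M → M') (g : BilinField I' M') : BilinField I M := fun x =>
  show E →L[ℝ] E →L[ℝ] ℝ from (show E' →L[ℝ] E' →L[ℝ] ℝ from g (f x)).bilinearComp
    (show E →L[ℝ] E' from mfderiv I I' f x) (show E →L[ℝ] E' from mfderiv I I' f x)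

variable [FiniteDimensional ℝ E]

/-- The Hodge star of differential forms. -/
def star {k m : ℕ} (g : BilinField I M) (vol : DForm I M (m + k) ℝ) (a : DForm I M k ℝ) :
    DForm I M m ℝ := fun x => hodgeStar (g x) (vol x) (a x)

/-- The codifferential `d^* = * d *` on `4`-forms of a `7`-manifold
(in dimension `7` one has `d^* = (-1)^p * d *` on `p`-forms). -/
def codiff₄ (g : BilinField I M) (vol : DForm I M 7 ℝ) (a : DForm I M 4 ℝ) : DForm I M 3 ℝ :=
  star (k := 4) (m := 3) g vol (d (star (k := 4) (m := 3) g vol a))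

/-- The codifferential `d^* = - * d *` on `5`-forms of a `7`-manifold. -/
def codiff₅ (g : BilinField I M) (vol : DForm I M 7 ℝ) (a : DForm I M 5 ℝ) : DForm I M 4 ℝ :=
  -star (k := 3) (m := 4) g vol (d (star (k := 5) (m := 2) g vol a))

/-- The Hodge Laplacian `d d^* + d^* d` on `4`-forms of a `7`-manifold. -/
def hodgeLaplacian (g : BilinField I M) (vol : DForm I M 7 ℝ) (a : DForm I M 4 ℝ) :
    DForm I M 4 ℝ :=
  d (codiff₄ g vol a) + codiff₅ g vol (d a)

/-- The Christoffel symbols `Γ(u, v) = Γ^c_{ab} u^a v^b ∂_c` at the point `y` of a chart with domain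
in `E`, for the metric coefficients `γ`:
`Γ^c_{ab} = (1/2) γ^{ce} (∂_a γ_{be} + ∂_b γ_{ae} - ∂_e γ_{ab})`. -/
def christoffel (γ : E → E →L[ℝ] E →L[ℝ] ℝ) (y : E) (u v : E) : E :=
  ∑ c, ∑ e, (inverseMetric (γ y) c e * ((1 / 2 : ℝ) *
      (fderiv ℝ (fun z => γ z v (Module.finBasis ℝ E e)) y u
        + fderiv ℝ (fun z => γ z u (Module.finBasis ℝ E e)) y v
        - fderiv ℝ (fun z => γ z u v) y (Module.finBasis ℝ E e)))) • Module.finBasis ℝ E c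

/-- The Levi-Civita covariant derivative `(∇_u a)(v₁, v₂, v₃)` of a `3`-form in a chart. -/
def covDeriv₃ (γ : E → E →L[ℝ] E →L[ℝ] ℝ) (a : E → E [⋀^Fin 3]→L[ℝ] ℝ) (y : E)
    (u v₁ v₂ v₃ : E) : ℝ :=
  fderiv ℝ (fun z => a z ![v₁, v₂, v₃]) y u
    - a y ![christoffel γ y u v₁, v₂, v₃]
    - a y ![v₁, christoffel γ y u v₂, v₃]
    - a y ![v₁, v₂, christoffel γ y u v₃]

/-- The full torsion tensor of a `G₂`-structure in a chart:
`T_{am} = (1/24) (∇_a φ_{bcd}) ψ_m^{bcd}`, indices raised by the metric. -/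
def torsion (γ : E → E →L[ℝ] E →L[ℝ] ℝ) (φ : E → E [⋀^Fin 3]→L[ℝ] ℝ)
    (ψ : E → E [⋀^Fin 4]→L[ℝ] ℝ) (y : E) (u w : E) : ℝ :=
  (1 / 24 : ℝ) * ∑ b : Fin 3 → Fin (Module.finrank ℝ E), ∑ c : Fin 3 → Fin (Module.finrank ℝ E),
    (∏ s, inverseMetric (γ y) (b s) (c s)) *
      covDeriv₃ γ φ y u (Module.finBasis ℝ E (b 0)) (Module.finBasis ℝ E (b 1))
        (Module.finBasis ℝ E (b 2)) *
      ψ y ![w, Module.finBasis ℝ E (c 0), Module.finBasis ℝ E (c 1), Module.finBasis ℝ E (c 2)]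

/-- The trace `Tr T = g^{am} T_{am}` of the full torsion tensor of a `G₂`-structure with `3`-form
`φ`, `4`-form `ψ` and metric `g`, computed at each point in the preferred chart at that point. -/
def traceTorsion (g : BilinField I M) (φ : DForm I M 3 ℝ) (ψ : DForm I M 4 ℝ) (x : M) : ℝ :=
  ∑ a, ∑ m, inverseMetric (chartBilin g x (extChartAt I x x)) a m *
    torsion (chartBilin g x) (chartForm φ x) (chartForm ψ x) (extChartAt I x x)
      (Module.finBasis ℝ E a) (Module.finBasis ℝ E m)

end Manifold

/-! ### Calabi–Yau and nearly Kähler `6`-manifolds -/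

section SixManifold

variable (N : Type*) [TopologicalSpace N] [ChartedSpace (EuclideanSpace ℝ (Fin 6)) N]
  [IsManifold (𝓡 6) ∞ N]

/-- An `SU(3)`-structure on a `6`-manifold: a Riemannian metric `g` with an orthogonal almost
complex structure `J`, the Hermitian form `ω = g(J·, ·)`, and a complex volume form `Ω` of type
`(3, 0)`, normalized by `Ω ∧ conj Ω = -8 i vol₆` with `ω³ = 6 vol₆`. -/
structure SU3Structure where
  /-- the Riemannian metric -/
  g : Bundle.ContMDiffRiemannianMetric (𝓡 6) ∞ (EuclideanSpace ℝ (Fin 6))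
    (fun x : N => TangentSpace (𝓡 6) x)
  /-- the almost complex structure -/
  J : ∀ x : N, TangentSpace (𝓡 6) x →L[ℝ] TangentSpace (𝓡 6) x
  /-- the Hermitian form -/
  omega : DForm (𝓡 6) N 2 ℝ
  /-- the complex volume form -/
  Omega : DForm (𝓡 6) N 3 ℂ
  smooth_omega : SmoothForm omega
  smooth_Omega : SmoothForm Omega
  J_J : ∀ x v, J x (J x v) = -v
  g_J_J : ∀ x u v, g.inner x (J x u) (J x v) = g.inner x u v
  omega_apply : ∀ x u v, omega x ![u, v] = g.inner x (J x u) v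
  Omega_J : ∀ x u v w, Omega x ![J x u, v, w] = Complex.I * Omega x ![u, v, w]
  Omega_omega : dwedge Omega (complexForm omega) = 0
  Omega_conj : ∀ x, (dwedge Omega (conjForm Omega) : DForm (𝓡 6) N 6 ℂ) x =
    (-8 * Complex.I) •
      (complexForm ((1 / 6 : ℝ) • (dwedge (dwedge omega omega) omega : DForm (𝓡 6) N 6 ℝ))) x

variable {N}

/-- The volume form `vol₆ = ω³ / 6`. -/
def SU3Structure.vol (S : SU3Structure N) : DForm (𝓡 6) N 6 ℝ :=
  (1 / 6 : ℝ) • dwedge (dwedge S.omega S.omega) S.omega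

/-- The structure equations of a Calabi–Yau (`lam = 0`) or nearly Kähler (`lam ≠ 0`)
`6`-manifold. -/
structure SU3Structure.IsOfType (S : SU3Structure N) (lam : ℝ) : Prop where
  d_omega : d S.omega = (-3 * lam) • reForm S.Omega
  d_Omega : d S.Omega = (2 * lam * Complex.I : ℂ) • complexForm (dwedge S.omega S.omega)
  d_omega_sq : d (dwedge S.omega S.omega) = 0

end SixManifold

/-! ### Warped product `G₂`-structures and the modified Laplacian coflow -/

/-- The parameters `G`, `h`, `θ` of a warped product, as functions of the coordinate `r`. -/
structure WarpedData where
  /-- the lapse function `G` -/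
  G : ℝ → ℝ
  /-- the warping function `h = |F|` -/
  h : ℝ → ℝ
  /-- the phase `θ`, where `F = h exp(i θ / 3)` -/
  θ : ℝ → ℝ

/-- Smooth warped product parameters with `G, h > 0` on a set of values of `r`. -/
structure WarpedData.IsSmoothOn (W : WarpedData) (V : Set ℝ) : Prop where
  smooth_G : ContDiffOn ℝ ∞ W.G V
  smooth_h : ContDiffOn ℝ ∞ W.h V
  smooth_θ : ContDiffOn ℝ ∞ W.θ V
  G_pos : ∀ s ∈ V, 0 < W.G s
  h_pos : ∀ s ∈ V, 0 < W.h s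

/-- The derivative `G⁻¹ d/dr` with respect to the coordinate on `L` in which `G = 1`. -/
def WarpedData.ndiff (W : WarpedData) (f : ℝ → ℝ) : ℝ → ℝ := fun s => (W.G s)⁻¹ * deriv f s

/-- The torsion component `α`, the derivative of `θ`. -/
def WarpedData.α (W : WarpedData) : ℝ → ℝ := W.ndiff W.θ

/-- The torsion component `β = λ sin θ / h`. -/
def WarpedData.β (W : WarpedData) (lam : ℝ) : ℝ → ℝ := fun s => lam * Real.sin (W.θ s) / W.h s

section Warped

variable {N : Type*} [TopologicalSpace N] [ChartedSpace (EuclideanSpace ℝ (Fin 6)) N]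
  [IsManifold (𝓡 6) ∞ N]
variable {L : Type*} [TopologicalSpace L] [ChartedSpace ℝ L]

/-- The model with corners of the `7`-manifold `N × L`. -/
abbrev I₇ := (𝓡 6).prod 𝓘(ℝ, ℝ)

variable (N) in
/-- The `1`-form `dr` on `N × L`. -/
def dr (r : OpenPartialHomeomorph L ℝ) : DForm I₇ (N × L) 1 ℝ := fun z =>
  ContinuousAlternatingMap.ofSubsingleton ℝ (TangentSpace I₇ z) ℝ (0 : Fin 1)
    (show TangentSpace I₇ z →L[ℝ] ℝ from mfderiv I₇ 𝓘(ℝ, ℝ) (fun z : N × L => r z.2) z)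

variable (N) in
/-- The coordinate vector field `∂/∂r` on `N × L`. -/
def ddr (r : OpenPartialHomeomorph L ℝ) (z : N × L) : TangentSpace I₇ z :=
  ((0, mfderiv 𝓘(ℝ, ℝ) 𝓘(ℝ, ℝ) r.symm (r z.2) (1 : ℝ)) : EuclideanSpace ℝ (Fin 6) × ℝ)

/-- A form on `N` regarded as a form on `N × L`. -/
def lift {k : ℕ} {F : Type*} [NormedAddCommGroup F] [NormedSpace ℝ F] (a : DForm (𝓡 6) N k F) :
    DForm I₇ (N × L) k F :=
  pullForm Prod.fst a

variable (S : SU3Structure N) (r : OpenPartialHomeomorph L ℝ) (W : WarpedData)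

/-- The form `F³ Ω`, with `F³ = h³ exp(i θ)`. -/
def cubeOmega : DForm I₇ (N × L) 3 ℂ := fun z =>
  ((W.h (r z.2) : ℂ) ^ 3 * Complex.exp (Complex.I * W.θ (r z.2))) • lift (L := L) S.Omega z

/-- `φ = Re(F³ Ω) + G h² dr ∧ ω`. -/
def warpedφ : DForm I₇ (N × L) 3 ℝ := fun z =>
  reForm (cubeOmega S r W) z +
    (W.G (r z.2) * W.h (r z.2) ^ 2) • (dwedge (dr N r) (lift S.omega) : DForm I₇ (N × L) 3 ℝ) z

/-- `ψ = (1/2) h⁴ ω² + Im(F³ Ω) ∧ G dr`. -/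
def warpedψ : DForm I₇ (N × L) 4 ℝ := fun z =>
  (1 / 2 * W.h (r z.2) ^ 4) • (dwedge (lift S.omega) (lift S.omega) : DForm I₇ (N × L) 4 ℝ) z +
    W.G (r z.2) • (dwedge (imForm (cubeOmega S r W)) (dr N r) : DForm I₇ (N × L) 4 ℝ) z

/-- `g₇ = G² dr² + h² g₆`. -/
def warpedMetric : BilinField I₇ (N × L) := fun z =>
  (W.G (r z.2) ^ 2) •
      (show TangentSpace I₇ z →L[ℝ] ℝ from
        mfderiv I₇ 𝓘(ℝ, ℝ) (fun z : N × L => r z.2) z).smulRight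
      (show TangentSpace I₇ z →L[ℝ] ℝ from mfderiv I₇ 𝓘(ℝ, ℝ) (fun z : N × L => r z.2) z) +
    (W.h (r z.2) ^ 2) •
      (pullBilin Prod.fst (fun x => S.g.inner x) : BilinField I₇ (N × L)) z

/-- `vol₇ = G h⁶ vol₆ ∧ dr`. -/
def warpedVol : DForm I₇ (N × L) 7 ℝ := fun z =>
  (W.G (r z.2) * W.h (r z.2) ^ 6) • (dwedge (lift S.vol) (dr N r) : DForm I₇ (N × L) 7 ℝ) z

/-- The `4`-form `Δ_ψ ψ + k d((C - Tr T) φ)` driving the modified Laplacian coflow. -/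
def coflowRHS (k C : ℝ) : DForm I₇ (N × L) 4 ℝ :=
  hodgeLaplacian (warpedMetric S r W) (warpedVol S r W) (warpedψ S r W) +
    k • d (fun z => (C - traceTorsion (warpedMetric S r W) (warpedφ S r W) (warpedψ S r W) z) •
      warpedφ S r W z)

/-- The `4`-form `d(X ⌟ ψ) + 4 μ ψ` with `X = l G⁻¹ ∂/∂r`. -/
def solitonRHS (l : ℝ → ℝ) (mu : ℝ) : DForm I₇ (N × L) 4 ℝ :=
  d (fun z => interiorProd (k := 3) ((l (r z.2) * (W.G (r z.2))⁻¹) • ddr N r z) (warpedψ S r W z)) +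
    (4 * mu) • warpedψ S r W

/-- The warped product `G₂`-structure is co-closed over the coordinate patch: `d ψ = 0`. -/
def IsCoclosed : Prop := ∀ z : N × L, z.2 ∈ r.source → d (warpedψ S r W) z = 0

/-- The (time-independent) soliton equation
`Δ_ψ ψ + k d((C - Tr T) φ) = d(X ⌟ ψ) + 4 μ ψ` for a co-closed warped product `G₂`-structure over
the coordinate patch. -/
structure IsSoliton (k C : ℝ) (l : ℝ → ℝ) (mu : ℝ) : Prop where
  smooth : W.IsSmoothOn r.target
  smooth_l : ContDiffOn ℝ ∞ l r.target
  coclosed : IsCoclosed S r W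
  eq : ∀ z : N × L, z.2 ∈ r.source → coflowRHS S r W k C z = solitonRHS S r W l mu z

/-- A soliton solution of the modified Laplacian coflow on the time interval `J`: a family of
co-closed warped product `G₂`-structures with
`∂ψ/∂t = Δ_ψ ψ + k d((C - Tr T) φ)` and `∂ψ/∂t = d(X ⌟ ψ) + 4 μ ψ`
(the time derivatives of the components of `ψ` being one-sided at the end points of `J`). -/
structure IsSolitonSolution (W : ℝ → WarpedData) (k C : ℝ) (l : ℝ → ℝ → ℝ) (mu : ℝ)
    (J : Set ℝ) : Prop where
  smooth : ∀ t ∈ J, (W t).IsSmoothOn r.target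
  smooth_l : ∀ t ∈ J, ContDiffOn ℝ ∞ (l t) r.target
  coclosed : ∀ t ∈ J, IsCoclosed S r (W t)
  flow : ∀ t ∈ J, ∀ z : N × L, z.2 ∈ r.source → ∀ v : Fin 4 → TangentSpace I₇ z,
    HasDerivWithinAt (fun τ => warpedψ S r (W τ) z v) (coflowRHS S r (W t) k C z v) J t
  soliton : ∀ t ∈ J, ∀ z : N × L, z.2 ∈ r.source → ∀ v : Fin 4 → TangentSpace I₇ z,
    HasDerivWithinAt (fun τ => warpedψ S r (W τ) z v) (solitonRHS S r (W t) (l t) mu z v) J t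

end Warped

/-- The soliton system on a set `V` of values of `r`. The third equation is stated in the quotient
form wherever `α + β ≠ 0`, and at every point in the form in which
`β' / (α + β)` is replaced by `λ cos θ / h`. -/
structure SolitonSystem (W : WarpedData) (lam k C : ℝ) (l : ℝ → ℝ) (mu : ℝ) (V : Set ℝ) :
    Prop where
  eq₁ : ∀ s ∈ V, (1 - k) * W.α s ^ 2 + 3 * W.β lam s ^ 2 + 6 * k * W.α s * W.β lam s
      + k * C * W.α s = W.ndiff l s + mu
  eq₂ : ∀ s ∈ V, (k - 1) * W.ndiff (fun s => W.α s - 6 * W.β lam s) s = W.α s * l s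
  eq₃ : ∀ s ∈ V, W.α s + W.β lam s ≠ 0 →
    3 * (1 - 2 * k) * W.β lam s ^ 2 + (k - 1) * W.α s * W.β lam s - k * C * W.β lam s
      = -(W.ndiff (W.β lam) s * l s / (W.α s + W.β lam s)) + mu
  eq₃' : ∀ s ∈ V,
    3 * (1 - 2 * k) * W.β lam s ^ 2 + (k - 1) * W.α s * W.β lam s - k * C * W.β lam s
      = -(lam * Real.cos (W.θ s) / W.h s * l s) + mu

end WarpedCoflow

end

open scoped Manifold ContDiff TensorProduct

noncomputable section

namespace WarpedCoflow


section Decomposable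

variable {V : Type*} [AddCommGroup V] [Module ℝ V] [TopologicalSpace V]
variable {V' : Type*} [AddCommGroup V'] [Module ℝ V'] [TopologicalSpace V']
variable {A : Type*} [NormedCommRing A] [NormedAlgebra ℝ A]

/-- The wedge product of the `1`-forms `α 0, …, α (k - 1)`. -/
def detForm {k : ℕ} (α : Fin k → V →L[ℝ] A) : V [⋀^Fin k]→L[ℝ] A :=
  { MultilinearMap.alternatization
      ((MultilinearMap.mkPiAlgebra ℝ (Fin k) A).compLinearMap fun i => (α i : V →ₗ[ℝ] A)) with
    cont := by
      change Continuous fun v : Fin k → V => MultilinearMap.alternatization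
        ((MultilinearMap.mkPiAlgebra ℝ (Fin k) A).compLinearMap fun i => (α i : V →ₗ[ℝ] A)) v
      simp only [MultilinearMap.alternatization_apply, MultilinearMap.domDomCongr_apply,
        MultilinearMap.compLinearMap_apply, MultilinearMap.mkPiAlgebra_apply, Units.smul_def]
      fun_prop }

theorem detForm_apply {k : ℕ} (α : Fin k → V →L[ℝ] A) (v : Fin k → V) :
    detForm α v = (Matrix.of fun i j => α i (v j)).det := by
  rw [← Matrix.det_transpose, Matrix.det_apply]
  change MultilinearMap.alternatization
      ((MultilinearMap.mkPiAlgebra ℝ (Fin k) A).compLinearMap fun i => (α i : V →ₗ[ℝ] A)) v = _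
  simp [MultilinearMap.alternatization_apply]

theorem wedge_detForm {k m : ℕ} (α : Fin k → V →L[ℝ] A) (β : Fin m → V →L[ℝ] A) :
    wedge (detForm α) (detForm β) = detForm (Fin.append α β) := by
  ext v
  rw [detForm_apply, ← Matrix.det_submatrix_equiv_self finSumFinEquiv, ← Matrix.det_transpose,
    Matrix.det_apply]
  change LinearMap.mul' ℝ A (((MultilinearMap.alternatization
      ((MultilinearMap.mkPiAlgebra ℝ (Fin k) A).compLinearMap fun i => (α i : V →ₗ[ℝ] A))).domCoprod
      (MultilinearMap.alternatization
      ((MultilinearMap.mkPiAlgebra ℝ (Fin m) A).compLinearMap fun i => (β i : V →ₗ[ℝ] A))))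
      fun i => v (finSumFinEquiv i)) = _
  rw [← MultilinearMap.domCoprod_alternization, MultilinearMap.alternatization_apply, map_sum]
  refine Finset.sum_congr rfl fun σ _ => ?_
  simp [-zsmul_eq_mul, Units.smul_def, Fintype.prod_sum_type]

theorem detForm_perm {k : ℕ} (α : Fin k → V →L[ℝ] A) (σ : Equiv.Perm (Fin k)) :
    detForm (fun i => α (σ i)) = (Equiv.Perm.sign σ : ℤ) • detForm α := by
  ext v
  rw [ContinuousAlternatingMap.smul_apply, detForm_apply, detForm_apply, zsmul_eq_mul]
  exact Matrix.det_permute σ (Matrix.of fun i j => α i (v j))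

theorem detForm_eq_zero {k : ℕ} (α : Fin k → V →L[ℝ] A) {i j : Fin k} (hij : i ≠ j)
    (h : α i = α j) : detForm α = 0 := by
  ext v
  rw [detForm_apply]
  exact Matrix.det_zero_of_row_eq hij (by ext l; simp [h])

theorem wedge_apply {k m : ℕ} (a : V [⋀^Fin k]→L[ℝ] A) (b : V [⋀^Fin m]→L[ℝ] A)
    (v : Fin (k + m) → V) :
    wedge a b v = LinearMap.mul' ℝ A ((a.toAlternatingMap.domCoprod b.toAlternatingMap)
      fun i => v (finSumFinEquiv i)) := rfl

theorem wedge_add_left {k m : ℕ} (a a' : V [⋀^Fin k]→L[ℝ] A) (b : V [⋀^Fin m]→L[ℝ] A) :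
    wedge (a + a') b = wedge a b + wedge a' b := by
  ext v
  simp only [wedge_apply, ContinuousAlternatingMap.add_apply, ← AlternatingMap.domCoprod'_apply,
    ContinuousAlternatingMap.toAlternatingMap_add, TensorProduct.add_tmul, map_add,
    AlternatingMap.add_apply]

theorem wedge_add_right {k m : ℕ} (a : V [⋀^Fin k]→L[ℝ] A) (b b' : V [⋀^Fin m]→L[ℝ] A) :
    wedge a (b + b') = wedge a b + wedge a b' := by
  ext v
  simp only [wedge_apply, ContinuousAlternatingMap.add_apply, ← AlternatingMap.domCoprod'_apply,
    ContinuousAlternatingMap.toAlternatingMap_add, TensorProduct.tmul_add, map_add,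
    AlternatingMap.add_apply]

theorem wedge_smul_left {k m : ℕ} (c : ℝ) (a : V [⋀^Fin k]→L[ℝ] A) (b : V [⋀^Fin m]→L[ℝ] A) :
    wedge (c • a) b = c • wedge a b := by
  ext v
  simp only [wedge_apply, ContinuousAlternatingMap.smul_apply, ← AlternatingMap.domCoprod'_apply,
    ContinuousAlternatingMap.toAlternatingMap_smul, ← TensorProduct.smul_tmul', map_smul,
    AlternatingMap.smul_apply]

theorem wedge_smul_right {k m : ℕ} (c : ℝ) (a : V [⋀^Fin k]→L[ℝ] A) (b : V [⋀^Fin m]→L[ℝ] A) :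
    wedge a (c • b) = c • wedge a b := by
  ext v
  simp only [wedge_apply, ContinuousAlternatingMap.smul_apply, ← AlternatingMap.domCoprod'_apply,
    ContinuousAlternatingMap.toAlternatingMap_smul, TensorProduct.tmul_smul, map_smul,
    AlternatingMap.smul_apply]

/-- The wedge product as a bilinear map. -/
def wedgeₗ (k m : ℕ) :
    (V [⋀^Fin k]→L[ℝ] A) →ₗ[ℝ] (V [⋀^Fin m]→L[ℝ] A) →ₗ[ℝ] (V [⋀^Fin (k + m)]→L[ℝ] A) :=
  LinearMap.mk₂ ℝ wedge wedge_add_left wedge_smul_left wedge_add_right wedge_smul_right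

theorem wedge_comp {k m : ℕ} (a : V [⋀^Fin k]→L[ℝ] A) (b : V [⋀^Fin m]→L[ℝ] A) (L : V' →L[ℝ] V) :
    (wedge a b).compContinuousLinearMap L =
      wedge (a.compContinuousLinearMap L) (b.compContinuousLinearMap L) := by
  ext v
  rw [ContinuousAlternatingMap.compContinuousLinearMap_apply, wedge_apply, wedge_apply]
  congr 1
  simp only [AlternatingMap.domCoprod_apply, sum_apply]
  refine Finset.sum_congr rfl fun σ _ => ?_
  induction σ using Quotient.inductionOn' with
  | h σ => rfl

end Decomposable


section Frames

theorem multilinear_apply_eq_sum {V : Type*} [AddCommGroup V] [Module ℝ V] [FiniteDimensional ℝ V]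
    {k : ℕ} {ι : Type*}
    (L : MultilinearMap ℝ (fun _ : Fin k => V) ℝ) (e : ι → V) (s : Fin k → ι) :
    L (fun c => e (s c)) = ∑ i : Fin k → Fin (Module.finrank ℝ V),
      (∏ c, (Module.finBasis ℝ V).repr (e (s c)) (i c)) *
        L fun c => Module.finBasis ℝ V (i c) := by
  conv_lhs => rw [show (fun c => e (s c)) = fun c => ∑ p, (Module.finBasis ℝ V).repr (e (s c)) p •
    Module.finBasis ℝ V p from funext fun c => ((Module.finBasis ℝ V).sum_repr _).symm]
  rw [MultilinearMap.map_sum]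
  simp only [MultilinearMap.map_smul_univ, smul_eq_mul]

variable {V : Type*} [AddCommGroup V] [Module ℝ V] [TopologicalSpace V]
variable {F : Type*} [NormedAddCommGroup F] [NormedSpace ℝ F]

theorem append_finSumFinEquiv {X : Type*} {k m : ℕ} (u : Fin k → X) (v : Fin m → X)
    (x : Fin k ⊕ Fin m) : Fin.append u v (finSumFinEquiv x) = Sum.elim u v x := by
  cases x <;> simp

theorem contract_apply {m k : ℕ} (v : Fin k → V) (a : V [⋀^Fin (m + k)]→L[ℝ] F) (w : Fin m → V) :
    contract v a w = a fun i => Fin.append v w (Fin.cast (add_comm m k) i) := by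
  induction k with
  | zero =>
    change a w = _
    congr 1
    ext i
    have : Fin.cast (add_comm m 0) i = Fin.natAdd 0 i := by ext; simp
    rw [this, Fin.append_right]
  | succ k ih =>
    change contract (Fin.tail v) (interiorProd (v 0) a) w = _
    rw [ih]
    change a (Fin.cons (v 0) _) = _
    congr 1
    ext i
    refine Fin.cases ?_ (fun j => ?_) i
    · have : Fin.cast (add_comm m (k + 1)) 0 = Fin.castAdd m (0 : Fin (k + 1)) := by ext; simp
      rw [Fin.cons_zero]
      erw [this, Fin.append_left]
    · rw [Fin.cons_succ]
      rcases lt_or_ge (j : ℕ) k with h | h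
      · have h1 : Fin.cast (add_comm m k) j = Fin.castAdd m (⟨j, h⟩ : Fin k) := by ext; simp
        have h2 : Fin.cast (add_comm m (k + 1)) j.succ =
          Fin.castAdd m (⟨j + 1, by omega⟩ : Fin (k + 1)) := by ext; simp
        rw [h1, Fin.append_left]
        erw [h2, Fin.append_left]
        rfl
      · have hj : (j : ℕ) < m + k := j.2
        have h1 : Fin.cast (add_comm m k) j = Fin.natAdd k (⟨j - k, by omega⟩ : Fin m) := by
          ext; simp; omega
        have h2 : Fin.cast (add_comm m (k + 1)) j.succ =
          Fin.natAdd (k + 1) (⟨j - k, by omega⟩ : Fin m) := by ext; simp; omega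
        rw [h1, Fin.append_right]
        erw [h2, Fin.append_right]

/-- `e` is a frame of `V` with dual coframe `ε`. -/
structure IsFrame {n : ℕ} (e : Fin n → V) (ε : Fin n → V →L[ℝ] ℝ) : Prop where
  dual : ∀ i j, ε i (e j) = if i = j then 1 else 0
  expand : ∀ v, v = ∑ i, ε i v • e i

/-- `e` is an orthonormal frame for `g` with dual coframe `ε`. -/
structure IsOrthonormalFrame {n : ℕ} (g : V →L[ℝ] V →L[ℝ] ℝ) (e : Fin n → V)
    (ε : Fin n → V →L[ℝ] ℝ) : Prop extends IsFrame e ε where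
  metric : ∀ u v, g u v = ∑ i, ε i u * ε i v

variable {n : ℕ} {g : V →L[ℝ] V →L[ℝ] ℝ} {e : Fin n → V} {ε : Fin n → V →L[ℝ] ℝ}

theorem IsOrthonormalFrame.inverseMetric_apply [FiniteDimensional ℝ V]
    (h : IsOrthonormalFrame g e ε) (p q : Fin (Module.finrank ℝ V)) :
    inverseMetric g p q =
      ∑ i, (Module.finBasis ℝ V).repr (e i) p * (Module.finBasis ℝ V).repr (e i) q := by
  set b := Module.finBasis ℝ V with hb
  set P : Matrix (Fin n) (Fin (Module.finrank ℝ V)) ℝ := Matrix.of fun i p => b.repr (e i) p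
  set Q : Matrix (Fin n) (Fin (Module.finrank ℝ V)) ℝ := Matrix.of fun i p => ε i (b p)
  have hQP : Q * P.transpose = 1 := by
    ext i j
    have : ε i (∑ p, b.repr (e j) p • b p) = _ := congrArg (ε i) (b.sum_repr (e j))
    rw [h.dual, map_sum] at this
    simp only [map_smul, smul_eq_mul] at this
    rw [Matrix.one_apply, ← this, Matrix.mul_apply]
    exact Finset.sum_congr rfl fun p _ => mul_comm _ _
  have hPQ : P.transpose * Q = 1 := by
    ext q p
    have := congrArg (fun v => b.repr v q) (h.expand (b p))
    simp only [map_sum, map_smul, Module.Basis.repr_self, Finsupp.coe_finsetSum,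
      Finset.sum_apply, Finsupp.smul_apply, smul_eq_mul, Finsupp.single_apply] at this
    rw [Matrix.one_apply, Matrix.mul_apply,
      show (if q = p then (1 : ℝ) else 0) = if p = q then 1 else 0 by simp [eq_comm], this]
    exact Finset.sum_congr rfl fun i _ => mul_comm _ _
  have hG : (Matrix.of fun i j => g (b i) (b j)) = Q.transpose * Q := by
    ext p q
    simp [Matrix.mul_apply, Q, h.metric]
  have : (Q.transpose * Q) * (P.transpose * P) = 1 := by
    rw [Matrix.mul_assoc, ← Matrix.mul_assoc Q, hQP, Matrix.one_mul,
      ← Matrix.transpose_transpose P, ← Matrix.transpose_mul, hPQ, Matrix.transpose_one]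
  rw [inverseMetric, ← hb, hG, Matrix.inv_eq_right_inv this]
  simp [Matrix.mul_apply, P]

theorem IsOrthonormalFrame.sum_inverseMetric [FiniteDimensional ℝ V]
    (h : IsOrthonormalFrame g e ε) {k : ℕ} (L M : MultilinearMap ℝ (fun _ : Fin k => V) ℝ) :
    ∑ i : Fin k → Fin (Module.finrank ℝ V), ∑ j : Fin k → Fin (Module.finrank ℝ V),
      (∏ c, inverseMetric g (i c) (j c)) * (L fun c => Module.finBasis ℝ V (i c)) *
        (M fun c => Module.finBasis ℝ V (j c)) =
    ∑ s : Fin k → Fin n, L (fun c => e (s c)) * M fun c => e (s c) := by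
  simp only [multilinear_apply_eq_sum _ e, h.inverseMetric_apply, Finset.prod_univ_sum,
    Fintype.piFinset_univ, Finset.sum_mul_sum]
  simp only [Finset.sum_mul]
  rw [Finset.sum_comm' (t' := Finset.univ) (s' := fun _ => Finset.univ) (by simp)]
  rw [eq_comm, Finset.sum_comm]
  rw [eq_comm, Finset.sum_comm]
  refine Finset.sum_congr rfl fun i _ => ?_
  rw [eq_comm, Finset.sum_comm]
  refine Finset.sum_congr rfl fun j _ => Finset.sum_congr rfl fun s _ => ?_
  rw [Finset.prod_mul_distrib]
  ring

/-- The `k`-form `ε (s 0) ∧ … ∧ ε (s (k - 1))`. -/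
def coframeForm (ε : Fin n → V →L[ℝ] ℝ) {k : ℕ} (s : Fin k → Fin n) : V [⋀^Fin k]→L[ℝ] ℝ :=
  detForm fun i => ε (s i)

theorem IsFrame.sum_coframeForm_mul (h : IsFrame e ε) {k : ℕ} (t : Fin k → Fin n)
    (B : (Fin k → V) → ℝ)
    (hB : ∀ (w : Fin k → V) (σ : Equiv.Perm (Fin k)),
      B (fun i => w (σ i)) = (Equiv.Perm.sign σ : ℤ) * B w) :
    ∑ s : Fin k → Fin n, coframeForm ε t (fun c => e (s c)) * B (fun c => e (s c)) =
      k.factorial * B fun c => e (t c) := by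
  have h1 : ∀ s : Fin k → Fin n, coframeForm ε t (fun c => e (s c)) =
      ∑ σ : Equiv.Perm (Fin k), ((Equiv.Perm.sign σ : ℤ) : ℝ) * if (fun i => t
          (σ i)) = s then 1 else 0 := by
    intro s
    rw [coframeForm, detForm_apply, Matrix.det_apply]
    refine Finset.sum_congr rfl fun σ _ => ?_
    simp only [Matrix.of_apply, h.dual, Units.smul_def, zsmul_eq_mul, Finset.prod_ite_zero,
      Finset.prod_const_one, funext_iff, Finset.mem_univ, true_imp_iff]
  simp only [h1, Finset.sum_mul]
  rw [Finset.sum_comm]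
  have h2 : ∀ σ : Equiv.Perm (Fin k), ∑ s : Fin k → Fin n,
      (((Equiv.Perm.sign σ : ℤ) : ℝ) * if (fun i => t (σ i)) = s then 1 else 0) *
        B (fun c => e (s c)) = B fun c => e (t c) := by
    intro σ
    simp only [mul_assoc, ite_mul, one_mul, zero_mul, ← Finset.mul_sum, Finset.sum_ite_eq,
      Finset.mem_univ, if_true]
    rw [hB (fun c => e (t c)) σ, ← mul_assoc, ← Int.cast_mul, ← Units.val_mul,
      Int.units_mul_self]
    simp
  rw [Finset.sum_congr rfl fun σ _ => h2 σ]
  simp [Fintype.card_perm]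

theorem map_perm_real {k : ℕ} (B : V [⋀^Fin k]→L[ℝ] ℝ) (w : Fin k → V) (σ : Equiv.Perm (Fin k)) :
    B (fun i => w (σ i)) = (Equiv.Perm.sign σ : ℤ) * B w := by
  have := B.toAlternatingMap.map_perm w σ
  rw [Units.smul_def, zsmul_eq_mul] at this
  exact this

theorem IsFrame.eq_sum (h : IsFrame e ε) {k : ℕ} (a : V [⋀^Fin k]→L[ℝ] ℝ) :
    a = (k.factorial : ℝ)⁻¹ •
      ∑ s : Fin k → Fin n, a (fun c => e (s c)) • coframeForm ε s := by
  ext v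
  rw [ContinuousAlternatingMap.smul_apply, ContinuousAlternatingMap.sum_apply, smul_eq_mul,
    eq_inv_mul_iff_mul_eq₀ (by positivity)]
  have h1 : ∀ σ : Equiv.Perm (Fin k), ∑ s : Fin k → Fin n, a (fun c => e (s c)) *
      ((Equiv.Perm.sign σ : ℤ) * ∏ i, ε (s (σ i)) (v i)) = a v := by
    intro σ
    have hv : a v = ∑ s : Fin k → Fin n, (∏ i, ε (s i) (v i)) * a fun c => e (s c) := by
      conv_lhs => rw [show v = fun c => ∑ i, ε i (v c) • e i from funext fun c => h.expand (v c)]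
      have := a.toMultilinearMap.map_sum (g := fun c i => ε i (v c) • e i)
      refine this.trans (Finset.sum_congr rfl fun s _ => ?_)
      exact a.toMultilinearMap.map_smul_univ _ _
    rw [hv, ← (Equiv.arrowCongr σ.symm (Equiv.refl (Fin n))).sum_comp
      fun s => (∏ i, ε (s i) (v i)) * a fun c => e (s c)]
    refine Finset.sum_congr rfl fun s _ => ?_
    simp only [Equiv.arrowCongr_apply, Equiv.coe_refl, Function.comp_apply, id_eq, Equiv.symm_symm]
    rw [map_perm_real a (fun c => e (s c)) σ]
    ring
  have h2 : ∀ s : Fin k → Fin n, coframeForm ε s v =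
      ∑ σ : Equiv.Perm (Fin k), ((Equiv.Perm.sign σ : ℤ) * ∏ i, ε (s (σ i)) (v i)) := by
    intro s
    rw [coframeForm, detForm_apply, Matrix.det_apply]
    simp [Units.smul_def]
  simp only [ContinuousAlternatingMap.smul_apply, h2, smul_eq_mul, Finset.mul_sum]
  rw [Finset.sum_comm, Finset.sum_congr rfl fun σ _ => h1 σ]
  simp [Fintype.card_perm]

theorem IsOrthonormalFrame.hodgeStar_apply [FiniteDimensional ℝ V] [IsTopologicalAddGroup V]
    [ContinuousSMul ℝ V] (h : IsOrthonormalFrame g e ε) {k m : ℕ} (vol : V [⋀^Fin (m + k)]→L[ℝ] ℝ)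
    (a : V [⋀^Fin k]→L[ℝ] ℝ) (v : Fin m → V) :
    hodgeStar g vol a v = (k.factorial : ℝ)⁻¹ * ∑ s : Fin k → Fin n,
      a (fun c => e (s c)) *
        vol fun i => Fin.append (fun c => e (s c)) v (Fin.cast (add_comm m k) i) := by
  let M : MultilinearMap ℝ (fun _ : Fin k => V) ℝ :=
    ({ toFun := fun f => f v
       map_add' := fun _ _ => rfl
       map_smul' := fun _ _ => rfl } :
      MultilinearMap ℝ (fun _ : Fin m => V) ℝ →ₗ[ℝ] ℝ).compMultilinearMap
          (vol.toMultilinearMap.domDomCongr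
      ((finCongr (add_comm m k)).trans finSumFinEquiv.symm)).currySum
  have hM : ∀ w : Fin k → V,
      M w = vol fun i => Fin.append w v (Fin.cast (add_comm m k) i) := by
    intro w
    change vol (fun i => Sum.elim w v _) = _
    congr 1
    ext i
    rw [← append_finSumFinEquiv]
    simp
  have key := h.sum_inverseMetric M a.toMultilinearMap
  rw [hodgeStar, ContinuousAlternatingMap.smul_apply, smul_eq_mul]
  congr 1
  simp only [ContinuousAlternatingMap.sum_apply, ContinuousAlternatingMap.smul_apply,
      contract_apply,
    smul_eq_mul, ← hM]
  calc _ = _ := by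
        refine Finset.sum_congr rfl fun i _ => Finset.sum_congr rfl fun j _ => ?_
        rw [mul_right_comm]
        rfl
    _ = _ := key
    _ = _ := Finset.sum_congr rfl fun s _ => mul_comm _ _

theorem IsOrthonormalFrame.hodgeStar_coframeForm [FiniteDimensional ℝ V] [IsTopologicalAddGroup V]
    [ContinuousSMul ℝ V] {m k : ℕ} {e : Fin (m + k) → V} {ε : Fin (m + k) → V →L[ℝ] ℝ}
    (h : IsOrthonormalFrame g e ε) (t : Fin k → Fin (m + k)) (t' : Fin m → Fin (m + k))
    (σ : Equiv.Perm (Fin (m + k)))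
    (hσ : ∀ i, σ i = Fin.append t t' (Fin.cast (add_comm m k) i)) :
    hodgeStar g (detForm ε) (coframeForm ε t) = (Equiv.Perm.sign σ : ℤ) • coframeForm ε t' := by
  ext v
  rw [h.hodgeStar_apply, h.sum_coframeForm_mul t (fun w => detForm ε
    fun i => Fin.append w v (Fin.cast (add_comm m k) i)), ← mul_assoc,
    inv_mul_cancel₀ (by positivity), one_mul]
  · rw [ContinuousAlternatingMap.smul_apply, zsmul_eq_mul, coframeForm, detForm_apply,
      detForm_apply]
    set N : Matrix (Fin (m + k)) (Fin (m + k)) ℝ := Matrix.of fun i j =>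
      ε i (Fin.append (fun c => e (t c)) v (Fin.cast (add_comm m k) j)) with hN
    let E : Fin k ⊕ Fin m ≃ Fin (m + k) := finSumFinEquiv.trans (finCongr (add_comm k m))
    have hE : ∀ x, σ (E x) = Sum.elim t t' x := fun x => by
      rw [hσ, ← append_finSumFinEquiv]
      rfl
    have hN' : ∀ i x, N i (E x) = ε i (Sum.elim (fun c => e (t c)) v x) := fun i x => by
      rw [← append_finSumFinEquiv]
      rfl
    have hblock : (N.submatrix σ id).submatrix E E = Matrix.fromBlocks 1
        (Matrix.of fun i j => ε (t i) (v j)) 0 (Matrix.of fun i j => ε (t' i) (v j)) := by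
      ext x y
      rw [Matrix.submatrix_apply, Matrix.submatrix_apply, id_eq, hE, hN']
      rcases x with x | x <;> rcases y with y | y
      · have : t x = t y ↔ x = y := by
          have := hE (Sum.inl x)
          have h' := hE (Sum.inl y)
          simp only [Sum.elim_inl] at this h'
          rw [← this, ← h']
          simp
        simp [h.dual, Matrix.one_apply, this]
      · simp
      · have : t' x ≠ t y := by
          have := hE (Sum.inr x)
          have h' := hE (Sum.inl y)
          simp only [Sum.elim_inl, Sum.elim_inr] at this h'
          rw [← this, ← h']
          simp
        simp [h.dual, this]
      · simp
    have hdet := Matrix.det_permute σ N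
    rw [← Matrix.det_submatrix_equiv_self E, hblock, Matrix.det_fromBlocks_zero₂₁, Matrix.det_one,
      one_mul] at hdet
    rw [hdet, ← mul_assoc, ← Int.cast_mul, ← Units.val_mul, Int.units_mul_self]
    simp
  · intro w τ
    let E : Fin k ⊕ Fin m ≃ Fin (m + k) := finSumFinEquiv.trans (finCongr (add_comm k m))
    have hE : ∀ (u : Fin k → V) x, Fin.append u v (Fin.cast (add_comm m k) (E x)) =
      Sum.elim u v x := fun u x => by
        rw [← append_finSumFinEquiv]
        rfl
    have := map_perm_real (detForm ε) (fun i => Fin.append w v (Fin.cast (add_comm m k) i))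
      (E.permCongr (Equiv.sumCongr τ (Equiv.refl _)))
    rw [Equiv.Perm.sign_permCongr] at this
    rw [show Equiv.Perm.sign τ = Equiv.Perm.sign (Equiv.sumCongr τ (Equiv.refl (Fin m))) by
      simp, ← this]
    congr 1
    ext i
    obtain ⟨x, rfl⟩ := E.surjective i
    rw [hE]
    simp only [Equiv.permCongr_apply, Equiv.symm_apply_apply, hE]
    cases x <;> simp

end Frames


section CovectorWedge

variable {V : Type*} [AddCommGroup V] [Module ℝ V] [TopologicalSpace V]
variable {V' : Type*} [AddCommGroup V'] [Module ℝ V'] [TopologicalSpace V']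

/-- The wedge product `ρ ∧ a` of a covector and a form. -/
def covectorWedge {k : ℕ} (ρ : V →L[ℝ] ℝ) (a : V [⋀^Fin k]→L[ℝ] ℝ) : V [⋀^Fin (k + 1)]→L[ℝ] ℝ :=
  { AlternatingMap.alternatizeUncurryFin ((ρ : V →ₗ[ℝ] ℝ).smulRight a.toAlternatingMap) with
    cont := by
      change Continuous fun v : Fin (k + 1) → V => AlternatingMap.alternatizeUncurryFin
        ((ρ : V →ₗ[ℝ] ℝ).smulRight a.toAlternatingMap) v
      simp only [AlternatingMap.alternatizeUncurryFin_apply]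
      refine continuous_finsetSum _ fun i _ => ?_
      change Continuous fun v : Fin (k + 1) → V => (-1 : ℤ) ^ (i : ℕ) • (ρ (v i) * a
          (i.removeNth v))
      have h : Continuous fun v : Fin (k + 1) → V => i.removeNth v :=
        continuous_pi fun j => continuous_apply (i.succAbove j)
      have h' : Continuous fun v : Fin (k + 1) → V => ρ (v i) * a (i.removeNth v) :=
        (ρ.continuous.comp (continuous_apply i)).mul (a.cont.comp h)
      exact h'.const_smul ((-1 : ℤ) ^ (i : ℕ)) }

theorem covectorWedge_apply {k : ℕ} (ρ : V →L[ℝ] ℝ) (a : V [⋀^Fin k]→L[ℝ] ℝ)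
    (v : Fin (k + 1) → V) :
    covectorWedge ρ a v = ∑ i : Fin (k + 1), (-1) ^ (i : ℕ) * ρ (v i) * a (i.removeNth v) := by
  change AlternatingMap.alternatizeUncurryFin
        ((ρ : V →ₗ[ℝ] ℝ).smulRight a.toAlternatingMap) v = _
  rw [AlternatingMap.alternatizeUncurryFin_apply]
  refine Finset.sum_congr rfl fun i _ => ?_
  simp [mul_assoc]

theorem covectorWedge_add {k : ℕ} (ρ : V →L[ℝ] ℝ) (a b : V [⋀^Fin k]→L[ℝ] ℝ) :
    covectorWedge ρ (a + b) = covectorWedge ρ a + covectorWedge ρ b := by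
  ext v
  simp [covectorWedge_apply, mul_add, Finset.sum_add_distrib]

theorem covectorWedge_smul {k : ℕ} (c : ℝ) (ρ : V →L[ℝ] ℝ) (a : V [⋀^Fin k]→L[ℝ] ℝ) :
    covectorWedge ρ (c • a) = c • covectorWedge ρ a := by
  ext v
  simp only [covectorWedge_apply, ContinuousAlternatingMap.smul_apply, smul_eq_mul,
    Finset.mul_sum]
  exact Finset.sum_congr rfl fun i _ => by ring

theorem smul_covectorWedge {k : ℕ} [ContinuousConstSMul ℝ V] (c : ℝ) (ρ : V →L[ℝ] ℝ)
    (a : V [⋀^Fin k]→L[ℝ] ℝ) :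
    covectorWedge (c • ρ) a = c • covectorWedge ρ a := by
  ext v
  simp only [covectorWedge_apply, ContinuousAlternatingMap.smul_apply, smul_eq_mul,
    Finset.mul_sum, smul_apply]
  exact Finset.sum_congr rfl fun i _ => by ring

theorem covectorWedge_comp {k : ℕ} (ρ : V →L[ℝ] ℝ) (a : V [⋀^Fin k]→L[ℝ] ℝ) (T : V' →L[ℝ] V) :
    (covectorWedge ρ a).compContinuousLinearMap T =
      covectorWedge (ρ.comp T) (a.compContinuousLinearMap T) := by
  ext v
  simp only [covectorWedge_apply, ContinuousAlternatingMap.compContinuousLinearMap_apply]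
  rfl

theorem covectorWedge_detForm {k : ℕ} (ρ : V →L[ℝ] ℝ) (α : Fin k → V →L[ℝ] ℝ) :
    covectorWedge ρ (detForm α) = detForm (Fin.cons ρ α : Fin (k + 1) → V →L[ℝ] ℝ) := by
  ext v
  rw [covectorWedge_apply, detForm_apply, Matrix.det_succ_row_zero]
  refine Finset.sum_congr rfl fun i _ => ?_
  rw [detForm_apply]
  rfl

theorem ofSubsingleton_eq_detForm (ρ : V →L[ℝ] ℝ) :
    ContinuousAlternatingMap.ofSubsingleton ℝ V ℝ (0 : Fin 1) ρ = detForm fun _ => ρ := by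
  ext v
  simp [detForm_apply]

theorem IsFrame.induction {n : ℕ} {e : Fin n → V} {ε : Fin n → V →L[ℝ] ℝ} (h : IsFrame e ε)
    {k : ℕ} {P : V [⋀^Fin k]→L[ℝ] ℝ → Prop} (hadd : ∀ a b, P a → P b → P (a + b))
    (hsmul : ∀ (c : ℝ) a, P a → P (c • a)) (hdet : ∀ α, P (detForm α)) (a : V [⋀^Fin k]→L[ℝ] ℝ) :
    P a := by
  rw [h.eq_sum a]
  refine hsmul _ _ (Finset.sum_induction _ P hadd ?_ fun s _ => hsmul _ _ (hdet _))
  simpa using hsmul 0 _ (hdet fun _ => 0)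

theorem IsFrame.wedge_covector_left {n : ℕ} {e : Fin n → V} {ε : Fin n → V →L[ℝ] ℝ}
    (h : IsFrame e ε) {k : ℕ} (ρ : V →L[ℝ] ℝ) (a : V [⋀^Fin k]→L[ℝ] ℝ) (v : Fin (1 + k) → V) :
    wedge (ContinuousAlternatingMap.ofSubsingleton ℝ V ℝ (0 : Fin 1) ρ) a v =
      covectorWedge ρ a fun i => v (Fin.cast (add_comm k 1) i) := by
  induction a using h.induction with
  | hadd a b ha hb =>
    rw [wedge_add_right, covectorWedge_add, ContinuousAlternatingMap.add_apply, ha, hb]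
    rfl
  | hsmul c a ha =>
    rw [wedge_smul_right, covectorWedge_smul, ContinuousAlternatingMap.smul_apply, ha]
    rfl
  | hdet α =>
    rw [covectorWedge_detForm, ofSubsingleton_eq_detForm, wedge_detForm, detForm_apply,
      detForm_apply, ← Matrix.det_submatrix_equiv_self (finCongr (add_comm k 1)),
      Fin.append_left_eq_cons]
    rfl

theorem detForm_snoc {k : ℕ} (ρ : V →L[ℝ] ℝ) (α : Fin k → V →L[ℝ] ℝ) :
    detForm (Fin.snoc α ρ : Fin (k + 1) → V →L[ℝ] ℝ) =
      ((-1) ^ k : ℝ) • detForm (Fin.cons ρ α : Fin (k + 1) → V →L[ℝ] ℝ) := by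
  have := detForm_perm (Fin.cons ρ α : Fin (k + 1) → V →L[ℝ] ℝ) (finRotate (k + 1))
  rw [sign_finRotate] at this
  rw [Fin.snoc_eq_cons_rotate, this]
  ext v
  simp

theorem IsFrame.wedge_covector_right {n : ℕ} {e : Fin n → V} {ε : Fin n → V →L[ℝ] ℝ}
    (h : IsFrame e ε) {k : ℕ} (ρ : V →L[ℝ] ℝ) (a : V [⋀^Fin k]→L[ℝ] ℝ) :
    wedge a (ContinuousAlternatingMap.ofSubsingleton ℝ V ℝ (0 : Fin 1) ρ) =
      ((-1) ^ k : ℝ) • covectorWedge ρ a := by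
  induction a using h.induction with
  | hadd a b ha hb => rw [wedge_add_left, covectorWedge_add, ha, hb, smul_add]
  | hsmul c a ha => rw [wedge_smul_left, covectorWedge_smul, ha, smul_comm]
  | hdet α =>
    rw [covectorWedge_detForm, ofSubsingleton_eq_detForm, wedge_detForm, Fin.append_right_eq_snoc,
      detForm_snoc]

end CovectorWedge

section Model

variable {V : Type*} [AddCommGroup V] [Module ℝ V] [TopologicalSpace V]
variable {V' : Type*} [AddCommGroup V'] [Module ℝ V'] [TopologicalSpace V']

/-- The standard Hermitian form `α⁰¹ + α²³ + α⁴⁵`. -/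
def stdKahler (α : Fin 6 → V →L[ℝ] ℝ) : V [⋀^Fin 2]→L[ℝ] ℝ :=
  detForm ![α 0, α 1] + detForm ![α 2, α 3] + detForm ![α 4, α 5]

/-- Half the square of the standard Hermitian form, `α⁰¹²³ + α⁰¹⁴⁵ + α²³⁴⁵`. -/
def stdKahlerSq (α : Fin 6 → V →L[ℝ] ℝ) : V [⋀^Fin 4]→L[ℝ] ℝ :=
  detForm ![α 0, α 1, α 2, α 3] + detForm ![α 0, α 1, α 4, α 5] + detForm ![α 2, α 3, α 4, α 5]

/-- The complex covector `α + i β`. -/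
def complexCovector (α β : V →L[ℝ] ℝ) : V →L[ℝ] ℂ :=
  { toFun := fun v => (α v : ℂ) + Complex.I * (β v : ℂ)
    map_add' := fun u v => by simp; ring
    map_smul' := fun c v => by simp; ring
    cont := by fun_prop }

/-- The standard complex volume form `(α⁰ + i α¹) ∧ (α² + i α³) ∧ (α⁴ + i α⁵)`. -/
def stdOmega (α : Fin 6 → V →L[ℝ] ℝ) : V [⋀^Fin 3]→L[ℝ] ℂ :=
  detForm ![complexCovector (α 0) (α 1), complexCovector (α 2) (α 3), complexCovector (α 4) (α 5)]

/-- The real part of the standard complex volume form. -/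
def stdRe (α : Fin 6 → V →L[ℝ] ℝ) : V [⋀^Fin 3]→L[ℝ] ℝ :=
  detForm ![α 0, α 2, α 4] - detForm ![α 0, α 3, α 5] - detForm ![α 1, α 2, α 5]
    - detForm ![α 1, α 3, α 4]

/-- The imaginary part of the standard complex volume form. -/
def stdIm (α : Fin 6 → V →L[ℝ] ℝ) : V [⋀^Fin 3]→L[ℝ] ℝ :=
  detForm ![α 0, α 2, α 5] + detForm ![α 0, α 3, α 4] + detForm ![α 1, α 2, α 4]
    - detForm ![α 1, α 3, α 5]

theorem stdOmega_apply (α : Fin 6 → V →L[ℝ] ℝ) (v : Fin 3 → V) :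
    stdOmega α v = (stdRe α v : ℂ) + Complex.I * (stdIm α v : ℂ) := by
  simp only [stdOmega, stdRe, stdIm, ContinuousAlternatingMap.sub_apply,
    ContinuousAlternatingMap.add_apply, detForm_apply, Matrix.det_fin_three, Matrix.of_apply,
    Matrix.cons_val]
  simp only [complexCovector, ContinuousLinearMap.coe_mk', LinearMap.coe_mk, AddHom.coe_mk]
  apply Complex.ext
  · simp; ring
  · simp; ring

theorem re_stdOmega (α : Fin 6 → V →L[ℝ] ℝ) :
    Complex.reCLM.compContinuousAlternatingMap (stdOmega α) = stdRe α := by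
  ext v
  simp [stdOmega_apply]

theorem im_stdOmega (α : Fin 6 → V →L[ℝ] ℝ) :
    Complex.imCLM.compContinuousAlternatingMap (stdOmega α) = stdIm α := by
  ext v
  simp [stdOmega_apply]

theorem append_two_two {X : Type*} (a b c d : X) : Fin.append ![a, b] ![c, d] = ![a, b, c, d] := by
  ext i; fin_cases i <;> rfl

theorem append_four_two {X : Type*} (a b c d e f : X) :
    Fin.append ![a, b, c, d] ![e, f] = ![a, b, c, d, e, f] := by
  ext i; fin_cases i <;> rfl

theorem append_three_three {X : Type*} (a b c d e f : X) :
    Fin.append ![a, b, c] ![d, e, f] = ![a, b, c, d, e, f] := by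
  ext i; fin_cases i <;> rfl

theorem detForm_rotate_two {A : Type*} [NormedCommRing A] [NormedAlgebra ℝ A]
    (a b c d : V →L[ℝ] A) : detForm ![c, d, a, b] = detForm ![a, b, c, d] := by
  have := detForm_perm ![a, b, c, d] (⟨![2, 3, 0, 1], ![2, 3, 0, 1], by decide, by decide⟩)
  rw [show Equiv.Perm.sign (⟨![2, 3, 0, 1], ![2, 3, 0, 1], by decide, by decide⟩ :
    Equiv.Perm (Fin 4)) = 1 by decide] at this
  simp only [Units.val_one, one_smul] at this
  rw [← this]
  congr 1
  ext i; fin_cases i <;> rfl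

theorem wedge_stdKahler (α : Fin 6 → V →L[ℝ] ℝ) :
    wedge (stdKahler α) (stdKahler α) = (2 : ℝ) • stdKahlerSq α := by
  have z : ∀ a b : V →L[ℝ] ℝ, detForm ![a, b, a, b] = 0 := fun a b =>
    detForm_eq_zero _ (i := 0) (j := 2) (by decide) rfl
  simp only [stdKahler, stdKahlerSq, wedge_add_left, wedge_add_right, wedge_detForm, append_two_two,
    z,
    detForm_rotate_two (α 0) (α 1) (α 2) (α 3), detForm_rotate_two (α 0) (α 1) (α 4) (α 5),
    detForm_rotate_two (α 2) (α 3) (α 4) (α 5)]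
  module

theorem wedge_stdKahlerSq_stdKahler (α : Fin 6 → V →L[ℝ] ℝ) :
    wedge (stdKahlerSq α) (stdKahler α) = (3 : ℝ) • detForm α := by
  have z1 : ∀ a b c d : V →L[ℝ] ℝ, detForm ![a, b, c, d, a, b] = 0 := fun a b c d =>
    detForm_eq_zero _ (i := 0) (j := 4) (by decide) rfl
  have z2 : ∀ a b c d : V →L[ℝ] ℝ, detForm ![a, b, c, d, c, d] = 0 := fun a b c d =>
    detForm_eq_zero _ (i := 2) (j := 4) (by decide) rfl
  have h0 : detForm ![α 0, α 1, α 2, α 3, α 4, α 5] = detForm α := by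
    congr 1
    ext i; fin_cases i <;> rfl
  have h1 : detForm ![α 0, α 1, α 4, α 5, α 2, α 3] = detForm α := by
    have := detForm_perm α (⟨![0, 1, 4, 5, 2, 3], ![0, 1, 4, 5, 2, 3], by decide, by decide⟩)
    rw [show Equiv.Perm.sign (⟨![0, 1, 4, 5, 2, 3], ![0, 1, 4, 5, 2, 3], by decide, by decide⟩ :
      Equiv.Perm (Fin 6)) = 1 by decide] at this
    simp only [Units.val_one, one_smul] at this
    rw [← this]
    congr 1
    ext i; fin_cases i <;> rfl
  have h2 : detForm ![α 2, α 3, α 4, α 5, α 0, α 1] = detForm α := by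
    have := detForm_perm α (⟨![2, 3, 4, 5, 0, 1], ![4, 5, 0, 1, 2, 3], by decide, by decide⟩)
    rw [show Equiv.Perm.sign (⟨![2, 3, 4, 5, 0, 1], ![4, 5, 0, 1, 2, 3], by decide, by decide⟩ :
      Equiv.Perm (Fin 6)) = 1 by decide] at this
    simp only [Units.val_one, one_smul] at this
    rw [← this]
    congr 1
    ext i; fin_cases i <;> rfl
  simp only [stdKahler, stdKahlerSq, wedge_add_left, wedge_add_right, wedge_detForm,
    append_four_two, z1, z2, h0, h1, h2]
  module

end Model


section AdaptedFrame

theorem stdKahler_cube {V : Type*} [AddCommGroup V] [Module ℝ V] [TopologicalSpace V]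
    (α : Fin 6 → V →L[ℝ] ℝ) :
    (1 / 6 : ℝ) • wedge (wedge (stdKahler α) (stdKahler α)) (stdKahler α) = detForm α := by
  have h : wedge (wedge (stdKahler α) (stdKahler α)) (stdKahler α) = (6 : ℝ) • detForm α := by
    refine (congrArg (fun a : V [⋀^Fin 4]→L[ℝ] ℝ => wedge a (stdKahler α))
      (wedge_stdKahler α)).trans ((wedge_smul_left _ _ _).trans ?_)
    rw [wedge_stdKahlerSq_stdKahler, smul_smul]
    norm_num
  rw [h, smul_smul]
  norm_num

variable {T : Type*} [AddCommGroup T] [Module ℝ T] [TopologicalSpace T]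

theorem IsFrame.of_dual [FiniteDimensional ℝ T] {n : ℕ} (hn : Module.finrank ℝ T = n)
    {e : Fin n → T} {ε : Fin n → T →L[ℝ] ℝ} (h : ∀ i j, ε i (e j) = if i = j then 1 else 0) :
    IsFrame e ε := by
  refine ⟨h, fun v => ?_⟩
  have hli : LinearIndependent ℝ e := by
    rw [Fintype.linearIndependent_iff]
    intro c hc i
    simpa [h] using congrArg (ε i) hc
  have hsp := hli.span_eq_top_of_card_eq_finrank' (by simp [hn])
  obtain ⟨c, rfl⟩ := (Submodule.mem_span_range_iff_exists_fun ℝ).1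
    (hsp ▸ Submodule.mem_top : v ∈ Submodule.span ℝ (Set.range e))
  simp [h]

/-- Pointwise data of an `SU(3)`-structure on a vector space. -/
structure IsSU3 (g : T →L[ℝ] T →L[ℝ] ℝ) (J : T →L[ℝ] T) (om : T [⋀^Fin 2]→L[ℝ] ℝ)
    (Om : T [⋀^Fin 3]→L[ℝ] ℂ) : Prop where
  symm : ∀ u v, g u v = g v u
  pos : ∀ u, u ≠ 0 → 0 < g u u
  J_J : ∀ v, J (J v) = -v
  g_J_J : ∀ u v, g (J u) (J v) = g u v
  omega_apply : ∀ u v, om ![u, v] = g (J u) v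
  Omega_J : ∀ u v w, Om ![J u, v, w] = Complex.I * Om ![u, v, w]
  Omega_conj : wedge Om ((Complex.conjCLE : ℂ →L[ℝ] ℂ).compContinuousAlternatingMap Om) =
    (-8 * Complex.I) • Complex.ofRealCLM.compContinuousAlternatingMap
      ((1 / 6 : ℝ) • wedge (wedge om om) om)

variable {g : T →L[ℝ] T →L[ℝ] ℝ} {J : T →L[ℝ] T} {om : T [⋀^Fin 2]→L[ℝ] ℝ}
  {Om : T [⋀^Fin 3]→L[ℝ] ℂ}

theorem exists_unit_orthogonal [FiniteDimensional ℝ T] (pos : ∀ u, u ≠ 0 → 0 < g u u) {k : ℕ}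
    (hk : k < Module.finrank ℝ T) (e : Fin k → T) : ∃ u, g u u = 1 ∧ ∀ i, g (e i) u = 0 := by
  let f : T →ₗ[ℝ] Fin k → ℝ := LinearMap.pi fun i => (g (e i) : T →ₗ[ℝ] ℝ)
  obtain ⟨u, hu, hu0⟩ := (Submodule.ne_bot_iff _).1
    (LinearMap.ker_ne_bot_of_finrank_lt (f := f) (by simpa using hk))
  have hpos := pos u hu0
  refine ⟨(√(g u u))⁻¹ • u, ?_, fun i => ?_⟩
  · simp only [map_smul, smul_apply, smul_eq_mul]
    rw [← mul_assoc, ← mul_inv, Real.mul_self_sqrt hpos.le, inv_mul_cancel₀ hpos.ne']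
  · have : g (e i) u = 0 := congrFun (LinearMap.mem_ker.1 hu) i
    simp [this]

/-- `u`, `v`, `w` is a unitary basis. -/
structure IsUnitaryTriple (g : T →L[ℝ] T →L[ℝ] ℝ) (J : T →L[ℝ] T) (u v w : T) : Prop where
  uu : g u u = 1
  vv : g v v = 1
  ww : g w w = 1
  uv : g u v = 0
  uw : g u w = 0
  vw : g v w = 0
  Juv : g (J u) v = 0
  Juw : g (J u) w = 0
  Jvw : g (J v) w = 0

theorem IsSU3.exists_unitaryTriple [FiniteDimensional ℝ T] (h : IsSU3 g J om Om)
    (hT : Module.finrank ℝ T = 6) : ∃ u v w, IsUnitaryTriple g J u v w := by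
  obtain ⟨u, hu, -⟩ := exists_unit_orthogonal h.pos (k := 0) (by omega) ![]
  obtain ⟨v, hv, hv'⟩ := exists_unit_orthogonal h.pos (k := 2) (by omega) ![u, J u]
  obtain ⟨w, hw, hw'⟩ := exists_unit_orthogonal h.pos (k := 4) (by omega) ![u, J u, v, J v]
  exact ⟨u, v, w, hu, hv, hw, hv' 0, hw' 0, hw' 2, hv' 1, hw' 1, hw' 3⟩

/-- The orthonormal frame `u, J u, v, J v, w, J w`. -/
def unitaryFrame (J : T →L[ℝ] T) (u v w : T) : Fin 6 → T := ![u, J u, v, J v, w, J w]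

theorem IsSU3.g_J_right (h : IsSU3 g J om Om) (a b : T) : g a (J b) = -g (J a) b := by
  rw [← h.g_J_J, h.J_J]
  simp

theorem IsSU3.g_J_self (h : IsSU3 g J om Om) (a : T) : g (J a) a = 0 := by
  have := h.g_J_right a a
  rw [h.symm] at this
  linarith

theorem IsSU3.isOrthonormalFrame [FiniteDimensional ℝ T] (h : IsSU3 g J om Om)
    (hT : Module.finrank ℝ T = 6) {u v w : T} (t : IsUnitaryTriple g J u v w) :
    IsOrthonormalFrame g (unitaryFrame J u v w) fun i => g (unitaryFrame J u v w i) := by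
  have hd : ∀ i j, g (unitaryFrame J u v w i) (unitaryFrame J u v w j) = if i = j then 1 else 0 :=
      by
    have e1 : g v u = 0 := by rw [h.symm, t.uv]
    have e2 : g w u = 0 := by rw [h.symm, t.uw]
    have e3 : g w v = 0 := by rw [h.symm, t.vw]
    have f1 : g (J v) u = 0 := by rw [h.symm, h.g_J_right, t.Juv, neg_zero]
    have f2 : g (J w) u = 0 := by rw [h.symm, h.g_J_right, t.Juw, neg_zero]
    have f3 : g (J w) v = 0 := by rw [h.symm, h.g_J_right, t.Jvw, neg_zero]
    intro i j
    fin_cases i <;> fin_cases j <;>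
      simp [unitaryFrame, h.g_J_J, h.g_J_right, h.g_J_self, t.uu, t.vv, t.ww, t.uv, t.uw, t.vw,
        t.Juv, t.Juw, t.Jvw, e1, e2, e3, f1, f2, f3]
  have hf := IsFrame.of_dual hT hd
  refine ⟨hf, fun a b => ?_⟩
  conv_lhs => rw [hf.expand a]
  simp

theorem map_vec_two (a : T [⋀^Fin 2]→L[ℝ] ℝ) (v : Fin 2 → T) : a v = a ![v 0, v 1] := by
  congr 1
  ext i; fin_cases i <;> rfl

theorem map_vec_three (a : T [⋀^Fin 3]→L[ℝ] ℂ) (v : Fin 3 → T) : a v = a ![v 0, v 1, v 2] := by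
  congr 1
  ext i; fin_cases i <;> rfl

theorem IsSU3.omega_eq [FiniteDimensional ℝ T] (h : IsSU3 g J om Om)
    (hT : Module.finrank ℝ T = 6) {u v w : T} (t : IsUnitaryTriple g J u v w) :
    om = stdKahler fun i => g (unitaryFrame J u v w i) := by
  ext x
  rw [map_vec_two, h.omega_apply, (h.isOrthonormalFrame hT t).metric]
  simp only [stdKahler, ContinuousAlternatingMap.add_apply, detForm_apply, Matrix.det_fin_two,
    Matrix.of_apply, Matrix.cons_val]
  simp [unitaryFrame, Fin.sum_univ_succ, h.J_J, h.g_J_right]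
  ring

theorem map_add_three (a : T [⋀^Fin 3]→L[ℝ] ℂ) (x x' y z : T) :
    a ![x + x', y, z] = a ![x, y, z] + a ![x', y, z] :=
  a.toAlternatingMap.map_vecCons_add ![y, z] x x'

theorem map_smul_three (a : T [⋀^Fin 3]→L[ℝ] ℂ) (c : ℝ) (x y z : T) :
    a ![c • x, y, z] = c * a ![x, y, z] :=
  (a.toAlternatingMap.map_vecCons_smul ![y, z] c x).trans (Complex.real_smul ..)

theorem map_swap_three (a : T [⋀^Fin 3]→L[ℝ] ℂ) (x y z : T) : a ![x, y, z] = -a ![y, x, z] := by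
  have := a.toAlternatingMap.map_swap ![x, y, z] (i := 0) (j := 1) (by decide)
  rw [eq_neg_iff_add_eq_zero, add_comm, ← eq_neg_iff_add_eq_zero]
  refine Eq.trans ?_ this
  change a _ = a _
  congr 1
  ext i; fin_cases i <;> rfl

theorem map_rotate_three (a : T [⋀^Fin 3]→L[ℝ] ℂ) (x y z : T) : a ![x, y, z] = a ![z, x, y] := by
  have := a.toAlternatingMap.map_perm ![z, x, y] (finRotate 3)
  rw [sign_finRotate] at this
  refine Eq.trans ?_ (this.trans (by simp))
  change a _ = a _
  congr 1
  ext i; fin_cases i <;> rfl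

theorem map_self_three (a : T [⋀^Fin 3]→L[ℝ] ℂ) (x z : T) : a ![x, x, z] = 0 :=
  a.map_eq_zero_of_eq ![x, x, z] (i := 0) (j := 1) rfl (by decide)

theorem IsSU3.Omega_expand [FiniteDimensional ℝ T] (h : IsSU3 g J om Om)
    (hT : Module.finrank ℝ T = 6) {u v w : T} (t : IsUnitaryTriple g J u v w) (x y z : T) :
    Om ![x, y, z] = complexCovector (g u) (g (J u)) x * Om ![u, y, z] +
      complexCovector (g v) (g (J v)) x * Om ![v, y, z] +
      complexCovector (g w) (g (J w)) x * Om ![w, y, z] := by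
  conv_lhs => rw [(h.isOrthonormalFrame hT t).expand x]
  simp only [unitaryFrame, Fin.sum_univ_succ, Finset.univ_eq_empty, Finset.sum_empty,
    Matrix.cons_val_zero, Matrix.cons_val_succ, add_zero]
  simp only [map_add_three, map_smul_three,
    h.Omega_J, complexCovector, ContinuousLinearMap.coe_mk', LinearMap.coe_mk, AddHom.coe_mk]
  ring

theorem IsSU3.Omega_eq [FiniteDimensional ℝ T] (h : IsSU3 g J om Om)
    (hT : Module.finrank ℝ T = 6) {u v w : T} (t : IsUnitaryTriple g J u v w) :
    Om = Om ![u, v, w] • stdOmega fun i => g (unitaryFrame J u v w i) := by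
  ext x
  rw [map_vec_three, ContinuousAlternatingMap.smul_apply, smul_eq_mul]
  rw [stdOmega, detForm_apply, Matrix.det_fin_three]
  simp only [Matrix.of_apply, Matrix.cons_val]
  generalize x 0 = a, x 1 = b, x 2 = c
  have E := h.Omega_expand hT t
  have E1 : ∀ p, Om ![p, b, c] = _ := fun p => (map_swap_three Om p b c).trans
    (congrArg _ (E b p c))
  have E2 : ∀ p q, Om ![p, q, c] = _ := fun p q => (map_rotate_three Om p q c).trans (E c p q)
  have z2 : ∀ x z, Om ![x, z, z] = 0 := fun x z => by rw [← map_rotate_three, map_self_three]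
  have z3 : ∀ x z, Om ![x, z, x] = 0 := fun x z => by rw [map_rotate_three, map_self_three]
  have p1 : Om ![v, w, u] = Om ![u, v, w] := map_rotate_three _ _ _ _
  have p2 : Om ![w, u, v] = Om ![u, v, w] := (map_rotate_three _ _ _ _).trans p1
  have p3 : Om ![v, u, w] = -Om ![u, v, w] := map_swap_three _ _ _ _
  have p4 : Om ![u, w, v] = -Om ![u, v, w] := (map_swap_three _ _ _ _).trans (by rw [p2])
  have p5 : Om ![w, v, u] = -Om ![u, v, w] := (map_swap_three _ _ _ _).trans (by rw [p1])
  rw [E a b c, E1 u, E1 v, E1 w, E2 u u, E2 v u, E2 w u, E2 u v, E2 v v, E2 w v, E2 u w, E2 v w,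
    E2 w w]
  simp only [map_self_three, z2, z3, p1, p2, p3, p4, p5]
  simp only [unitaryFrame, Matrix.cons_val]
  ring

theorem conj_detForm (a b d : T →L[ℝ] ℂ) :
    (Complex.conjCLE : ℂ →L[ℝ] ℂ).compContinuousAlternatingMap (detForm ![a, b, d]) =
      detForm ![(Complex.conjCLE : ℂ →L[ℝ] ℂ).comp a, (Complex.conjCLE : ℂ →L[ℝ] ℂ).comp b,
        (Complex.conjCLE : ℂ →L[ℝ] ℂ).comp d] := by
  ext v
  simp [detForm_apply, Matrix.det_fin_three]

theorem smul_detForm_three (c : ℂ) (a b d : T →L[ℝ] ℂ) :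
    c • detForm ![a, b, d] = detForm ![c • a, b, d] := by
  ext v
  simp [detForm_apply, Matrix.det_fin_three]
  ring

theorem det_complexFrame (c d : ℂ) :
    (!![c, c * Complex.I, 0, 0, 0, 0; 0, 0, 1, Complex.I, 0, 0; 0, 0, 0, 0, 1, Complex.I;
        d, -(d * Complex.I), 0, 0, 0, 0; 0, 0, 1, -Complex.I, 0, 0;
        0, 0, 0, 0, 1, -Complex.I] : Matrix (Fin 6) (Fin 6) ℂ).det = -8 * Complex.I * (c * d) := by
  simp [Matrix.det_succ_row_zero, Fin.sum_univ_succ, Fin.succAbove]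
  ring_nf
  simp [show Complex.I ^ 3 = -Complex.I by rw [pow_succ, Complex.I_sq]; ring]
  ring

theorem IsSU3.norm_Omega [FiniteDimensional ℝ T] (h : IsSU3 g J om Om)
    (hT : Module.finrank ℝ T = 6) {u v w : T} (t : IsUnitaryTriple g J u v w) :
    Complex.normSq (Om ![u, v, w]) = 1 := by
  have hf := h.isOrthonormalFrame hT t
  have h1 := h.Omega_conj
  set c := Om ![u, v, w] with hc
  rw [h.omega_eq hT t, h.Omega_eq hT t, ← hc, stdOmega, smul_detForm_three, conj_detForm,
      wedge_detForm, append_three_three,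
    stdKahler_cube] at h1
  have h2 := congrArg (fun a : T [⋀^Fin 6]→L[ℝ] ℂ => a (unitaryFrame J u v w)) h1
  have h3 : (detForm fun i => g (unitaryFrame J u v w i)) (unitaryFrame J u v w) = 1 := by
    rw [detForm_apply, ← Matrix.det_one (n := Fin 6)]
    congr 1
    ext i j
    simp [hf.dual, Matrix.one_apply]
  have h4 : ∀ i j k, complexCovector (g (unitaryFrame J u v w i)) (g (unitaryFrame J u v w j))
    (unitaryFrame J u v w k) = (if i = k then 1 else 0) + Complex.I * (if j = k then 1 else 0) := by
    intro i j k
    simp only [complexCovector, ContinuousLinearMap.coe_mk', LinearMap.coe_mk, AddHom.coe_mk,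
      hf.dual]
    split_ifs <;> simp
  simp only [ContinuousAlternatingMap.smul_apply,
    ContinuousLinearMap.compContinuousAlternatingMap_coe, Function.comp_apply, h3] at h2
  rw [detForm_apply] at h2
  have h5 : (Matrix.of fun i j => (![c • complexCovector (g (unitaryFrame J u v w 0))
        (g (unitaryFrame J u v w 1)), complexCovector (g (unitaryFrame J u v w 2))
        (g (unitaryFrame J u v w 3)), complexCovector (g (unitaryFrame J u v w 4))
        (g (unitaryFrame J u v w 5)), (Complex.conjCLE : ℂ →L[ℝ] ℂ).comp
        (c • complexCovector (g (unitaryFrame J u v w 0)) (g (unitaryFrame J u v w 1))),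
        (Complex.conjCLE : ℂ →L[ℝ] ℂ).comp (complexCovector (g (unitaryFrame J u v w 2))
        (g (unitaryFrame J u v w 3))), (Complex.conjCLE : ℂ →L[ℝ] ℂ).comp (complexCovector
        (g (unitaryFrame J u v w 4)) (g (unitaryFrame J u v w 5)))] i) (unitaryFrame J u v w j)) =
      !![c, c * Complex.I, 0, 0, 0, 0; 0, 0, 1, Complex.I, 0, 0; 0, 0, 0, 0, 1, Complex.I;
        (starRingEnd ℂ) c, -((starRingEnd ℂ) c * Complex.I), 0, 0, 0, 0; 0, 0, 1, -Complex.I, 0, 0;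
        0, 0, 0, 0, 1, -Complex.I] := by
    ext i j
    fin_cases i <;> fin_cases j <;> simp [h4]
  rw [h5, det_complexFrame, Complex.mul_conj] at h2
  have h6 : (-8 * Complex.I : ℂ) ≠ 0 := by simp
  simp only [smul_eq_mul] at h2
  have h7 := mul_left_cancel₀ h6 h2
  norm_num at h7
  exact_mod_cast h7

theorem IsSU3.exists_adaptedFrame [FiniteDimensional ℝ T] (h : IsSU3 g J om Om)
    (hT : Module.finrank ℝ T = 6) :
    ∃ (e : Fin 6 → T) (ε : Fin 6 → T →L[ℝ] ℝ), IsOrthonormalFrame g e ε ∧ om = stdKahler ε ∧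
      Om = stdOmega ε := by
  obtain ⟨u, v, w, t⟩ := h.exists_unitaryTriple hT
  set c := Om ![u, v, w] with hc
  have hc1 : Complex.normSq c = 1 := h.norm_Omega hT t
  have hc2 : c.re * c.re + c.im * c.im = 1 := hc1
  have e3 : g (J w) w = 0 := h.g_J_self w
  have t' : IsUnitaryTriple g J u v (c.re • w - c.im • J w) := by
    refine { t with ww := ?_, uw := ?_, vw := ?_, Juw := ?_, Jvw := ?_ }
    · simp [h.g_J_right, h.J_J, t.ww, e3]
      linarith
    all_goals simp [h.g_J_right, h.J_J, t.uw, t.vw, t.Juw, t.Jvw]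
  refine ⟨_, _, h.isOrthonormalFrame hT t', h.omega_eq hT t', ?_⟩
  conv_lhs => rw [h.Omega_eq hT t']
  have : Om ![u, v, c.re • w - c.im • J w] = (starRingEnd ℂ) c * Om ![u, v, w] := by
    rw [map_rotate_three, sub_eq_add_neg, ← neg_smul]
    simp only [map_add_three, map_smul_three, h.Omega_J]
    rw [← map_rotate_three]
    apply Complex.ext <;> simp
  rw [this, ← hc, mul_comm, Complex.mul_conj, hc1, Complex.ofReal_one, one_smul]

end AdaptedFrame


section SevenModel

variable {V : Type*} [AddCommGroup V] [Module ℝ V] [TopologicalSpace V]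

theorem hodgeStar_add [FiniteDimensional ℝ V] [IsTopologicalAddGroup V] [ContinuousSMul ℝ V]
    {k m : ℕ} (g : V →L[ℝ] V →L[ℝ] ℝ) (vol : V [⋀^Fin (m + k)]→L[ℝ] ℝ)
    (a b : V [⋀^Fin k]→L[ℝ] ℝ) :
    hodgeStar g vol (a + b) = hodgeStar g vol a + hodgeStar g vol b := by
  simp only [hodgeStar, ContinuousAlternatingMap.add_apply, mul_add, add_smul,
    Finset.sum_add_distrib, smul_add]

theorem hodgeStar_smul [FiniteDimensional ℝ V] [IsTopologicalAddGroup V] [ContinuousSMul ℝ V]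
    {k m : ℕ} (g : V →L[ℝ] V →L[ℝ] ℝ) (vol : V [⋀^Fin (m + k)]→L[ℝ] ℝ) (c : ℝ)
    (a : V [⋀^Fin k]→L[ℝ] ℝ) :
    hodgeStar g vol (c • a) = c • hodgeStar g vol a := by
  simp only [hodgeStar, ContinuousAlternatingMap.smul_apply, smul_eq_mul, mul_left_comm _ c,
    mul_smul, ← Finset.smul_sum]
  rw [smul_comm]

/-- Index tuples of the basic `4`-forms that occur in `ω²`, `dr ∧ Im Ω` and `dr ∧ Re Ω`. -/
def quad : Fin 11 → Fin 4 → Fin 7 :=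
  ![![0, 1, 2, 3], ![0, 1, 4, 5], ![2, 3, 4, 5], ![6, 0, 2, 5], ![6, 0, 3, 4], ![6, 1, 2, 4],
    ![6, 1, 3, 5], ![6, 0, 2, 4], ![6, 0, 3, 5], ![6, 1, 2, 5], ![6, 1, 3, 4]]

variable {e : Fin 7 → V} {ε : Fin 7 → V →L[ℝ] ℝ}

/-- The first six covectors of a coframe. -/
def initCoframe (ε : Fin 7 → V →L[ℝ] ℝ) : Fin 6 → V →L[ℝ] ℝ := fun i => ε i.castSucc

theorem stdKahlerSq_initCoframe : stdKahlerSq (initCoframe ε) =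
    coframeForm ε (quad 0) + coframeForm ε (quad 1) + coframeForm ε (quad 2) := by
  simp only [stdKahlerSq, coframeForm]
  congr 1

theorem detForm_cons_three (τ a b c : V →L[ℝ] ℝ) :
    covectorWedge τ (detForm ![a, b, c]) = detForm ![τ, a, b, c] :=
  covectorWedge_detForm _ _

theorem detForm_cons_two (τ a b : V →L[ℝ] ℝ) :
    covectorWedge τ (detForm ![a, b]) = detForm ![τ, a, b] :=
  covectorWedge_detForm _ _

theorem covectorWedge_sub {k : ℕ} (ρ : V →L[ℝ] ℝ) (a b : V [⋀^Fin k]→L[ℝ] ℝ) :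
    covectorWedge ρ (a - b) = covectorWedge ρ a - covectorWedge ρ b := by
  ext v
  simp [covectorWedge_apply, mul_sub, Finset.sum_sub_distrib]

theorem covectorWedge_stdIm : covectorWedge (ε 6) (stdIm (initCoframe ε)) =
    coframeForm ε (quad 3) + coframeForm ε (quad 4) + coframeForm ε (quad 5)
      - coframeForm ε (quad 6) := by
  simp only [stdIm, covectorWedge_add, covectorWedge_sub, detForm_cons_three, coframeForm]
  congr 1

theorem covectorWedge_stdRe : covectorWedge (ε 6) (stdRe (initCoframe ε)) =
    coframeForm ε (quad 7) - coframeForm ε (quad 8) - coframeForm ε (quad 9)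
      - coframeForm ε (quad 10) := by
  simp only [stdRe, covectorWedge_sub, detForm_cons_three, coframeForm]
  congr 1

theorem det_quad : ∀ a b : Fin 11,
    (Matrix.of fun i j => if quad a i = quad b j then (1 : ℤ) else 0).det =
      if a = b then 1 else 0 := by
  decide +kernel

theorem IsFrame.coframeForm_quad (h : IsFrame e ε) (a b : Fin 11) :
    coframeForm ε (quad a) (fun i => e (quad b i)) = if a = b then 1 else 0 := by
  have := congrArg (Int.cast : ℤ → ℝ) (det_quad a b)
  rw [Int.cast_det] at this
  rw [coframeForm, detForm_apply]
  refine Eq.trans ?_ (this.trans (by split_ifs <;> simp))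
  congr 1
  ext i j
  simp [h.dual]

/-- The Euclidean pairing of `4`-forms in a frame, normalized so that the basic forms are
orthonormal. -/
def framePairing (e : Fin 7 → V) (a b : V [⋀^Fin 4]→L[ℝ] ℝ) : ℝ :=
  (1 / 24 : ℝ) * ∑ s : Fin 4 → Fin 7, a (fun i => e (s i)) * b fun i => e (s i)

theorem framePairing_add (a a' b : V [⋀^Fin 4]→L[ℝ] ℝ) :
    framePairing e (a + a') b = framePairing e a b + framePairing e a' b := by
  simp only [framePairing, ContinuousAlternatingMap.add_apply, add_mul, Finset.sum_add_distrib,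
    mul_add]

theorem framePairing_smul (c : ℝ) (a b : V [⋀^Fin 4]→L[ℝ] ℝ) :
    framePairing e (c • a) b = c * framePairing e a b := by
  simp only [framePairing, ContinuousAlternatingMap.smul_apply, smul_eq_mul, mul_assoc,
    Finset.mul_sum, mul_left_comm _ c]

theorem IsFrame.framePairing_quad (h : IsFrame e ε) (a : Fin 11) (b : V [⋀^Fin 4]→L[ℝ] ℝ) :
    framePairing e (coframeForm ε (quad a)) b = b fun i => e (quad a i) := by
  rw [framePairing, h.sum_coframeForm_mul (quad a) b (map_perm_real b)]
  norm_num [Nat.factorial]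
  ring

theorem IsFrame.framePairing_model (h : IsFrame e ε) (p q s p' q' s' : ℝ) :
    framePairing e (p • stdKahlerSq (initCoframe ε) +
        q • covectorWedge (ε 6) (stdRe (initCoframe ε)) +
        s • covectorWedge (ε 6) (stdIm (initCoframe ε)))
      (p' • stdKahlerSq (initCoframe ε) + q' • covectorWedge (ε 6) (stdRe (initCoframe ε)) +
        s' • covectorWedge (ε 6) (stdIm (initCoframe ε))) =
      3 * (p * p') + 4 * (q * q') + 4 * (s * s') := by
  rw [covectorWedge_stdIm, covectorWedge_stdRe, stdKahlerSq_initCoframe]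
  change framePairing e
    (p • (coframeForm ε (quad 0) + coframeForm ε (quad 1) + coframeForm ε (quad 2)) +
      q • (coframeForm ε (quad 7) - coframeForm ε (quad 8) - coframeForm ε (quad 9) -
        coframeForm ε (quad 10)) +
      s • (coframeForm ε (quad 3) + coframeForm ε (quad 4) + coframeForm ε (quad 5) -
        coframeForm ε (quad 6)))
    (p' • (coframeForm ε (quad 0) + coframeForm ε (quad 1) + coframeForm ε (quad 2)) +
      q' • (coframeForm ε (quad 7) - coframeForm ε (quad 8) - coframeForm ε (quad 9) -
        coframeForm ε (quad 10)) +
      s' • (coframeForm ε (quad 3) + coframeForm ε (quad 4) + coframeForm ε (quad 5) -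
        coframeForm ε (quad 6))) = _
  have hneg : ∀ i, -coframeForm ε (quad i) = (-1 : ℝ) • coframeForm ε (quad i) := fun i =>
    (neg_one_smul ℝ _).symm
  simp only [sub_eq_add_neg, hneg]
  simp only [smul_add, framePairing_add, framePairing_smul, h.framePairing_quad,
    ContinuousAlternatingMap.add_apply, ContinuousAlternatingMap.smul_apply, h.coframeForm_quad]
  simp [Fin.ext_iff]
  ring

theorem IsFrame.model_eq_zero (h : IsFrame e ε) {a b c : ℝ}
    (h0 : a • stdKahlerSq (initCoframe ε) + b • covectorWedge (ε 6) (stdRe (initCoframe ε)) +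
      c • covectorWedge (ε 6) (stdIm (initCoframe ε)) = 0) : a = 0 ∧ b = 0 ∧ c = 0 := by
  rw [covectorWedge_stdIm, covectorWedge_stdRe, stdKahlerSq_initCoframe] at h0
  have key := fun j => congrArg (fun x : V [⋀^Fin 4]→L[ℝ] ℝ => x fun i => e (quad j i)) h0
  simp only [ContinuousAlternatingMap.add_apply, ContinuousAlternatingMap.smul_apply,
    ContinuousAlternatingMap.sub_apply, h.coframeForm_quad] at key
  refine ⟨?_, ?_, ?_⟩
  · simpa [Fin.ext_iff] using key 0
  · simpa [Fin.ext_iff] using key 7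
  · simpa [Fin.ext_iff] using key 3

theorem IsFrame.covectorWedge_stdKahlerSq_ne_zero (h : IsFrame e ε) :
    covectorWedge (ε 6) (stdKahlerSq (initCoframe ε)) ≠ 0 := by
  intro h0
  have key := congrArg (fun x : V [⋀^Fin 5]→L[ℝ] ℝ => x ![e 6, e 0, e 1, e 2, e 3]) h0
  simp [covectorWedge_apply, Fin.sum_univ_succ, h.dual] at key
  have hq : (fun i => e (quad 0 i)) = ![e 0, e 1, e 2, e 3] := by ext i; fin_cases i <;> rfl
  rw [stdKahlerSq_initCoframe, ← hq] at key
  simp only [ContinuousAlternatingMap.add_apply, h.coframeForm_quad] at key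
  simp at key

variable {g : V →L[ℝ] V →L[ℝ] ℝ}

theorem IsOrthonormalFrame.hodgeStar_perm [FiniteDimensional ℝ V] [IsTopologicalAddGroup V]
    [ContinuousSMul ℝ V] (h : IsOrthonormalFrame g e ε) (t : Fin 4 → Fin 7) (t' : Fin 3 → Fin 7)
    (σ : Equiv.Perm (Fin 7)) (hσ : ∀ i, σ i = Fin.append t t' i) :
    hodgeStar (k := 4) (m := 3) g (detForm ε) (coframeForm ε t) =
      (Equiv.Perm.sign σ : ℤ) • coframeForm ε t' :=
  IsOrthonormalFrame.hodgeStar_coframeForm (m := 3) (k := 4) h t t' σ hσ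

theorem IsOrthonormalFrame.hodgeStar_stdKahlerSq [FiniteDimensional ℝ V] [IsTopologicalAddGroup V]
    [ContinuousSMul ℝ V] (h : IsOrthonormalFrame g e ε) :
    hodgeStar (k := 4) (m := 3) g (detForm ε) (stdKahlerSq (initCoframe ε)) =
      covectorWedge (ε 6) (stdKahler (initCoframe ε)) := by
  have h0 := h.hodgeStar_perm (quad 0) ![6, 4, 5]
    ⟨![0, 1, 2, 3, 6, 4, 5], ![0, 1, 2, 3, 5, 6, 4], by decide, by decide⟩ (by decide)
  have h1 := h.hodgeStar_perm (quad 1) ![6, 2, 3]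
    ⟨![0, 1, 4, 5, 6, 2, 3], ![0, 1, 5, 6, 2, 3, 4], by decide, by decide⟩ (by decide)
  have h2 := h.hodgeStar_perm (quad 2) ![6, 0, 1]
    ⟨![2, 3, 4, 5, 6, 0, 1], ![5, 6, 0, 1, 2, 3, 4], by decide, by decide⟩ (by decide)
  rw [show Equiv.Perm.sign _ = 1 by decide +kernel, Units.val_one, one_smul] at h0 h1 h2
  rw [stdKahlerSq_initCoframe, hodgeStar_add, hodgeStar_add, h0, h1, h2]
  simp only [stdKahler, covectorWedge_add, detForm_cons_two]
  have k0 : coframeForm ε ![6, 4, 5] = detForm ![ε 6, initCoframe ε 4, initCoframe ε 5] :=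
    congrArg detForm (by ext i; fin_cases i <;> rfl)
  have k1 : coframeForm ε ![6, 2, 3] = detForm ![ε 6, initCoframe ε 2, initCoframe ε 3] :=
    congrArg detForm (by ext i; fin_cases i <;> rfl)
  have k2 : coframeForm ε ![6, 0, 1] = detForm ![ε 6, initCoframe ε 0, initCoframe ε 1] :=
    congrArg detForm (by ext i; fin_cases i <;> rfl)
  rw [k0, k1, k2]
  change _ + _ + _ = ((_ + _ + _ : V [⋀^Fin 3]→L[ℝ] ℝ))
  abel

theorem IsOrthonormalFrame.hodgeStar_stdIm [FiniteDimensional ℝ V] [IsTopologicalAddGroup V]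
    [ContinuousSMul ℝ V] (h : IsOrthonormalFrame g e ε) :
    hodgeStar (k := 4) (m := 3) g (detForm ε) (covectorWedge (ε 6) (stdIm (initCoframe ε))) =
      -stdRe (initCoframe ε) := by
  have h3 := h.hodgeStar_perm (quad 3) ![1, 3, 4]
    ⟨![6, 0, 2, 5, 1, 3, 4], ![1, 4, 2, 5, 6, 3, 0], by decide, by decide⟩ (by decide)
  have h4 := h.hodgeStar_perm (quad 4) ![1, 2, 5]
    ⟨![6, 0, 3, 4, 1, 2, 5], ![1, 4, 5, 2, 3, 6, 0], by decide, by decide⟩ (by decide)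
  have h5 := h.hodgeStar_perm (quad 5) ![0, 3, 5]
    ⟨![6, 1, 2, 4, 0, 3, 5], ![4, 1, 2, 5, 3, 6, 0], by decide, by decide⟩ (by decide)
  have h6 := h.hodgeStar_perm (quad 6) ![0, 2, 4]
    ⟨![6, 1, 3, 5, 0, 2, 4], ![4, 1, 5, 2, 6, 3, 0], by decide, by decide⟩ (by decide)
  rw [show Equiv.Perm.sign _ = 1 by decide +kernel, Units.val_one, one_smul] at h3 h4 h5 h6
  rw [covectorWedge_stdIm, sub_eq_add_neg, ← neg_one_smul ℝ (coframeForm ε (quad 6)),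
    hodgeStar_add, hodgeStar_add, hodgeStar_add, hodgeStar_smul, h3, h4, h5, h6]
  have k3 : coframeForm ε ![1, 3, 4] = detForm ![initCoframe ε 1, initCoframe ε 3,
      initCoframe ε 4] :=
    congrArg detForm (by ext i; fin_cases i <;> rfl)
  have k4 : coframeForm ε ![1, 2, 5] = detForm ![initCoframe ε 1, initCoframe ε 2,
      initCoframe ε 5] :=
    congrArg detForm (by ext i; fin_cases i <;> rfl)
  have k5 : coframeForm ε ![0, 3, 5] = detForm ![initCoframe ε 0, initCoframe ε 3,
      initCoframe ε 5] :=
    congrArg detForm (by ext i; fin_cases i <;> rfl)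
  have k6 : coframeForm ε ![0, 2, 4] = detForm ![initCoframe ε 0, initCoframe ε 2,
      initCoframe ε 4] :=
    congrArg detForm (by ext i; fin_cases i <;> rfl)
  rw [stdRe, k3, k4, k5, k6]
  module

theorem IsOrthonormalFrame.hodgeStar_stdRe [FiniteDimensional ℝ V] [IsTopologicalAddGroup V]
    [ContinuousSMul ℝ V] (h : IsOrthonormalFrame g e ε) :
    hodgeStar (k := 4) (m := 3) g (detForm ε) (covectorWedge (ε 6) (stdRe (initCoframe ε))) =
      stdIm (initCoframe ε) := by
  have h3 := h.hodgeStar_perm (quad 7) ![1, 3, 5]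
    ⟨![6, 0, 2, 4, 1, 3, 5], ![1, 4, 2, 5, 3, 6, 0], by decide, by decide⟩ (by decide)
  have h4 := h.hodgeStar_perm (quad 8) ![1, 2, 4]
    ⟨![6, 0, 3, 5, 1, 2, 4], ![1, 4, 5, 2, 6, 3, 0], by decide, by decide⟩ (by decide)
  have h5 := h.hodgeStar_perm (quad 9) ![0, 3, 4]
    ⟨![6, 1, 2, 5, 0, 3, 4], ![4, 1, 2, 5, 6, 3, 0], by decide, by decide⟩ (by decide)
  have h6 := h.hodgeStar_perm (quad 10) ![0, 2, 5]
    ⟨![6, 1, 3, 4, 0, 2, 5], ![4, 1, 5, 2, 3, 6, 0], by decide, by decide⟩ (by decide)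
  rw [show Equiv.Perm.sign _ = -1 by decide +kernel, Units.val_neg, Units.val_one,
    neg_one_zsmul] at h3 h4 h5 h6
  rw [covectorWedge_stdRe, sub_eq_add_neg, sub_eq_add_neg, sub_eq_add_neg,
    ← neg_one_smul ℝ (coframeForm ε (quad 8)), ← neg_one_smul ℝ (coframeForm ε (quad 9)),
    ← neg_one_smul ℝ (coframeForm ε (quad 10)), hodgeStar_add, hodgeStar_add, hodgeStar_add,
    hodgeStar_smul, hodgeStar_smul, hodgeStar_smul, h3, h4, h5, h6]
  have k3 : coframeForm ε ![1, 3, 5] = detForm ![initCoframe ε 1, initCoframe ε 3,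
      initCoframe ε 5] :=
    congrArg detForm (by ext i; fin_cases i <;> rfl)
  have k4 : coframeForm ε ![1, 2, 4] = detForm ![initCoframe ε 1, initCoframe ε 2,
      initCoframe ε 4] :=
    congrArg detForm (by ext i; fin_cases i <;> rfl)
  have k5 : coframeForm ε ![0, 3, 4] = detForm ![initCoframe ε 0, initCoframe ε 3,
      initCoframe ε 4] :=
    congrArg detForm (by ext i; fin_cases i <;> rfl)
  have k6 : coframeForm ε ![0, 2, 5] = detForm ![initCoframe ε 0, initCoframe ε 2,
      initCoframe ε 5] :=
    congrArg detForm (by ext i; fin_cases i <;> rfl)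
  rw [stdIm, k3, k4, k5, k6]
  module

end SevenModel


section ExteriorDerivative

open Filter Topology ContinuousAlternatingMap

variable {E : Type*} [NormedAddCommGroup E] [NormedSpace ℝ E]
variable {E' : Type*} [NormedAddCommGroup E'] [NormedSpace ℝ E']
variable {F : Type*} [NormedAddCommGroup F] [NormedSpace ℝ F]

theorem exists_isFrame (E : Type*) [NormedAddCommGroup E] [NormedSpace ℝ E]
    [FiniteDimensional ℝ E] :
    ∃ (n : ℕ) (e : Fin n → E) (ε : Fin n → E →L[ℝ] ℝ), IsFrame e ε := by
  refine ⟨_, Module.finBasis ℝ E,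
    fun i => ((Module.finBasis ℝ E).coord i).toContinuousLinearMap, ?_, ?_⟩
  · intro i j
    simp [Finsupp.single_apply, eq_comm]
  · intro v
    simp

instance finiteDimensional_continuousAlternatingMap [FiniteDimensional ℝ E]
    [FiniteDimensional ℝ F] (k : ℕ) : FiniteDimensional ℝ (E [⋀^Fin k]→L[ℝ] F) :=
  let f : (E [⋀^Fin k]→L[ℝ] F) →ₗ[ℝ] MultilinearMap ℝ (fun _ : Fin k => E) F :=
    { toFun := fun a => a.toMultilinearMap
      map_add' := fun _ _ => rfl
      map_smul' := fun _ _ => rfl }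
  Module.Finite.of_injective f fun a b h => by
    ext v
    exact congrArg (fun m : MultilinearMap ℝ (fun _ : Fin k => E) F => m v) h

theorem contDiffAt_bilinear {X G₁ G₂ G₃ : Type*} [NormedAddCommGroup X] [NormedSpace ℝ X]
    [NormedAddCommGroup G₁] [NormedSpace ℝ G₁] [FiniteDimensional ℝ G₁]
    [NormedAddCommGroup G₂] [NormedSpace ℝ G₂] [FiniteDimensional ℝ G₂]
    [NormedAddCommGroup G₃] [NormedSpace ℝ G₃] (B : G₁ →ₗ[ℝ] G₂ →ₗ[ℝ] G₃) {n : WithTop ℕ∞}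
    {a : X → G₁} {b : X → G₂} {x : X} (ha : ContDiffAt ℝ n a x) (hb : ContDiffAt ℝ n b x) :
    ContDiffAt ℝ n (fun y => B (a y) (b y)) x :=
  (B.toContinuousBilinearMap.contDiff.contDiffAt.comp x ha).clm_apply hb

theorem contDiffAt_wedge [FiniteDimensional ℝ E] {k m : ℕ} {n : WithTop ℕ∞} {X : Type*}
    [NormedAddCommGroup X] [NormedSpace ℝ X] {a : X → E [⋀^Fin k]→L[ℝ] ℝ}
    {b : X → E [⋀^Fin m]→L[ℝ] ℝ} {x : X} (ha : ContDiffAt ℝ n a x) (hb : ContDiffAt ℝ n b x) :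
    ContDiffAt ℝ n (fun y => wedge (a y) (b y)) x :=
  contDiffAt_bilinear (wedgeₗ k m) ha hb

/-- `covectorWedge` as a bilinear map. -/
def covectorWedgeₗ (k : ℕ) :
    (E →L[ℝ] ℝ) →ₗ[ℝ] (E [⋀^Fin k]→L[ℝ] ℝ) →ₗ[ℝ] (E [⋀^Fin (k + 1)]→L[ℝ] ℝ) :=
  LinearMap.mk₂ ℝ covectorWedge
    (fun ρ ρ' a => by
      ext v; simp [covectorWedge_apply, mul_add, add_mul, Finset.sum_add_distrib])
    (fun c ρ a => smul_covectorWedge c ρ a) covectorWedge_add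
    (fun c ρ a => covectorWedge_smul c ρ a)

theorem contDiffAt_covectorWedge [FiniteDimensional ℝ E] {k : ℕ} {n : WithTop ℕ∞} {X : Type*}
    [NormedAddCommGroup X] [NormedSpace ℝ X] {a : X → E →L[ℝ] ℝ}
    {b : X → E [⋀^Fin k]→L[ℝ] ℝ} {x : X} (ha : ContDiffAt ℝ n a x) (hb : ContDiffAt ℝ n b x) :
    ContDiffAt ℝ n (fun y => covectorWedge (a y) (b y)) x :=
  contDiffAt_bilinear (covectorWedgeₗ k) ha hb

theorem covectorWedge_covectorWedge_self [FiniteDimensional ℝ E] {k : ℕ} (ρ : E →L[ℝ] ℝ)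
    (a : E [⋀^Fin k]→L[ℝ] ℝ) : covectorWedge ρ (covectorWedge ρ a) = 0 := by
  obtain ⟨n, e, ε, h⟩ := exists_isFrame E
  induction a using h.induction with
  | hadd a b ha hb => rw [covectorWedge_add, covectorWedge_add, ha, hb, add_zero]
  | hsmul c a ha => rw [covectorWedge_smul, covectorWedge_smul, ha, smul_zero]
  | hdet α =>
    rw [covectorWedge_detForm, covectorWedge_detForm]
    exact detForm_eq_zero _ (i := 0) (j := 1) (by simp) rfl

theorem covectorWedge_eq_alternatizeUncurryFin {k : ℕ} (ρ : E →L[ℝ] ℝ) (a : E [⋀^Fin k]→L[ℝ] ℝ) :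
    covectorWedge ρ a = alternatizeUncurryFin (ρ.smulRight a) := by
  ext v
  rw [covectorWedge_apply, alternatizeUncurryFin_apply]
  simp [mul_assoc]

theorem extDeriv_fun_smul' {k : ℕ} {f : E → ℝ} {A : E → E [⋀^Fin k]→L[ℝ] ℝ} {y : E}
    (hf : DifferentiableAt ℝ f y) (hA : DifferentiableAt ℝ A y) :
    extDeriv (fun x => f x • A x) y = covectorWedge (fderiv ℝ f y) (A y) + f y • extDeriv A y := by
  rw [extDeriv, fderiv_fun_smul hf hA, alternatizeUncurryFin_add, alternatizeUncurryFin_smul,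
    covectorWedge_eq_alternatizeUncurryFin]
  exact add_comm _ _

theorem contDiffAt_extDeriv {k : ℕ} {A : E → E [⋀^Fin k]→L[ℝ] F} {y : E}
    (hA : ContDiffAt ℝ ∞ A y) : ContDiffAt ℝ ∞ (extDeriv A) y := by
  have h : extDeriv A = alternatizeUncurryFinCLM ℝ E F ∘ fderiv ℝ A := rfl
  rw [h]
  exact (alternatizeUncurryFinCLM ℝ E F).contDiff.contDiffAt.comp y
    (hA.fderiv_right (m := ∞) (by simp))

theorem extDeriv_covectorWedge_fderiv [FiniteDimensional ℝ E] {k : ℕ} {f : E → ℝ}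
    {A : E → E [⋀^Fin k]→L[ℝ] ℝ} {y : E} (hf : ContDiffAt ℝ ∞ f y) (hA : ContDiffAt ℝ ∞ A y) :
    extDeriv (fun x => covectorWedge (fderiv ℝ f x) (A x)) y =
      -covectorWedge (fderiv ℝ f y) (extDeriv A y) := by
  have hdA : ContDiffAt ℝ ∞ (extDeriv A) y := contDiffAt_extDeriv hA
  have hfA : ContDiffAt ℝ ∞ (fun x => f x • A x) y := hf.smul hA
  have hdfA : ContDiffAt ℝ ∞ (extDeriv fun x => f x • A x) y := contDiffAt_extDeriv hfA
  have hev : (fun x => covectorWedge (fderiv ℝ f x) (A x)) =ᶠ[𝓝 y]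
      fun x => extDeriv (fun x => f x • A x) x + -(f x • extDeriv A x) := by
    filter_upwards [(hf.of_le (m := 1) (by simp)).eventually (by simp),
      (hA.of_le (m := 1) (by simp)).eventually (by simp)] with x hfx hAx
    rw [extDeriv_fun_smul' (hfx.differentiableAt (by simp)) (hAx.differentiableAt (by simp))]
    abel
  have hs : minSmoothness ℝ 2 ≤ (∞ : WithTop ℕ∞) := by
    rw [minSmoothness_of_isRCLikeNormedField]; exact ENat.LEInfty.out
  rw [hev.extDeriv_eq, extDeriv_fun_add (hdfA.differentiableAt (by simp))
    (ω₂ := fun x => -(f x • extDeriv A x)) ((hf.smul hdA).neg.differentiableAt (by simp)),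
        extDeriv_extDeriv_apply hfA hs, zero_add]
  have hneg : (fun x => -(f x • extDeriv A x)) = (-1 : ℝ) • fun x => f x • extDeriv A x := by
    ext x; simp
  rw [hneg, extDeriv_smul, extDeriv_fun_smul' (hf.differentiableAt (by simp))
    (hdA.differentiableAt (by simp)), extDeriv_extDeriv_apply hA hs]
  simp

theorem extDeriv_comp_clm {k : ℕ} {A : E' → E' [⋀^Fin k]→L[ℝ] F} {y : E} (T : E →L[ℝ] E')
    (hA : DifferentiableAt ℝ A (T y)) :
    extDeriv (fun x => (A (T x)).compContinuousLinearMap T) y =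
      (extDeriv A (T y)).compContinuousLinearMap T := by
  have h := extDeriv_pullback (x := y) (f := T) (r := minSmoothness ℝ 2) hA T.contDiff.contDiffAt
    le_rfl
  simpa using h

theorem extDeriv_clm_comp {k : ℕ} {F' : Type*} [NormedAddCommGroup F'] [NormedSpace ℝ F']
    {A : E → E [⋀^Fin k]→L[ℝ] F} {y : E} (T : F →L[ℝ] F') (hA : DifferentiableAt ℝ A y) :
    extDeriv (fun x => T.compContinuousAlternatingMap (A x)) y =
      T.compContinuousAlternatingMap (extDeriv A y) := by
  have h : fderiv ℝ (fun x => T.compContinuousAlternatingMap (A x)) y =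
      (ContinuousLinearMap.compContinuousAlternatingMapCLM ℝ E F F' (Fin k) T).comp
        (fderiv ℝ A y) :=
    ((ContinuousLinearMap.compContinuousAlternatingMapCLM ℝ E F F'
        (Fin k) T).hasFDerivAt.comp y hA.hasFDerivAt).fderiv
  rw [extDeriv, h]
  ext v
  simp only [extDeriv, alternatizeUncurryFin_apply,
    ContinuousLinearMap.compContinuousAlternatingMap_coe, Function.comp_apply, _root_.map_sum,
        map_zsmul]
  rfl

end ExteriorDerivative


section ChartForms

open Filter Topology ContinuousAlternatingMap

variable {E : Type*} [NormedAddCommGroup E] [NormedSpace ℝ E]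
variable {H : Type*} [TopologicalSpace H] {I : ModelWithCorners ℝ E H}
variable {M : Type*} [TopologicalSpace M] [ChartedSpace H M]
variable {F : Type*} [NormedAddCommGroup F] [NormedSpace ℝ F]

section

variable [IsManifold I 1 M]

theorem mfderiv_extChartAt_symm_self [I.Boundaryless] (x : M) :
    (mfderiv 𝓘(ℝ, E) I (extChartAt I x).symm (extChartAt I x x) : E →L[ℝ] E) =
      ContinuousLinearMap.id ℝ E := by
  have h := mfderivWithin_range_extChartAt_symm (I := I) (x := x)
  rw [I.range_eq_univ, mfderivWithin_univ] at h
  exact h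

theorem d_apply {k : ℕ} (a : DForm I M k F) (x : M) :
    d a x = extDeriv (chartForm a x) (extChartAt I x x) := by
  unfold d
  have h : (mfderiv I 𝓘(ℝ, E) (extChartAt I x) x : E →L[ℝ] E) = ContinuousLinearMap.id ℝ E :=
    mfderiv_extChartAt_self
  ext v
  change (extDeriv (chartForm a x) (extChartAt I x x))
    (fun i => (mfderiv I 𝓘(ℝ, E) (extChartAt I x) x : E →L[ℝ] E) (v i)) = _
  rw [h]
  rfl

theorem chartForm_self [I.Boundaryless] {k : ℕ} (a : DForm I M k F) (x : M) :
    chartForm a x (extChartAt I x x) = a x := by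
  ext v
  change (a ((extChartAt I x).symm (extChartAt I x x)))
    (fun i => (mfderiv 𝓘(ℝ, E) I (extChartAt I x).symm (extChartAt I x x) : E →L[ℝ] E) (v i)) = _
  rw [mfderiv_extChartAt_symm_self, extChartAt_to_inv]
  rfl

theorem mdifferentiableAt_extChartAt_symm [I.Boundaryless] {x : M} {y : E} (hy : y ∈
    (extChartAt I x).target) :
    MDifferentiableAt 𝓘(ℝ, E) I (extChartAt I x).symm y := by
  have h := mdifferentiableWithinAt_extChartAt_symm (I := I) hy
  rwa [I.range_eq_univ, mdifferentiableWithinAt_univ] at h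

end

/-- Smoothness at a point, in the preferred chart there. -/
def SmoothFormAt {k : ℕ} (a : DForm I M k F) (x : M) : Prop :=
  ContDiffAt ℝ ∞ (chartForm a x) (extChartAt I x x)

theorem SmoothForm.smoothFormAt [I.Boundaryless] {k : ℕ} {a : DForm I M k F} (h : SmoothForm a)
    (x : M) :
    SmoothFormAt a x :=
  (h x).contDiffAt (extChartAt_target_mem_nhds x)

theorem SmoothFormAt.differentiableAt {k : ℕ} {a : DForm I M k F} {x : M} (h : SmoothFormAt a x) :
    DifferentiableAt ℝ (chartForm a x) (extChartAt I x x) :=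
  ContDiffAt.differentiableAt h (by simp)

theorem chartForm_eventuallyEq {k : ℕ} {a b : DForm I M k F} {x : M} (h : ∀ᶠ z in 𝓝 x, a z = b z) :
    chartForm a x =ᶠ[𝓝 (extChartAt I x x)] chartForm b x := by
  have hc : Tendsto (extChartAt I x).symm (𝓝 (extChartAt I x x)) (𝓝 x) := by
    have := continuousAt_extChartAt_symm (I := I) x
    rwa [ContinuousAt, extChartAt_to_inv] at this
  filter_upwards [hc.eventually h] with y hy
  unfold chartForm
  rw [hy]

theorem d_congr {k : ℕ} {a b : DForm I M k F} {x : M} (h : ∀ᶠ z in 𝓝 x, a z = b z) :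
    d a x = d b x := by
  unfold d
  rw [(chartForm_eventuallyEq h).extDeriv_eq]

theorem chartForm_smul {k : ℕ} (c : ℝ) (a : DForm I M k F) (x : M) :
    chartForm (c • a) x = c • chartForm a x := rfl

theorem SmoothFormAt.add {k : ℕ} {a b : DForm I M k F} {x : M} (ha : SmoothFormAt a x)
    (hb : SmoothFormAt b x) : SmoothFormAt (a + b) x :=
  ContDiffAt.add ha hb

theorem SmoothFormAt.const_smul {k : ℕ} {a : DForm I M k F} {x : M} (c : ℝ)
    (ha : SmoothFormAt a x) : SmoothFormAt (c • a) x :=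
  ContDiffAt.const_smul c ha

theorem SmoothFormAt.clm_comp {k : ℕ} {F' : Type*} [NormedAddCommGroup F'] [NormedSpace ℝ F']
    {a : DForm I M k F} {x : M} (T : F →L[ℝ] F') (ha : SmoothFormAt a x) :
    SmoothFormAt (fun x => T.compContinuousAlternatingMap (a x)) x :=
  (ContinuousLinearMap.compContinuousAlternatingMapCLM ℝ E F F' (Fin k) T).contDiff.contDiffAt.comp
    _ ha

theorem SmoothFormAt.dwedge [FiniteDimensional ℝ E] {k m : ℕ} {a : DForm I M k ℝ}
    {b : DForm I M m ℝ} {x : M} (ha : SmoothFormAt a x) (hb : SmoothFormAt b x) :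
    SmoothFormAt (dwedge a b) x := by
  refine ContDiffAt.congr_of_eventuallyEq (contDiffAt_wedge ha hb)
      (Eventually.of_forall fun y => ?_)
  unfold chartForm WarpedCoflow.dwedge
  exact (wedge_comp _ _ _)

variable [IsManifold I 1 M]

theorem d_add {k : ℕ} {a b : DForm I M k F} {x : M} (ha : SmoothFormAt a x)
    (hb : SmoothFormAt b x) : d (a + b) x = d a x + d b x := by
  rw [d_apply, d_apply, d_apply]
  exact extDeriv_add ha.differentiableAt hb.differentiableAt

theorem d_smul {k : ℕ} (c : ℝ) (a : DForm I M k F) (x : M) : d (c • a) x = c • d a x := by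
  rw [d_apply, d_apply, chartForm_smul]
  exact extDeriv_smul _ _

theorem d_clm_comp {k : ℕ} {F' : Type*} [NormedAddCommGroup F'] [NormedSpace ℝ F']
    {a : DForm I M k F} {x : M} (T : F →L[ℝ] F') (ha : SmoothFormAt a x) :
    d (fun x => T.compContinuousAlternatingMap (a x)) x =
      T.compContinuousAlternatingMap (d a x) := by
  rw [d_apply, d_apply]
  exact extDeriv_clm_comp T ha.differentiableAt

end ChartForms

section Warped

open Filter Topology ContinuousAlternatingMap

variable {N : Type*} [TopologicalSpace N] [ChartedSpace (EuclideanSpace ℝ (Fin 6)) N]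
variable {L : Type*} [TopologicalSpace L] [ChartedSpace ℝ L]

/-- The differential of the coordinate `r` on `N × L`, as a covector. -/
def drCovector (r : OpenPartialHomeomorph L ℝ) (z : N × L) : TangentSpace I₇ z →L[ℝ] ℝ :=
  mfderiv I₇ 𝓘(ℝ, ℝ) (fun z : N × L => r z.2) z

/-- The coordinate `r` in the preferred chart of `N × L` at `z`. -/
def chartCoord (r : OpenPartialHomeomorph L ℝ) (z : N × L) (y : EuclideanSpace ℝ (Fin 6) × ℝ) : ℝ :=
  r ((extChartAt 𝓘(ℝ, ℝ) z.2).symm y.2)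

/-- A function of the coordinate `r` times a form. -/
def coordSmul {k : ℕ} (r : OpenPartialHomeomorph L ℝ) (f : ℝ → ℝ) (a : DForm I₇ (N × L) k ℝ) :
    DForm I₇ (N × L) k ℝ := fun z => f (r z.2) • a z

/-- The form `dr ∧ a`. -/
def drWedge {k : ℕ} (r : OpenPartialHomeomorph L ℝ) (a : DForm I₇ (N × L) k ℝ) :
    DForm I₇ (N × L) (k + 1) ℝ := fun z => covectorWedge (drCovector r z) (a z)

theorem extChartAt_I₇_symm_apply (z : N × L) (y : EuclideanSpace ℝ (Fin 6) × ℝ) :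
    (extChartAt I₇ z).symm y =
      ((extChartAt (𝓡 6) z.1).symm y.1, (extChartAt 𝓘(ℝ, ℝ) z.2).symm y.2) := by
  rw [extChartAt_prod]; rfl

theorem chartForm_coordSmul {k : ℕ} (r : OpenPartialHomeomorph L ℝ) (f : ℝ → ℝ)
    (a : DForm I₇ (N × L) k ℝ) (z : N × L) :
    chartForm (coordSmul r f a) z = fun y => f (chartCoord r z y) • chartForm a z y := by
  funext y
  have h : r ((extChartAt I₇ z).symm y).2 = chartCoord r z y := by
    rw [extChartAt_I₇_symm_apply]; rfl
  unfold chartForm coordSmul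
  rw [h]
  rfl

theorem chartCoord_self (r : OpenPartialHomeomorph L ℝ) (z : N × L) :
    chartCoord r z (extChartAt I₇ z z) = r z.2 := by
  have h4 : (extChartAt I₇ z z).2 = extChartAt 𝓘(ℝ, ℝ) z.2 z.2 := by
    rw [extChartAt_prod]; rfl
  rw [chartCoord, h4, extChartAt_to_inv]

theorem eventually_chart_symm_mem_source {r : OpenPartialHomeomorph L ℝ} {z : N × L}
    (hz : z.2 ∈ r.source) :
    ∀ᶠ y in 𝓝 (extChartAt I₇ z z), ((extChartAt I₇ z).symm y).2 ∈ r.source := by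
  have hc : Tendsto (extChartAt I₇ z).symm (𝓝 (extChartAt I₇ z z)) (𝓝 z) := by
    have := continuousAt_extChartAt_symm (I := I₇) z
    rwa [ContinuousAt, extChartAt_to_inv] at this
  exact hc.eventually ((r.open_source.preimage continuous_snd).mem_nhds hz)

theorem drWedge_drWedge (r : OpenPartialHomeomorph L ℝ) (a : DForm I₇ (N × L) k ℝ) :
    drWedge r (drWedge r a) = 0 := by
  funext z
  exact covectorWedge_covectorWedge_self (E := EuclideanSpace ℝ (Fin 6) × ℝ) _ _

theorem drWedge_smul {r : OpenPartialHomeomorph L ℝ} {k : ℕ} (c : ℝ) (a : DForm I₇ (N × L) k ℝ)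
    (z : N × L) :
    drWedge r (c • a) z = c • drWedge r a z :=
  covectorWedge_smul _ _ _

theorem lift_smul {k : ℕ} (c : ℝ) (a : DForm (𝓡 6) N k ℝ) :
    lift (L := L) (c • a) = c • lift (L := L) a := rfl

theorem drWedge_zero {r : OpenPartialHomeomorph L ℝ} {k : ℕ} : drWedge r (0 : DForm I₇
    (N × L) k ℝ) = 0 := by
  funext z
  exact map_zero (covectorWedgeₗ (E := EuclideanSpace ℝ (Fin 6) × ℝ) k (drCovector r z))

theorem mdifferentiableAt_coord {r : OpenPartialHomeomorph L ℝ}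
    (hr : r ∈ IsManifold.maximalAtlas 𝓘(ℝ, ℝ) ∞ L) {z : N × L} (hz : z.2 ∈ r.source) :
    MDifferentiableAt I₇ 𝓘(ℝ, ℝ) (fun z : N × L => r z.2) z := by
  have h := (contMDiffAt_of_mem_maximalAtlas hr hz).mdifferentiableAt (by simp)
  exact h.comp z mdifferentiableAt_snd

variable [IsManifold 𝓘(ℝ, ℝ) ∞ L]

theorem contDiffAt_chartCoord {r : OpenPartialHomeomorph L ℝ}
    (hr : r ∈ IsManifold.maximalAtlas 𝓘(ℝ, ℝ) ∞ L) {z : N × L} (hz : z.2 ∈ r.source) :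
    ContDiffAt ℝ ∞ (chartCoord r z) (extChartAt I₇ z z) := by
  have h1 : ContMDiffAt 𝓘(ℝ, ℝ) 𝓘(ℝ, ℝ) ∞ (extChartAt 𝓘(ℝ, ℝ) z.2).symm
      (extChartAt 𝓘(ℝ, ℝ) z.2 z.2) :=
    (contMDiffOn_extChartAt_symm z.2).contMDiffAt (extChartAt_target_mem_nhds z.2)
  have h2 : ContMDiffAt 𝓘(ℝ, ℝ) 𝓘(ℝ, ℝ) ∞ r
      ((extChartAt 𝓘(ℝ, ℝ) z.2).symm (extChartAt 𝓘(ℝ, ℝ) z.2 z.2)) := by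
    rw [extChartAt_to_inv]
    exact contMDiffAt_of_mem_maximalAtlas hr hz
  have h3 : ContDiffAt ℝ ∞ (r ∘ (extChartAt 𝓘(ℝ, ℝ) z.2).symm) (extChartAt 𝓘(ℝ, ℝ) z.2 z.2) :=
    (h2.comp _ h1).contDiffAt
  have h4 : (extChartAt I₇ z z).2 = extChartAt 𝓘(ℝ, ℝ) z.2 z.2 := by
    rw [extChartAt_prod]; rfl
  rw [← h4] at h3
  exact h3.comp _ contDiffAt_snd

theorem contDiffAt_comp_chartCoord {r : OpenPartialHomeomorph L ℝ} {f : ℝ → ℝ} {z : N × L}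
    (hr : r ∈ IsManifold.maximalAtlas 𝓘(ℝ, ℝ) ∞ L)
    (hz : z.2 ∈ r.source) (hf : ContDiffAt ℝ ∞ f (r z.2)) :
    ContDiffAt ℝ ∞ (fun y => f (chartCoord r z y)) (extChartAt I₇ z z) := by
  rw [← chartCoord_self r z] at hf
  exact hf.comp _ (contDiffAt_chartCoord hr hz)

theorem smoothFormAt_coordSmul {r : OpenPartialHomeomorph L ℝ} {k : ℕ} {f : ℝ → ℝ}
    {a : DForm I₇ (N × L) k ℝ} {z : N × L} (hr : r ∈ IsManifold.maximalAtlas 𝓘(ℝ, ℝ) ∞ L)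
    (hz : z.2 ∈ r.source) (hf : ContDiffAt ℝ ∞ f (r z.2)) (ha : SmoothFormAt a z) :
    SmoothFormAt (coordSmul r f a) z := by
  unfold SmoothFormAt
  rw [chartForm_coordSmul]
  exact (contDiffAt_comp_chartCoord hr hz hf).smul ha

variable [IsManifold (𝓡 6) ∞ N]

theorem chartForm_lift {k : ℕ} {F : Type*} [NormedAddCommGroup F] [NormedSpace ℝ F]
    (a : DForm (𝓡 6) N k F) (z : N × L) :
    chartForm (lift (L := L) a) z =ᶠ[𝓝 (extChartAt I₇ z z)] fun y =>
      (chartForm a z.1 y.1).compContinuousLinearMap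
        (ContinuousLinearMap.fst ℝ (EuclideanSpace ℝ (Fin 6)) ℝ) := by
  filter_upwards [extChartAt_target_mem_nhds z] with y hy
  have hy1 : y.1 ∈ (extChartAt (𝓡 6) z.1).target := by
    rw [extChartAt_prod] at hy; exact hy.1
  have h1 := mfderiv_comp y (I' := I₇) (I'' := 𝓡 6) (g := (Prod.fst : N × L → N))
    (f := (extChartAt I₇ z).symm) mdifferentiableAt_fst (mdifferentiableAt_extChartAt_symm hy)
  have h2 := mfderiv_comp y (I := 𝓘(ℝ, EuclideanSpace ℝ (Fin 6) × ℝ))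
    (I' := 𝓘(ℝ, EuclideanSpace ℝ (Fin 6))) (I'' := 𝓡 6)
    (g := (extChartAt (𝓡 6) z.1).symm)
    (f := (Prod.fst : EuclideanSpace ℝ (Fin 6) × ℝ → EuclideanSpace ℝ (Fin 6)))
    (mdifferentiableAt_extChartAt_symm hy1) differentiableAt_fst.mdifferentiableAt
  have h3 : (Prod.fst : N × L → N) ∘ (extChartAt I₇ z).symm =
      (extChartAt (𝓡 6) z.1).symm ∘ Prod.fst := by
    funext y; rw [Function.comp_apply, extChartAt_I₇_symm_apply]; rfl
  have h4 : mfderiv 𝓘(ℝ, EuclideanSpace ℝ (Fin 6) × ℝ) 𝓘(ℝ, EuclideanSpace ℝ (Fin 6))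
      (Prod.fst : EuclideanSpace ℝ (Fin 6) × ℝ → EuclideanSpace ℝ (Fin 6)) y =
      ContinuousLinearMap.fst ℝ (EuclideanSpace ℝ (Fin 6)) ℝ := by
    rw [mfderiv_eq_fderiv]; exact fderiv_fst
  rw [h3, h2, h4] at h1
  have h5 (v : EuclideanSpace ℝ (Fin 6) × ℝ) := DFunLike.congr_fun h1 v
  ext v
  change a ((extChartAt I₇ z).symm y).1 _ = a ((extChartAt (𝓡 6) z.1).symm y.1) _
  rw [extChartAt_I₇_symm_apply]
  refine congrArg (a ((extChartAt (𝓡 6) z.1).symm y.1)) (funext fun i => ?_)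
  refine (h5 (v i)).symm.trans ?_
  rfl

theorem drCovector_comp_chart {r : OpenPartialHomeomorph L ℝ}
    (hr : r ∈ IsManifold.maximalAtlas 𝓘(ℝ, ℝ) ∞ L) {z : N × L} (hz : z.2 ∈ r.source) :
    ∀ᶠ y in 𝓝 (extChartAt I₇ z z),
      (drCovector r ((extChartAt I₇ z).symm y)).comp
        (mfderiv 𝓘(ℝ, EuclideanSpace ℝ (Fin 6) × ℝ) I₇ (extChartAt I₇ z).symm y) =
      fderiv ℝ (chartCoord r z) y := by
  filter_upwards [extChartAt_target_mem_nhds z, eventually_chart_symm_mem_source hz] with y hy hy'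
  have h1 := mfderiv_comp y (I' := I₇) (I'' := 𝓘(ℝ, ℝ)) (g := fun z : N × L => r z.2)
    (f := (extChartAt I₇ z).symm) (mdifferentiableAt_coord hr hy')
    (mdifferentiableAt_extChartAt_symm hy)
  have h2 : (fun z : N × L => r z.2) ∘ (extChartAt I₇ z).symm = chartCoord r z := by
    funext y; rw [Function.comp_apply, extChartAt_I₇_symm_apply]; rfl
  rw [h2, mfderiv_eq_fderiv] at h1
  exact h1.symm

theorem fderiv_chartCoord_self {r : OpenPartialHomeomorph L ℝ}
    (hr : r ∈ IsManifold.maximalAtlas 𝓘(ℝ, ℝ) ∞ L) {z : N × L} (hz : z.2 ∈ r.source) :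
    fderiv ℝ (chartCoord r z) (extChartAt I₇ z z) = drCovector r z := by
  have h := (drCovector_comp_chart hr hz).self_of_nhds
  refine ContinuousLinearMap.ext fun v : EuclideanSpace ℝ (Fin 6) × ℝ => ?_
  refine (DFunLike.congr_fun h v).symm.trans ?_
  change (drCovector r ((extChartAt I₇ z).symm (extChartAt I₇ z z)))
    ((mfderiv 𝓘(ℝ, EuclideanSpace ℝ (Fin 6) × ℝ) I₇ (extChartAt I₇ z).symm (extChartAt I₇ z z) :
      EuclideanSpace ℝ (Fin 6) × ℝ →L[ℝ] EuclideanSpace ℝ (Fin 6) × ℝ) v) = _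
  rw [mfderiv_extChartAt_symm_self, extChartAt_to_inv]
  rfl

theorem smoothFormAt_lift {k : ℕ} {F : Type*} [NormedAddCommGroup F] [NormedSpace ℝ F]
    {a : DForm (𝓡 6) N k F} {z : N × L} (ha : SmoothFormAt a z.1) :
    SmoothFormAt (lift (L := L) a) z := by
  have h4 : (extChartAt I₇ z z).1 = extChartAt (𝓡 6) z.1 z.1 := by
    rw [extChartAt_prod]; rfl
  refine ContDiffAt.congr_of_eventuallyEq ?_ (chartForm_lift a z)
  unfold SmoothFormAt at ha
  rw [← h4] at ha
  exact (compContinuousLinearMapCLM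
    (ContinuousLinearMap.fst ℝ (EuclideanSpace ℝ (Fin 6)) ℝ)).contDiff.contDiffAt.comp _
      (ha.comp _ contDiffAt_fst)

theorem d_lift {k : ℕ} {F : Type*} [NormedAddCommGroup F] [NormedSpace ℝ F]
    {a : DForm (𝓡 6) N k F} {z : N × L} (ha : SmoothFormAt a z.1) :
    d (lift (L := L) a) z = lift (d a) z := by
  have h4 : (extChartAt I₇ z z).1 = extChartAt (𝓡 6) z.1 z.1 := by
    rw [extChartAt_prod]; rfl
  have hd := ha.differentiableAt
  rw [← h4] at hd
  rw [d_apply, (chartForm_lift a z).extDeriv_eq]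
  have h := extDeriv_comp_clm (ContinuousLinearMap.fst ℝ (EuclideanSpace ℝ (Fin 6)) ℝ)
    (y := extChartAt I₇ z z) hd
  refine h.trans ?_
  unfold lift pullForm
  rw [d_apply, mfderiv_fst]
  change (extDeriv (chartForm a z.1) (extChartAt I₇ z z).1).compContinuousLinearMap _ = _
  rw [h4]
  rfl

variable {r : OpenPartialHomeomorph L ℝ} {k : ℕ} {f : ℝ → ℝ} {a : DForm I₇ (N × L) k ℝ} {z : N × L}

theorem chartForm_drWedge (hr : r ∈ IsManifold.maximalAtlas 𝓘(ℝ, ℝ) ∞ L) (hz : z.2 ∈ r.source)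
    (a : DForm I₇ (N × L) k ℝ) :
    chartForm (drWedge r a) z =ᶠ[𝓝 (extChartAt I₇ z z)]
      fun y => covectorWedge (fderiv ℝ (chartCoord r z) y) (chartForm a z y) := by
  filter_upwards [drCovector_comp_chart hr hz] with y hy
  rw [← hy]
  exact covectorWedge_comp _ _ _

theorem smoothFormAt_drWedge (hr : r ∈ IsManifold.maximalAtlas 𝓘(ℝ, ℝ) ∞ L)
    (hz : z.2 ∈ r.source) (ha : SmoothFormAt a z) : SmoothFormAt (drWedge r a) z := by
  refine ContDiffAt.congr_of_eventuallyEq ?_ (chartForm_drWedge hr hz a)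
  exact contDiffAt_covectorWedge
    ((contDiffAt_chartCoord hr hz).fderiv_right (m := ∞) (by simp)) ha

theorem d_coordSmul (hr : r ∈ IsManifold.maximalAtlas 𝓘(ℝ, ℝ) ∞ L)
    (hz : z.2 ∈ r.source) (hf : ContDiffAt ℝ ∞ f (r z.2)) (ha : SmoothFormAt a z) :
    d (coordSmul r f a) z =
      coordSmul r (deriv f) (drWedge r a) z +
        coordSmul r f (d a) z := by
  have hρ := (contDiffAt_chartCoord hr hz).differentiableAt (by simp)
  have hfd : DifferentiableAt ℝ f (chartCoord r z (extChartAt I₇ z z)) := by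
    rw [chartCoord_self]; exact hf.differentiableAt (by simp)
  have h1 : fderiv ℝ (fun y => f (chartCoord r z y)) (extChartAt I₇ z z) =
      deriv f (r z.2) • (drCovector r z : EuclideanSpace ℝ (Fin 6) × ℝ →L[ℝ] ℝ) := by
    rw [← chartCoord_self r z, ← fderiv_chartCoord_self hr hz]
    exact (hfd.hasDerivAt.comp_hasFDerivAt _ hρ.hasFDerivAt).fderiv
  rw [d_apply, chartForm_coordSmul]
  refine (extDeriv_fun_smul' ((contDiffAt_comp_chartCoord hr hz hf).differentiableAt (by simp))
    ha.differentiableAt).trans ?_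
  rw [h1, chartCoord_self, chartForm_self]
  unfold coordSmul drWedge
  rw [d_apply]
  congr 1
  exact smul_covectorWedge (V := EuclideanSpace ℝ (Fin 6) × ℝ) _ _ _

theorem d_drWedge (hr : r ∈ IsManifold.maximalAtlas 𝓘(ℝ, ℝ) ∞ L)
    (hz : z.2 ∈ r.source) (ha : SmoothFormAt a z) :
    d (drWedge r a) z = -drWedge r (d a) z := by
  rw [d_apply, (chartForm_drWedge hr hz a).extDeriv_eq,
    extDeriv_covectorWedge_fderiv (contDiffAt_chartCoord hr hz) ha, fderiv_chartCoord_self hr hz]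
  unfold drWedge
  rw [d_apply]
  rfl

end Warped


section BaseForms

open Filter Topology

variable {N : Type*} [TopologicalSpace N] [ChartedSpace (EuclideanSpace ℝ (Fin 6)) N]
  [IsManifold (𝓡 6) ∞ N]
variable {L : Type*} [TopologicalSpace L] [ChartedSpace ℝ L]
variable (S : SU3Structure N) (r : OpenPartialHomeomorph L ℝ)

/-- The `3`-form `a Re Ω + b Im Ω + c dr ∧ ω`, with coefficients depending on `r`. -/
def baseThree (a b c : ℝ → ℝ) : DForm I₇ (N × L) 3 ℝ :=
  coordSmul r a (lift (reForm S.Omega)) + coordSmul r b (lift (imForm S.Omega)) +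
    coordSmul r c (drWedge r (lift S.omega))

/-- The `4`-form `p ω² + q dr ∧ Re Ω + s dr ∧ Im Ω`, with coefficients depending on `r`. -/
def baseFour (p q s : ℝ → ℝ) : DForm I₇ (N × L) 4 ℝ :=
  coordSmul r p (lift (dwedge S.omega S.omega : DForm (𝓡 6) N 4 ℝ)) +
    coordSmul r q (drWedge r (lift (reForm S.Omega))) +
    coordSmul r s (drWedge r (lift (imForm S.Omega)))

variable {S} {lam : ℝ}

theorem smoothFormAt_reForm (x : N) : SmoothFormAt (reForm S.Omega) x :=
  (S.smooth_Omega.smoothFormAt x).clm_comp Complex.reCLM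

theorem smoothFormAt_imForm (x : N) : SmoothFormAt (imForm S.Omega) x :=
  (S.smooth_Omega.smoothFormAt x).clm_comp Complex.imCLM

theorem smoothFormAt_omega_sq (x : N) :
    SmoothFormAt (dwedge S.omega S.omega : DForm (𝓡 6) N 4 ℝ) x :=
  (S.smooth_omega.smoothFormAt x).dwedge (S.smooth_omega.smoothFormAt x)

theorem SU3Structure.IsOfType.d_reForm (hS : S.IsOfType lam) : d (reForm S.Omega) = 0 := by
  funext x
  refine (d_clm_comp Complex.reCLM (S.smooth_Omega.smoothFormAt x)).trans ?_
  rw [hS.d_Omega]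
  ext v
  change Complex.re ((2 * lam * Complex.I : ℂ) • (((dwedge S.omega S.omega : DForm
      (𝓡 6) N 4 ℝ) x v : ℝ) : ℂ)) = 0
  simp

theorem SU3Structure.IsOfType.d_imForm (hS : S.IsOfType lam) :
    d (imForm S.Omega) = (2 * lam) • (dwedge S.omega S.omega : DForm (𝓡 6) N 4 ℝ) := by
  funext x
  refine (d_clm_comp Complex.imCLM (S.smooth_Omega.smoothFormAt x)).trans ?_
  rw [hS.d_Omega]
  ext v
  change Complex.im ((2 * lam * Complex.I : ℂ) • (((dwedge S.omega S.omega : DForm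
      (𝓡 6) N 4 ℝ) x v : ℝ) : ℂ)) =
    (2 * lam) * (dwedge S.omega S.omega : DForm (𝓡 6) N 4 ℝ) x v
  simp

variable {r}
variable [IsManifold 𝓘(ℝ, ℝ) ∞ L]
variable {z : N × L} {a b c p q s : ℝ → ℝ}

theorem smoothFormAt_baseThree (hr : r ∈ IsManifold.maximalAtlas 𝓘(ℝ, ℝ) ∞ L) (hz : z.2 ∈ r.source)
    (ha : ContDiffAt ℝ ∞ a (r z.2)) (hb : ContDiffAt ℝ ∞ b (r z.2))
    (hc : ContDiffAt ℝ ∞ c (r z.2)) : SmoothFormAt (baseThree S r a b c) z :=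
  ((smoothFormAt_coordSmul hr hz ha (smoothFormAt_lift (smoothFormAt_reForm z.1))).add
    (smoothFormAt_coordSmul hr hz hb (smoothFormAt_lift (smoothFormAt_imForm z.1)))).add
    (smoothFormAt_coordSmul hr hz hc (smoothFormAt_drWedge hr hz
      (smoothFormAt_lift (S.smooth_omega.smoothFormAt z.1))))

theorem d_coordSmul_drWedge {k : ℕ} {f : ℝ → ℝ} {a : DForm (𝓡 6) N k ℝ}
    (hr : r ∈ IsManifold.maximalAtlas 𝓘(ℝ, ℝ) ∞ L) (hz : z.2 ∈ r.source)
    (hf : ContDiffAt ℝ ∞ f (r z.2)) (ha : SmoothFormAt a z.1) :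
    d (coordSmul r f (drWedge r (lift a))) z = -(f (r z.2) • drWedge r (lift (d a)) z) := by
  rw [d_coordSmul hr hz hf (smoothFormAt_drWedge hr hz (smoothFormAt_lift ha)), drWedge_drWedge]
  unfold coordSmul
  rw [d_drWedge hr hz (smoothFormAt_lift ha)]
  have h : drWedge r (d (lift (L := L) a)) z = drWedge r (lift (d a)) z := by
    unfold drWedge
    rw [d_lift ha]
  rw [h]
  simp

theorem d_coordSmul_lift {k : ℕ} {f : ℝ → ℝ} {a : DForm (𝓡 6) N k ℝ}
    (hr : r ∈ IsManifold.maximalAtlas 𝓘(ℝ, ℝ) ∞ L) (hz : z.2 ∈ r.source)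
    (hf : ContDiffAt ℝ ∞ f (r z.2)) (ha : SmoothFormAt a z.1) :
    d (coordSmul r f (lift a)) z =
      deriv f (r z.2) • drWedge r (lift a) z + f (r z.2) • lift (d a) z := by
  rw [d_coordSmul hr hz hf (smoothFormAt_lift ha)]
  unfold coordSmul
  rw [d_lift ha]

theorem SU3Structure.IsOfType.d_baseThree (hS : S.IsOfType lam)
    (hr : r ∈ IsManifold.maximalAtlas 𝓘(ℝ, ℝ) ∞ L) (hz : z.2 ∈ r.source)
    (ha : ContDiffAt ℝ ∞ a (r z.2)) (hb : ContDiffAt ℝ ∞ b (r z.2))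
    (hc : ContDiffAt ℝ ∞ c (r z.2)) :
    d (baseThree S r a b c) z = baseFour S r (fun t => 2 * lam * b t)
      (fun t => deriv a t + 3 * lam * c t) (deriv b) z := by
  have h1 := smoothFormAt_coordSmul hr hz ha (smoothFormAt_lift (smoothFormAt_reForm (S := S) z.1))
  have h2 := smoothFormAt_coordSmul hr hz hb (smoothFormAt_lift (smoothFormAt_imForm (S := S) z.1))
  have h3 := smoothFormAt_coordSmul hr hz hc (smoothFormAt_drWedge hr hz
      (smoothFormAt_lift (S.smooth_omega.smoothFormAt z.1)))
  unfold baseThree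
  rw [d_add (h1.add h2) h3, d_add h1 h2, d_coordSmul_lift hr hz ha (smoothFormAt_reForm z.1),
    d_coordSmul_lift hr hz hb (smoothFormAt_imForm z.1),
    d_coordSmul_drWedge hr hz hc (S.smooth_omega.smoothFormAt z.1), hS.d_reForm, hS.d_imForm,
    hS.d_omega]
  unfold baseFour coordSmul
  rw [lift_smul, lift_smul, drWedge_smul]
  have h0 : lift (L := L) (0 : DForm (𝓡 6) N 4 ℝ) z = 0 := rfl
  rw [h0]
  simp only [Pi.smul_apply, Pi.add_apply]
  module

theorem SU3Structure.IsOfType.d_baseFour (hS : S.IsOfType lam)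
    (hr : r ∈ IsManifold.maximalAtlas 𝓘(ℝ, ℝ) ∞ L) (hz : z.2 ∈ r.source)
    (hp : ContDiffAt ℝ ∞ p (r z.2)) (hq : ContDiffAt ℝ ∞ q (r z.2))
    (hs : ContDiffAt ℝ ∞ s (r z.2)) :
    d (baseFour S r p q s) z = (deriv p (r z.2) - 2 * lam * s (r z.2)) •
      drWedge r (lift (dwedge S.omega S.omega : DForm (𝓡 6) N 4 ℝ)) z := by
  have h1 := smoothFormAt_coordSmul hr hz hp (smoothFormAt_lift (smoothFormAt_omega_sq (S :=
      S) z.1))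
  have h2 := smoothFormAt_coordSmul hr hz hq (smoothFormAt_drWedge hr hz
    (smoothFormAt_lift (smoothFormAt_reForm (S := S) z.1)))
  have h3 := smoothFormAt_coordSmul hr hz hs (smoothFormAt_drWedge hr hz
    (smoothFormAt_lift (smoothFormAt_imForm (S := S) z.1)))
  unfold baseFour
  rw [d_add (h1.add h2) h3, d_add h1 h2, d_coordSmul_lift hr hz hp (smoothFormAt_omega_sq z.1),
    d_coordSmul_drWedge hr hz hq (smoothFormAt_reForm z.1),
    d_coordSmul_drWedge hr hz hs (smoothFormAt_imForm z.1), hS.d_reForm, hS.d_imForm,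
    hS.d_omega_sq]
  rw [lift_smul, drWedge_smul]
  have h0 : lift (L := L) (0 : DForm (𝓡 6) N 5 ℝ) z = 0 := rfl
  have h0' : lift (L := L) (0 : DForm (𝓡 6) N 4 ℝ) = 0 := rfl
  rw [h0, h0', drWedge_zero, Pi.zero_apply]
  module

end BaseForms


section ProductFrame

variable {V : Type*} [AddCommGroup V] [Module ℝ V] [TopologicalSpace V]
variable {T : Type*} [AddCommGroup T] [Module ℝ T] [TopologicalSpace T]

theorem IsOrthonormalFrame.snoc [FiniteDimensional ℝ V] [IsTopologicalAddGroup V]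
    [ContinuousSMul ℝ V] {n : ℕ} (hV : Module.finrank ℝ V = n + 1) {gT : T →L[ℝ] T →L[ℝ] ℝ}
    {gV : V →L[ℝ] V →L[ℝ] ℝ} {e : Fin n → T} {ε : Fin n → T →L[ℝ] ℝ}
    (he : IsOrthonormalFrame gT e ε) {P : V →L[ℝ] T} {ι : T → V} {τ : V →L[ℝ] ℝ} {t : V}
    (hι : ∀ u, P (ι u) = u) (hτι : ∀ u, τ (ι u) = 0) (ht : P t = 0) (hτ : τ t = 1) {a b : ℝ}
    (ha : a ≠ 0) (hb : b ≠ 0)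
    (hg : ∀ u v, gV u v = b ^ 2 * (τ u * τ v) + a ^ 2 * gT (P u) (P v)) :
    IsOrthonormalFrame gV (Fin.snoc (fun i => a⁻¹ • ι (e i)) (b⁻¹ • t) : Fin (n + 1) → V)
      (Fin.snoc (fun i => a • (ε i).comp P) (b • τ) : Fin (n + 1) → V →L[ℝ] ℝ) := by
  refine ⟨IsFrame.of_dual hV fun i j => ?_, fun u v => ?_⟩
  · induction i using Fin.lastCases with
    | last =>
      induction j using Fin.lastCases with
      | last => simp [hτ, hb]
      | cast j => simp [hτι, (Fin.castSucc_lt_last j).ne']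
    | cast i =>
      induction j using Fin.lastCases with
      | last => simp [ht, (Fin.castSucc_lt_last i).ne]
      | cast j => simp [hι, he.dual, ha]
  · rw [Fin.sum_univ_castSucc, hg, he.metric, Finset.mul_sum]
    simp only [Fin.snoc_castSucc, Fin.snoc_last, smul_apply,
      ContinuousLinearMap.comp_apply, smul_eq_mul]
    rw [add_comm]
    congr 1
    · exact Finset.sum_congr rfl fun i _ => by ring
    · ring

theorem detForm_smul_comp {A : Type*} [NormedCommRing A] [NormedAlgebra ℝ A] {k : ℕ} (c : ℝ)
    (α : Fin k → T →L[ℝ] A) (P : V →L[ℝ] T) :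
    detForm (fun i => c • (α i).comp P) = c ^ k • (detForm α).compContinuousLinearMap P := by
  ext v
  rw [ContinuousAlternatingMap.smul_apply, ContinuousAlternatingMap.compContinuousLinearMap_apply,
    detForm_apply, detForm_apply]
  have h : (Matrix.of fun i j => (c • (α i).comp P) (v j)) =
      c • Matrix.of fun i j => α i ((P ∘ v) j) := by
    ext i j; rfl
  rw [h, Matrix.det_smul_of_tower, Fintype.card_fin]

theorem detForm_snoc_smul_comp [ContinuousConstSMul ℝ V] {k : ℕ} (b c : ℝ) (α : Fin k → T →L[ℝ] ℝ)
    (P : V →L[ℝ] T) (τ : V →L[ℝ] ℝ) :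
    detForm (Fin.snoc (fun i => c • (α i).comp P) (b • τ) : Fin (k + 1) → V →L[ℝ] ℝ) =
      (b * c ^ k) • wedge ((detForm α).compContinuousLinearMap P)
        (ContinuousAlternatingMap.ofSubsingleton ℝ V ℝ (0 : Fin 1) τ) := by
  have h : ContinuousAlternatingMap.ofSubsingleton ℝ V ℝ (0 : Fin 1) (b • τ) =
      b • ContinuousAlternatingMap.ofSubsingleton ℝ V ℝ (0 : Fin 1) τ := rfl
  rw [mul_comm, mul_smul, ← wedge_smul_right, ← h, ← wedge_smul_left, ← detForm_smul_comp,
    ofSubsingleton_eq_detForm, wedge_detForm, Fin.append_right_eq_snoc]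

theorem stdKahler_smul_comp (c : ℝ) (α : Fin 6 → T →L[ℝ] ℝ) (P : V →L[ℝ] T) :
    stdKahler (fun i => c • (α i).comp P) = c ^ 2 • (stdKahler α).compContinuousLinearMap P := by
  have h (i j : Fin 6) : detForm ![c • (α i).comp P, c • (α j).comp P] =
      c ^ 2 • (detForm ![α i, α j]).compContinuousLinearMap P := by
    rw [← detForm_smul_comp]
    congr 1
    ext i; fin_cases i <;> rfl
  simp only [stdKahler, h, ← smul_add]
  rfl

theorem stdKahlerSq_smul_comp (c : ℝ) (α : Fin 6 → T →L[ℝ] ℝ) (P : V →L[ℝ] T) :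
    stdKahlerSq (fun i => c • (α i).comp P) =
      c ^ 4 • (stdKahlerSq α).compContinuousLinearMap P := by
  have h (i j k l : Fin 6) : detForm ![c • (α i).comp P, c • (α j).comp P, c • (α k).comp P,
      c • (α l).comp P] = c ^ 4 • (detForm ![α i, α j, α k, α l]).compContinuousLinearMap P := by
    rw [← detForm_smul_comp]
    congr 1
    ext i; fin_cases i <;> rfl
  simp only [stdKahlerSq, h, ← smul_add]
  rfl

theorem stdOmega_smul_comp (c : ℝ) (α : Fin 6 → T →L[ℝ] ℝ) (P : V →L[ℝ] T) :
    stdOmega (fun i => c • (α i).comp P) =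
      c ^ 3 • (stdOmega α).compContinuousLinearMap P := by
  have h (i j : Fin 6) : complexCovector (c • (α i).comp P) (c • (α j).comp P) =
      c • (complexCovector (α i) (α j)).comp P := by
    ext v
    simp [complexCovector]
    ring
  unfold stdOmega
  rw [← detForm_smul_comp]
  simp only [h]
  congr 1
  ext i; fin_cases i <;> rfl

end ProductFrame

section WarpedFrame

open Filter Topology

variable {N : Type*} [TopologicalSpace N] [ChartedSpace (EuclideanSpace ℝ (Fin 6)) N]
variable {L : Type*} [TopologicalSpace L] [ChartedSpace ℝ L]

theorem drCovector_apply {r : OpenPartialHomeomorph L ℝ}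
    (hr : r ∈ IsManifold.maximalAtlas 𝓘(ℝ, ℝ) ∞ L) {z : N × L} (hz : z.2 ∈ r.source)
    (v : EuclideanSpace ℝ (Fin 6) × ℝ) :
    drCovector r z v = (mfderiv 𝓘(ℝ, ℝ) 𝓘(ℝ, ℝ) r z.2 : ℝ →L[ℝ] ℝ) v.2 := by
  have h := mfderiv_comp z (I' := 𝓘(ℝ, ℝ)) (I'' := 𝓘(ℝ, ℝ)) (g := r) (f := (Prod.snd : N × L → L))
    ((contMDiffAt_of_mem_maximalAtlas hr hz).mdifferentiableAt (by simp)) mdifferentiableAt_snd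
    (I := I₇)
  rw [mfderiv_snd] at h
  exact DFunLike.congr_fun h v

theorem drCovector_ddr {r : OpenPartialHomeomorph L ℝ}
    (hr : r ∈ IsManifold.maximalAtlas 𝓘(ℝ, ℝ) ∞ L) {z : N × L} (hz : z.2 ∈ r.source) :
    drCovector r z (ddr N r z) = 1 := by
  have h1 : MDifferentiableAt 𝓘(ℝ, ℝ) 𝓘(ℝ, ℝ) r (r.symm (r z.2)) := by
    rw [r.left_inv hz]
    exact (contMDiffAt_of_mem_maximalAtlas hr hz).mdifferentiableAt (by simp)
  have h := mfderiv_comp (r z.2) (I := 𝓘(ℝ, ℝ)) (I' := 𝓘(ℝ, ℝ)) (I'' := 𝓘(ℝ, ℝ)) (g := r)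
    (f := r.symm) h1
    ((contMDiffAt_symm_of_mem_maximalAtlas hr (r.map_source hz)).mdifferentiableAt (by simp))
  have h2 : (r ∘ r.symm) =ᶠ[𝓝 (r z.2)] id := by
    filter_upwards [r.open_target.mem_nhds (r.map_source hz)] with t ht
    exact r.right_inv ht
  rw [h2.mfderiv_eq, mfderiv_id] at h
  have h3 := DFunLike.congr_fun h (1 : ℝ)
  refine (drCovector_apply hr hz _).trans ?_
  refine Eq.trans ?_ h3.symm
  change _ = (mfderiv 𝓘(ℝ, ℝ) 𝓘(ℝ, ℝ) r (r.symm (r z.2)) : ℝ →L[ℝ] ℝ) _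
  rw [r.left_inv hz]
  rfl

variable [IsManifold (𝓡 6) ∞ N]
variable (S : SU3Structure N) (r : OpenPartialHomeomorph L ℝ) (W : WarpedData)

theorem SU3Structure.vol_apply (x : N) :
    S.vol x = (1 / 6 : ℝ) • wedge (wedge (S.omega x) (S.omega x)) (S.omega x) := by
  unfold SU3Structure.vol dwedge
  rfl

theorem SU3Structure.isSU3 (x : N) : IsSU3 (S.g.inner x) (S.J x) (S.omega x) (S.Omega x) where
  symm := S.g.symm x
  pos := S.g.pos x
  J_J := S.J_J x
  g_J_J := S.g_J_J x
  omega_apply := S.omega_apply x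
  Omega_J := S.Omega_J x
  Omega_conj := by
    rw [← S.vol_apply]
    exact S.Omega_conj x

theorem warpedVol_apply (z : N × L) : warpedVol S r W z =
    (W.G (r z.2) * W.h (r z.2) ^ 6) • (wedge (lift S.vol z) (dr N r z) :
      TangentSpace I₇ z [⋀^Fin 7]→L[ℝ] ℝ) := by
  unfold warpedVol dwedge
  with_reducible rfl

/-- A frame adapted to the warped product `G₂`-structure at `z`. -/
structure IsWarpedFrame (z : N × L) (e : Fin 7 → TangentSpace I₇ z)
    (ε : Fin 7 → TangentSpace I₇ z →L[ℝ] ℝ) : Prop where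
  orthonormal : IsOrthonormalFrame (warpedMetric S r W z) e ε
  vol : warpedVol S r W z = detForm ε
  last : ε 6 = W.G (r z.2) • drCovector r z
  kahler : stdKahler (initCoframe ε) = W.h (r z.2) ^ 2 • lift S.omega z
  kahlerSq : stdKahlerSq (initCoframe ε) = (1 / 2 * W.h (r z.2) ^ 4) •
    lift (dwedge S.omega S.omega : DForm (𝓡 6) N 4 ℝ) z
  re : stdRe (initCoframe ε) = W.h (r z.2) ^ 3 • lift (reForm S.Omega) z
  im : stdIm (initCoframe ε) = W.h (r z.2) ^ 3 • lift (imForm S.Omega) z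

variable {S r W}

theorem exists_isWarpedFrame (hr : r ∈ IsManifold.maximalAtlas 𝓘(ℝ, ℝ) ∞ L) {z : N × L}
    (hz : z.2 ∈ r.source) (hG : W.G (r z.2) ≠ 0) (hh : W.h (r z.2) ≠ 0) :
    ∃ e ε, IsWarpedFrame S r W z e ε := by
  have hT : Module.finrank ℝ (TangentSpace (𝓡 6) z.1) = 6 := by
    change Module.finrank ℝ (EuclideanSpace ℝ (Fin 6)) = 6
    simp
  have hV : Module.finrank ℝ (TangentSpace I₇ z) = 6 + 1 := by
    change Module.finrank ℝ (EuclideanSpace ℝ (Fin 6) × ℝ) = 7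
    simp
  obtain ⟨e, ε, he, hom, hOm⟩ := (S.isSU3 z.1).exists_adaptedFrame hT
  have hf := he.snoc hV (gV := warpedMetric S r W z)
    (P := mfderiv I₇ (𝓡 6) (Prod.fst : N × L → N) z)
    (ι := fun u => ((u, 0) : EuclideanSpace ℝ (Fin 6) × ℝ)) (τ := drCovector r z) (t := ddr N r z)
    (fun u => by rw [mfderiv_fst]; rfl)
    (fun u => by
      rw [drCovector_apply hr hz]
      exact map_zero _)
    (by rw [mfderiv_fst]; rfl) (drCovector_ddr hr hz) hh hG
    (fun u v => rfl)
  set P : TangentSpace I₇ z →L[ℝ] TangentSpace (𝓡 6) z.1 := mfderiv I₇ (𝓡 6)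
      (Prod.fst : N × L → N) z
    with hP
  have hi : initCoframe (Fin.snoc (fun i => W.h (r z.2) • (ε i).comp P)
      (W.G (r z.2) • drCovector r z) : Fin 7 → TangentSpace I₇ z →L[ℝ] ℝ) =
      fun i => W.h (r z.2) • (ε i).comp P := by
    funext i
    exact Fin.snoc_castSucc (n := 6) _ _ _
  have hO : stdOmega (fun i => W.h (r z.2) • (ε i).comp P) =
      W.h (r z.2) ^ 3 • lift (L := L) S.Omega z := by
    rw [stdOmega_smul_comp, ← hOm]
    rfl
  refine ⟨_, _, hf, ?_, Fin.snoc_last (n := 6) _ _, ?_, ?_, ?_, ?_⟩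
  · have h1 : lift (L := L) S.vol z = (detForm ε).compContinuousLinearMap P := by
      rw [← stdKahler_cube, ← hom, ← S.vol_apply]
      rfl
    rw [warpedVol_apply, h1]
    have h2 := detForm_snoc_smul_comp (W.G (r z.2)) (W.h (r z.2)) ε P (drCovector r z)
    have h3 : ContinuousAlternatingMap.ofSubsingleton ℝ (TangentSpace I₇ z) ℝ (0 : Fin 1)
        (drCovector r z) = dr N r z := rfl
    rw [h3] at h2
    with_reducible exact h2.symm
  · rw [hi, stdKahler_smul_comp, ← hom]
    rfl
  · rw [hi, stdKahlerSq_smul_comp, mul_comm, mul_smul]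
    congr 1
    have h1 : lift (L := L) (dwedge S.omega S.omega : DForm (𝓡 6) N 4 ℝ) z =
        ((2 : ℝ) • stdKahlerSq ε).compContinuousLinearMap P := by
      rw [← wedge_stdKahler, ← hom]
      rfl
    have h2 : ((2 : ℝ) • stdKahlerSq ε).compContinuousLinearMap P =
        (2 : ℝ) • (stdKahlerSq ε).compContinuousLinearMap P := rfl
    rw [h1, h2, smul_smul]
    norm_num
  · rw [hi, ← re_stdOmega, hO]
    ext v
    exact Complex.smul_re _ _
  · rw [hi, ← im_stdOmega, hO]
    ext v
    exact Complex.smul_im _ _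

end WarpedFrame


section StarModel

variable {V : Type*} [AddCommGroup V] [Module ℝ V] [TopologicalSpace V] [FiniteDimensional ℝ V]
  [IsTopologicalAddGroup V] [ContinuousSMul ℝ V]

theorem IsOrthonormalFrame.hodgeStar_model {g : V →L[ℝ] V →L[ℝ] ℝ} {e : Fin 7 → V}
    {ε : Fin 7 → V →L[ℝ] ℝ} (h : IsOrthonormalFrame g e ε) {vol : V [⋀^Fin 7]→L[ℝ] ℝ}
    (hv : vol = detForm ε) (p q s : ℝ) :
    hodgeStar (k := 4) (m := 3) g vol (p • stdKahlerSq (initCoframe ε) +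
        q • covectorWedge (ε 6) (stdRe (initCoframe ε)) +
        s • covectorWedge (ε 6) (stdIm (initCoframe ε))) =
      (-s) • stdRe (initCoframe ε) + q • stdIm (initCoframe ε) +
        p • covectorWedge (ε 6) (stdKahler (initCoframe ε)) := by
  subst hv
  rw [hodgeStar_add, hodgeStar_add, hodgeStar_smul, hodgeStar_smul, hodgeStar_smul,
    h.hodgeStar_stdKahlerSq, h.hodgeStar_stdIm, h.hodgeStar_stdRe, smul_neg, ← neg_smul]
  abel

end StarModel

section WarpedForms

variable {N : Type*} [TopologicalSpace N] [ChartedSpace (EuclideanSpace ℝ (Fin 6)) N]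
variable {L : Type*} [TopologicalSpace L] [ChartedSpace ℝ L]

theorem wedge_dr_left (r : OpenPartialHomeomorph L ℝ) {k : ℕ} (z : N × L)
    (a : TangentSpace I₇ z [⋀^Fin k]→L[ℝ] ℝ)
    (v : Fin (1 + k) → TangentSpace I₇ z) :
    wedge (dr N r z) a v = covectorWedge (drCovector r z) a fun i => v (Fin.cast
        (add_comm k 1) i) := by
  obtain ⟨n, e, ε, h⟩ := exists_isFrame (EuclideanSpace ℝ (Fin 6) × ℝ)
  exact h.wedge_covector_left (drCovector r z) a v

theorem wedge_dr_right (r : OpenPartialHomeomorph L ℝ) {k : ℕ} (z : N × L)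
    (a : TangentSpace I₇ z [⋀^Fin k]→L[ℝ] ℝ) :
    wedge a (dr N r z) = ((-1) ^ k : ℝ) • covectorWedge (drCovector r z) a := by
  obtain ⟨n, e, ε, h⟩ := exists_isFrame (EuclideanSpace ℝ (Fin 6) × ℝ)
  exact h.wedge_covector_right (drCovector r z) a

section

variable [IsManifold (𝓡 6) ∞ N]

variable (S : SU3Structure N) (r : OpenPartialHomeomorph L ℝ) (W : WarpedData)

theorem reForm_cubeOmega (z : N × L) : reForm (cubeOmega S r W) z =
    (W.h (r z.2) ^ 3 * Real.cos (W.θ (r z.2))) • lift (L := L) (reForm S.Omega) z +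
      (-(W.h (r z.2) ^ 3 * Real.sin (W.θ (r z.2)))) • lift (L := L) (imForm S.Omega) z := by
  ext v
  change Complex.re (((W.h (r z.2) : ℂ) ^ 3 * Complex.exp (Complex.I * W.θ (r z.2))) *
    lift (L := L) S.Omega z v) = (W.h (r z.2) ^ 3 * Real.cos (W.θ (r z.2))) *
      Complex.re (lift (L := L) S.Omega z v) + (-(W.h (r z.2) ^ 3 * Real.sin (W.θ (r z.2)))) *
      Complex.im (lift (L := L) S.Omega z v)
  rw [mul_comm Complex.I, Complex.exp_mul_I, ← Complex.ofReal_cos, ← Complex.ofReal_sin,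
    ← Complex.ofReal_pow]
  generalize W.h (r z.2) ^ 3 = A
  generalize Real.cos (W.θ (r z.2)) = c
  generalize Real.sin (W.θ (r z.2)) = s
  simp
  ring

theorem imForm_cubeOmega (z : N × L) : imForm (cubeOmega S r W) z =
    (W.h (r z.2) ^ 3 * Real.sin (W.θ (r z.2))) • lift (L := L) (reForm S.Omega) z +
      (W.h (r z.2) ^ 3 * Real.cos (W.θ (r z.2))) • lift (L := L) (imForm S.Omega) z := by
  ext v
  change Complex.im (((W.h (r z.2) : ℂ) ^ 3 * Complex.exp (Complex.I * W.θ (r z.2))) *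
    lift (L := L) S.Omega z v) = (W.h (r z.2) ^ 3 * Real.sin (W.θ (r z.2))) *
      Complex.re (lift (L := L) S.Omega z v) + (W.h (r z.2) ^ 3 * Real.cos (W.θ (r z.2))) *
      Complex.im (lift (L := L) S.Omega z v)
  rw [mul_comm Complex.I, Complex.exp_mul_I, ← Complex.ofReal_cos, ← Complex.ofReal_sin,
    ← Complex.ofReal_pow]
  generalize W.h (r z.2) ^ 3 = A
  generalize Real.cos (W.θ (r z.2)) = c
  generalize Real.sin (W.θ (r z.2)) = s
  simp
  ring

theorem warpedφ_eq : warpedφ S r W = baseThree S r (fun t => W.h t ^ 3 * Real.cos (W.θ t))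
    (fun t => -(W.h t ^ 3 * Real.sin (W.θ t))) (fun t => W.G t * W.h t ^ 2) := by
  funext z
  unfold warpedφ
  rw [reForm_cubeOmega]
  have h : (dwedge (dr N r) (lift S.omega) : DForm I₇ (N × L) 3 ℝ) z =
      drWedge r (lift S.omega) z := by
    ext v
    exact wedge_dr_left r z (lift S.omega z) v
  rw [h]
  rfl

theorem warpedψ_eq : warpedψ S r W = baseFour S r (fun t => 1 / 2 * W.h t ^ 4)
    (fun t => -(W.G t * (W.h t ^ 3 * Real.sin (W.θ t))))
    (fun t => -(W.G t * (W.h t ^ 3 * Real.cos (W.θ t)))) := by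
  funext z
  unfold warpedψ
  have h : (dwedge (imForm (cubeOmega S r W)) (dr N r) : DForm I₇ (N × L) 4 ℝ) z =
      (-(W.h (r z.2) ^ 3 * Real.sin (W.θ (r z.2)))) • drWedge r (lift (reForm S.Omega)) z +
      (-(W.h (r z.2) ^ 3 * Real.cos (W.θ (r z.2)))) • drWedge r (lift (imForm S.Omega)) z := by
    unfold dwedge drWedge
    refine (wedge_dr_right r z _).trans ?_
    rw [imForm_cubeOmega, covectorWedge_add, covectorWedge_smul, covectorWedge_smul, smul_add,
      smul_smul, smul_smul, show (-1 : ℝ) ^ 3 = -1 by norm_num, neg_one_mul, neg_one_mul]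
  have h' : (dwedge (lift S.omega) (lift S.omega) : DForm I₇ (N × L) 4 ℝ) z =
      lift (dwedge S.omega S.omega : DForm (𝓡 6) N 4 ℝ) z :=
    (wedge_comp _ _ _).symm
  rw [h, h', smul_add, smul_smul, smul_smul, ← add_assoc, mul_neg, mul_neg]
  rfl

end

variable [IsManifold (𝓡 6) ∞ N]
variable {S : SU3Structure N} {r : OpenPartialHomeomorph L ℝ} {W : WarpedData} {z : N × L}
  {e : Fin 7 → TangentSpace I₇ z} {ε : Fin 7 → TangentSpace I₇ z →L[ℝ] ℝ}

theorem IsWarpedFrame.baseFour_eq (h : IsWarpedFrame S r W z e ε) (hG : W.G (r z.2) ≠ 0)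
    (hh : W.h (r z.2) ≠ 0) (p q s : ℝ → ℝ) : baseFour S r p q s z =
      (2 * p (r z.2) / W.h (r z.2) ^ 4) • stdKahlerSq (initCoframe ε) +
      (q (r z.2) / (W.G (r z.2) * W.h (r z.2) ^ 3)) •
        covectorWedge (ε 6) (stdRe (initCoframe ε)) +
      (s (r z.2) / (W.G (r z.2) * W.h (r z.2) ^ 3)) •
        covectorWedge (ε 6) (stdIm (initCoframe ε)) := by
  rw [h.kahlerSq, h.re, h.im, h.last]
  simp only [covectorWedge_smul, smul_covectorWedge, smul_smul]
  change p (r z.2) • _ + q (r z.2) • covectorWedge _ _ + s (r z.2) • covectorWedge _ _ = _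
  refine congrArg₂ (· + ·) (congrArg₂ (· + ·) (congrArg (· • _) ?_) (congrArg (· • _) ?_))
    (congrArg (· • _) ?_) <;> field_simp

theorem IsWarpedFrame.baseThree_eq (h : IsWarpedFrame S r W z e ε) (hG : W.G (r z.2) ≠ 0)
    (hh : W.h (r z.2) ≠ 0) (a b c : ℝ → ℝ) : baseThree S r a b c z =
      (a (r z.2) / W.h (r z.2) ^ 3) • stdRe (initCoframe ε) +
      (b (r z.2) / W.h (r z.2) ^ 3) • stdIm (initCoframe ε) +
      (c (r z.2) / (W.G (r z.2) * W.h (r z.2) ^ 2)) •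
        covectorWedge (ε 6) (stdKahler (initCoframe ε)) := by
  rw [h.kahler, h.re, h.im, h.last]
  simp only [covectorWedge_smul, smul_covectorWedge, smul_smul]
  change a (r z.2) • _ + b (r z.2) • _ + c (r z.2) • covectorWedge _ _ = _
  refine congrArg₂ (· + ·) (congrArg₂ (· + ·) (congrArg (· • _) ?_) (congrArg (· • _) ?_))
    (congrArg (· • _) ?_) <;> field_simp

theorem IsWarpedFrame.star_baseFour (h : IsWarpedFrame S r W z e ε) (hG : W.G (r z.2) ≠ 0)
    (hh : W.h (r z.2) ≠ 0) (p q s : ℝ → ℝ) :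
    star (k := 4) (m := 3) (warpedMetric S r W) (warpedVol S r W) (baseFour S r p q s) z =
      baseThree S r (fun t => -(s t / W.G t)) (fun t => q t / W.G t)
        (fun t => 2 * (p t * W.G t / W.h t ^ 2)) z := by
  unfold WarpedCoflow.star
  rw [h.baseFour_eq hG hh, h.baseThree_eq hG hh]
  rw [h.orthonormal.hodgeStar_model h.vol]
  refine congrArg₂ (· + ·) (congrArg₂ (· + ·) (congrArg (· • _) ?_) (congrArg (· • _) ?_))
    (congrArg (· • _) ?_) <;> field_simp

theorem IsWarpedFrame.framePairing_baseFour (h : IsWarpedFrame S r W z e ε) (hG : W.G (r z.2) ≠ 0)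
    (hh : W.h (r z.2) ≠ 0) (p q s p' q' s' : ℝ → ℝ) :
    framePairing e (baseFour S r p q s z) (baseFour S r p' q' s' z) =
      12 * (p (r z.2) * p' (r z.2)) / W.h (r z.2) ^ 8 +
        4 * (q (r z.2) * q' (r z.2) + s (r z.2) * s' (r z.2)) /
          (W.G (r z.2) ^ 2 * W.h (r z.2) ^ 6) := by
  rw [h.baseFour_eq hG hh, h.baseFour_eq hG hh,
    h.orthonormal.toIsFrame.framePairing_model]
  field_simp
  ring

theorem IsWarpedFrame.baseFour_eq_zero (h : IsWarpedFrame S r W z e ε) (hG : W.G (r z.2) ≠ 0)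
    (hh : W.h (r z.2) ≠ 0) {p q s : ℝ → ℝ} (h0 : baseFour S r p q s z = 0) :
    p (r z.2) = 0 ∧ q (r z.2) = 0 ∧ s (r z.2) = 0 := by
  rw [h.baseFour_eq hG hh] at h0
  obtain ⟨h1, h2, h3⟩ := h.orthonormal.toIsFrame.model_eq_zero h0
  simpa [hG, hh] using And.intro h1 (And.intro h2 h3)

theorem IsWarpedFrame.drWedge_omega_sq_ne_zero (h : IsWarpedFrame S r W z e ε) :
    drWedge r (lift (dwedge S.omega S.omega : DForm (𝓡 6) N 4 ℝ)) z ≠ 0 := by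
  intro h0
  apply h.orthonormal.toIsFrame.covectorWedge_stdKahlerSq_ne_zero
  rw [h.kahlerSq, h.last, covectorWedge_smul, smul_covectorWedge]
  change _ • _ • drWedge r (lift (dwedge S.omega S.omega : DForm (𝓡 6) N 4 ℝ)) z = 0
  rw [h0, smul_zero, smul_zero]

end WarpedForms


section Torsion

variable {E : Type*} [NormedAddCommGroup E] [NormedSpace ℝ E]

theorem sum_fin_cons {k N : ℕ} (F : (Fin (k + 1) → Fin N) → ℝ) :
    ∑ i, F i = ∑ a, ∑ b : Fin k → Fin N, F (Fin.cons a b) := by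
  rw [← Fintype.sum_prod_type', ← (Fin.consEquiv fun _ : Fin (k + 1) => Fin N).sum_comp]
  rfl

/-- Full contraction of a function of `k` basis vectors with a `k`-form by the inverse metric. -/
def contraction [FiniteDimensional ℝ E] {k : ℕ} (g : E →L[ℝ] E →L[ℝ] ℝ) (D : (Fin k → E) → ℝ)
    (a : E [⋀^Fin k]→L[ℝ] ℝ) : ℝ :=
  ∑ i : Fin k → Fin (Module.finrank ℝ E), ∑ j : Fin k → Fin (Module.finrank ℝ E),
    (∏ c, inverseMetric g (i c) (j c)) * D (fun c => Module.finBasis ℝ E (i c)) *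
      a fun c => Module.finBasis ℝ E (j c)

theorem contraction_sub [FiniteDimensional ℝ E] {k : ℕ} (g : E →L[ℝ] E →L[ℝ] ℝ)
    (D D' : (Fin k → E) → ℝ) (a : E [⋀^Fin k]→L[ℝ] ℝ) :
    contraction g (fun v => D v - D' v) a = contraction g D a - contraction g D' a := by
  simp only [contraction, mul_sub, sub_mul, Finset.sum_sub_distrib]

theorem contraction_eq_zero [FiniteDimensional ℝ E] {k : ℕ} (g : E →L[ℝ] E →L[ℝ] ℝ)
    {D : (Fin k → E) → ℝ} (a : E [⋀^Fin k]→L[ℝ] ℝ) {p q : Fin k} (hpq : p ≠ q)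
    (hD : ∀ v, D (v ∘ Equiv.swap p q) = D v) : contraction g D a = 0 := by
  have h : contraction g D a = -contraction g D a := by
    unfold contraction
    rw [← Finset.sum_neg_distrib, ← ((Equiv.swap p q).arrowCongr (Equiv.refl _)).sum_comp]
    refine Finset.sum_congr rfl fun i _ => ?_
    rw [← Finset.sum_neg_distrib, ← ((Equiv.swap p q).arrowCongr (Equiv.refl _)).sum_comp]
    refine Finset.sum_congr rfl fun j _ => ?_
    have h1 : (∏ c, inverseMetric g (i ((Equiv.swap p q).symm c)) (j ((Equiv.swap p q).symm c))) =
        ∏ c, inverseMetric g (i c) (j c) :=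
      (Equiv.swap p q).symm.prod_comp fun c => inverseMetric g (i c) (j c)
    have h2 := hD fun c => Module.finBasis ℝ E (i c)
    have h3 : a ((fun c => Module.finBasis ℝ E (j c)) ∘ Equiv.swap p q) =
        -a fun c => Module.finBasis ℝ E (j c) := a.toAlternatingMap.map_swap _ hpq
    change (∏ c, inverseMetric g (i ((Equiv.swap p q).symm c)) (j ((Equiv.swap p q).symm c))) *
      D (((fun c => Module.finBasis ℝ E (i c))) ∘ Equiv.swap p q) *
      a ((fun c => Module.finBasis ℝ E (j c)) ∘ Equiv.swap p q) = _
    rw [h1, h2, h3]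
    ring
  linarith

theorem christoffel_comm [FiniteDimensional ℝ E] {γ : E → E →L[ℝ] E →L[ℝ] ℝ}
    (hγ : ∀ y u v, γ y u v = γ y v u) (y u v : E) : christoffel γ y u v = christoffel γ y v u := by
  have h : (fun z => γ z u v) = fun z => γ z v u := funext fun z => hγ z u v
  unfold christoffel
  rw [h]
  simp only [add_comm]

theorem sum_torsion_eq_contraction [FiniteDimensional ℝ E] (γ : E → E →L[ℝ] E →L[ℝ] ℝ)
    (φ : E → E [⋀^Fin 3]→L[ℝ] ℝ) (ψ : E → E [⋀^Fin 4]→L[ℝ] ℝ) (y : E) :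
    ∑ a, ∑ m, inverseMetric (γ y) a m *
      torsion γ φ ψ y (Module.finBasis ℝ E a) (Module.finBasis ℝ E m) =
    (1 / 24 : ℝ) * contraction (γ y)
      (fun v : Fin 4 → E => covDeriv₃ γ φ y (v 0) (v 1) (v 2) (v 3)) (ψ y) := by
  unfold contraction
  simp only [sum_fin_cons (k := 3)]
  rw [Finset.mul_sum]
  refine Finset.sum_congr rfl fun a _ => ?_
  rw [Finset.sum_comm, Finset.mul_sum]
  refine Finset.sum_congr rfl fun m _ => ?_
  unfold torsion
  rw [Finset.mul_sum, Finset.mul_sum, Finset.mul_sum]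
  refine Finset.sum_congr rfl fun b _ => ?_
  rw [Finset.mul_sum, Finset.mul_sum, Finset.mul_sum]
  refine Finset.sum_congr rfl fun c _ => ?_
  have h : (![Module.finBasis ℝ E m, Module.finBasis ℝ E (c 0), Module.finBasis ℝ E (c 1),
      Module.finBasis ℝ E (c 2)] : Fin 4 → E) = fun s : Fin 4 => Module.finBasis ℝ E
        ((Fin.cons m c : Fin 4 → Fin (Module.finrank ℝ E)) s) := by
    ext s; fin_cases s <;> rfl
  rw [h, Fin.prod_univ_succ (n := 3)]
  simp only [Fin.cons_zero, Fin.cons_succ]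
  change _ = 1 / 24 * (inverseMetric (γ y) a m * (∏ s, inverseMetric (γ y) (b s) (c s)) *
    covDeriv₃ γ φ y (Module.finBasis ℝ E a) (Module.finBasis ℝ E (b 0)) (Module.finBasis ℝ E (b 1))
        (Module.finBasis ℝ E (b 2)) * _)
  ring

theorem contraction_covDeriv [FiniteDimensional ℝ E] {γ : E → E →L[ℝ] E →L[ℝ] ℝ}
    (hγ : ∀ y u v, γ y u v = γ y v u) {φ : E → E [⋀^Fin 3]→L[ℝ] ℝ} (ψ : E [⋀^Fin 4]→L[ℝ] ℝ)
    {y : E} (hφ : DifferentiableAt ℝ φ y) :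
    contraction (γ y) (fun v : Fin 4 → E => covDeriv₃ γ φ y (v 0) (v 1) (v 2) (v 3)) ψ =
      contraction (γ y) (fun v : Fin 4 → E => fderiv ℝ φ y (v 0) (Fin.tail v)) ψ := by
  have h0 (v : Fin 4 → E) : fderiv ℝ (fun z => φ z ![v 1, v 2, v 3]) y (v 0) =
      fderiv ℝ φ y (v 0) (Fin.tail v) := by
    have h : ![v 1, v 2, v 3] = Fin.tail v := by
      ext s; fin_cases s <;> rfl
    rw [h]
    exact congrArg (fun f : E →L[ℝ] ℝ => f (v 0))
      (((ContinuousAlternatingMap.apply ℝ E ℝ (Fin.tail v)).hasFDerivAt.comp y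
        hφ.hasFDerivAt).fderiv)
  unfold covDeriv₃
  simp only [h0]
  rw [contraction_sub, contraction_sub, contraction_sub,
    contraction_eq_zero (D := fun v : Fin 4 → E => φ y ![christoffel γ y (v 0) (v 1), v 2, v 3])
      (γ y) ψ (p := 0) (q := 1) (by decide)
      (fun v => by
        change φ y ![christoffel γ y (v 1) (v 0), v 2, v 3] = _
        rw [christoffel_comm hγ]),
    contraction_eq_zero (D := fun v : Fin 4 → E => φ y ![v 1, christoffel γ y (v 0) (v 2), v 3])
      (γ y) ψ (p := 0) (q := 2) (by decide)
      (fun v => by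
        change φ y ![v 1, christoffel γ y (v 2) (v 0), v 3] = _
        rw [christoffel_comm hγ]),
    contraction_eq_zero (D := fun v : Fin 4 → E => φ y ![v 1, v 2, christoffel γ y (v 0) (v 3)])
      (γ y) ψ (p := 0) (q := 3) (by decide)
      (fun v => by
        change φ y ![v 1, v 2, christoffel γ y (v 3) (v 0)] = _
        rw [christoffel_comm hγ])]
  ring

theorem sum_mul_eq_sum_extDeriv {k n : ℕ} (φ : E → E [⋀^Fin k]→L[ℝ] ℝ)
    (ψ : E [⋀^Fin (k + 1)]→L[ℝ] ℝ) (y : E) (e : Fin n → E) :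
    ∑ s : Fin (k + 1) → Fin n, extDeriv φ y (fun c => e (s c)) * ψ (fun c => e (s c)) =
      (k + 1 : ℝ) * ∑ s : Fin (k + 1) → Fin n,
        fderiv ℝ φ y (e (s 0)) (fun c => e (Fin.tail s c)) * ψ fun c => e (s c) := by
  have h (i : Fin (k + 1)) : ∑ s : Fin (k + 1) → Fin n,
      ((-1) ^ (i : ℕ) * fderiv ℝ φ y (e (s i)) (fun c => e (i.removeNth s c))) *
        ψ (fun c => e (s c)) = ∑ s : Fin (k + 1) → Fin n,
        fderiv ℝ φ y (e (s 0)) (fun c => e (Fin.tail s c)) * ψ fun c => e (s c) := by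
    rw [← (Fin.insertNthEquiv (fun _ : Fin (k + 1) => Fin n) i).sum_comp,
      ← (Fin.consEquiv fun _ : Fin (k + 1) => Fin n).sum_comp]
    refine Fintype.sum_congr _ _ fun ⟨x, w⟩ => ?_
    have h1 : (fun c => e ((Fin.insertNthEquiv (fun _ : Fin (k + 1) => Fin n) i (x, w)) c)) =
        i.insertNth (e x) (fun c => e (w c)) := by
      ext c
      induction c using i.succAboveCases <;> simp
    have h2 : (fun c => e ((Fin.consEquiv (fun _ : Fin (k + 1) => Fin n) (x, w)) c)) =
        Fin.cons (e x) (fun c => e (w c)) := by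
      ext c
      induction c using Fin.cases <;> simp
    have h4 : i.removeNth (Fin.insertNthEquiv (fun _ : Fin (k + 1) => Fin n) i (x, w)) = w :=
      Fin.removeNth_insertNth (α := fun _ => Fin n) i x w
    have h5 : Fin.tail (Fin.consEquiv (fun _ : Fin (k + 1) => Fin n) (x, w)) = w := rfl
    rw [h1, h2, h4, h5, ψ.map_insertNth]
    simp only [Fin.insertNthEquiv_apply, Fin.consEquiv_apply, Fin.insertNth_apply_same,
      Fin.cons_zero, Matrix.vecCons, zsmul_eq_mul]
    have h3 : ((-1 : ℝ) ^ (i : ℕ)) * (-1) ^ (i : ℕ) = 1 := by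
      rw [← mul_pow]; norm_num
    push_cast
    linear_combination (fderiv ℝ φ y (e x) (fun c => e (w c)) *
      ψ (Fin.cons (e x) fun c => e (w c))) * h3
  simp only [extDeriv, ContinuousAlternatingMap.alternatizeUncurryFin_apply, Finset.sum_mul]
  rw [Finset.sum_comm]
  refine (Fintype.sum_congr _ _ fun i => Eq.trans (Fintype.sum_congr _ _ fun s => ?_) (h i)).trans
    (by simp)
  rw [zsmul_eq_mul]
  push_cast
  rfl

theorem sum_torsion_eq_framePairing [FiniteDimensional ℝ E] {γ : E → E →L[ℝ] E →L[ℝ] ℝ}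
    (hγ : ∀ y u v, γ y u v = γ y v u) {φ : E → E [⋀^Fin 3]→L[ℝ] ℝ}
    (ψ : E → E [⋀^Fin 4]→L[ℝ] ℝ) {y : E} (hφ : DifferentiableAt ℝ φ y) {e : Fin 7 → E}
    {ε : Fin 7 → E →L[ℝ] ℝ} (h : IsOrthonormalFrame (γ y) e ε) :
    ∑ a, ∑ m, inverseMetric (γ y) a m *
      torsion γ φ ψ y (Module.finBasis ℝ E a) (Module.finBasis ℝ E m) =
    (1 / 4 : ℝ) * framePairing e (extDeriv φ y) (ψ y) := by
  rw [sum_torsion_eq_contraction, contraction_covDeriv hγ _ hφ, framePairing,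
    sum_mul_eq_sum_extDeriv]
  let D : MultilinearMap ℝ (fun _ : Fin 4 => E) ℝ :=
    LinearMap.uncurryLeft (M := fun _ : Fin 4 => E)
      { toFun := fun u => (fderiv ℝ φ y u).toMultilinearMap
        map_add' := fun u v => by rw [map_add]; rfl
        map_smul' := fun c u => by rw [map_smul]; rfl }
  have h1 := h.sum_inverseMetric D (ψ y).toMultilinearMap
  have h2 : contraction (γ y) (fun v : Fin 4 → E => fderiv ℝ φ y (v 0) (Fin.tail v)) (ψ y) =
      ∑ s : Fin 4 → Fin 7, fderiv ℝ φ y (e (s 0)) (fun c => e (Fin.tail s c)) *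
        ψ y fun c => e (s c) := h1
  rw [h2]
  norm_num
  ring

end Torsion


section TraceTorsion

variable {E : Type*} [NormedAddCommGroup E] [NormedSpace ℝ E]
variable {H : Type*} [TopologicalSpace H] {I : ModelWithCorners ℝ E H} [I.Boundaryless]
variable {M : Type*} [TopologicalSpace M] [ChartedSpace H M] [IsManifold I 1 M]

theorem chartBilin_self (g : BilinField I M) (x : M) :
    chartBilin g x (extChartAt I x x) = g x := by
  refine ContinuousLinearMap.ext fun u : E => ContinuousLinearMap.ext fun v : E => ?_
  change (g ((extChartAt I x).symm (extChartAt I x x)))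
    ((mfderiv 𝓘(ℝ, E) I (extChartAt I x).symm (extChartAt I x x) : E →L[ℝ] E) u)
    ((mfderiv 𝓘(ℝ, E) I (extChartAt I x).symm (extChartAt I x x) : E →L[ℝ] E) v) = _
  rw [mfderiv_extChartAt_symm_self, extChartAt_to_inv]
  rfl

theorem traceTorsion_eq_framePairing [FiniteDimensional ℝ E] {g : BilinField I M} (hg : ∀ x u v,
    g x u v = g x v u)
    {φ : DForm I M 3 ℝ} (ψ : DForm I M 4 ℝ) {x : M} (hφ : SmoothFormAt φ x)
    {e : Fin 7 → TangentSpace I x} {ε : Fin 7 → TangentSpace I x →L[ℝ] ℝ}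
    (h : IsOrthonormalFrame (g x) e ε) :
    traceTorsion g φ ψ x = (1 / 4 : ℝ) * framePairing e (d φ x) (ψ x) := by
  have h' : IsOrthonormalFrame (V := E) (chartBilin g x (extChartAt I x x)) e ε := by
    rw [chartBilin_self]
    exact h
  have key := sum_torsion_eq_framePairing (γ := chartBilin g x) (fun y u v => hg _ _ _)
    (chartForm ψ x) hφ.differentiableAt h'
  rw [d_apply]
  refine key.trans ?_
  rw [chartForm_self]
  rfl

end TraceTorsion

section WarpedOperators

variable {N : Type*} [TopologicalSpace N] [ChartedSpace (EuclideanSpace ℝ (Fin 6)) N]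
variable {L : Type*} [TopologicalSpace L] [ChartedSpace ℝ L]
variable {r : OpenPartialHomeomorph L ℝ} {z : N × L}

theorem lift_ddr_cons {k : ℕ} (a : DForm (𝓡 6) N (k + 1) ℝ)
    (w : Fin k → TangentSpace I₇ z) :
    lift (L := L) a z (Fin.cons (ddr N r z) w : Fin (k + 1) → TangentSpace I₇ z) = 0 := by
  refine (a z.1).map_coord_zero 0 ?_
  change mfderiv I₇ (𝓡 6) (Prod.fst : N × L → N) z (ddr N r z) = 0
  rw [mfderiv_fst]
  rfl

theorem drWedge_ddr_cons {k : ℕ} (hr : r ∈ IsManifold.maximalAtlas 𝓘(ℝ, ℝ) ∞ L)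
    (hz : z.2 ∈ r.source) (a : DForm (𝓡 6) N (k + 1) ℝ) (w : Fin (k + 1) → TangentSpace I₇ z) :
    drWedge r (lift a) z (Fin.cons (ddr N r z) w : Fin (k + 2) → TangentSpace I₇ z) =
      lift (L := L) a z w := by
  unfold drWedge
  rw [covectorWedge_apply, Fin.sum_univ_succ]
  have h (i : Fin (k + 1)) : lift (L := L) a z ((i.succ : Fin (k + 2)).removeNth
      (Fin.cons (ddr N r z) w : Fin (k + 2) → TangentSpace I₇ z)) = 0 := by
    have hc : (i.succ : Fin (k + 2)).removeNth
        (Fin.cons (ddr N r z) w : Fin (k + 2) → TangentSpace I₇ z) =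
        (Fin.cons (ddr N r z) (i.removeNth w) : Fin (k + 1) → TangentSpace I₇ z) := by
      ext j
      induction j using Fin.cases <;> simp [Fin.removeNth]
    rw [hc]
    exact lift_ddr_cons a _
  simp only [h, mul_zero, Finset.sum_const_zero, add_zero]
  have h0 : drCovector r z ((Fin.cons (ddr N r z) w : Fin (k + 2) → TangentSpace I₇ z) 0) = 1 :=
    drCovector_ddr hr hz
  rw [h0]
  simp

variable [IsManifold (𝓡 6) ∞ N] {S : SU3Structure N}

theorem warpedMetric_symm (S : SU3Structure N) (r : OpenPartialHomeomorph L ℝ) (W : WarpedData)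
    (z : N × L) (u v : TangentSpace I₇ z) :
    warpedMetric S r W z u v = warpedMetric S r W z v u := by
  change W.G (r z.2) ^ 2 * (drCovector r z u * drCovector r z v) + W.h (r z.2) ^ 2 *
    S.g.inner z.1 (mfderiv I₇ (𝓡 6) Prod.fst z u) (mfderiv I₇ (𝓡 6) Prod.fst z v) =
    W.G (r z.2) ^ 2 * (drCovector r z v * drCovector r z u) + W.h (r z.2) ^ 2 *
    S.g.inner z.1 (mfderiv I₇ (𝓡 6) Prod.fst z v) (mfderiv I₇ (𝓡 6) Prod.fst z u)
  rw [S.g.symm, mul_comm (drCovector r z u)]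

theorem interiorProd_baseFour (hr : r ∈ IsManifold.maximalAtlas 𝓘(ℝ, ℝ) ∞ L)
    (hz : z.2 ∈ r.source) (c p q s : ℝ → ℝ) :
    interiorProd (k := 3) (c (r z.2) • ddr N r z) (baseFour S r p q s z) =
      baseThree S r (fun t => c t * q t) (fun t => c t * s t) 0 z := by
  ext w
  change baseFour S r p q s z (Fin.cons (c (r z.2) • ddr N r z) w : Fin 4 → TangentSpace I₇ z) = _
  have h1 : (Fin.cons (c (r z.2) • ddr N r z) w : Fin 4 → TangentSpace I₇ z) =
      Function.update (Fin.cons (ddr N r z) w : Fin 4 → TangentSpace I₇ z) 0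
        (c (r z.2) • (Fin.cons (ddr N r z) w : Fin 4 → TangentSpace I₇ z) 0) := by
    rw [Fin.update_cons_zero]
    rfl
  rw [h1, ContinuousAlternatingMap.map_update_smul, Function.update_eq_self]
  change c (r z.2) * (p (r z.2) * lift (dwedge S.omega S.omega : DForm (𝓡 6) N 4 ℝ) z _ +
    q (r z.2) * drWedge r (lift (reForm S.Omega)) z _ +
    s (r z.2) * drWedge r (lift (imForm S.Omega)) z _) =
    (c (r z.2) * q (r z.2)) * lift (reForm S.Omega) z w +
      (c (r z.2) * s (r z.2)) * lift (imForm S.Omega) z w +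
      0 * drWedge r (lift S.omega) z w
  rw [drWedge_ddr_cons hr hz, drWedge_ddr_cons hr hz, lift_ddr_cons]
  ring

end WarpedOperators


section Coefficients

open Filter Topology

variable {W : WarpedData} {V : Set ℝ} {t lam : ℝ}

theorem contDiffAt_deriv {f : ℝ → ℝ} (hf : ContDiffAt ℝ ∞ f t) : ContDiffAt ℝ ∞ (deriv f) t :=
  (hf.fderiv_right (m := ∞) (by simp)).clm_apply contDiffAt_const

namespace WarpedData.IsSmoothOn

theorem contDiffAt_G (hW : W.IsSmoothOn V) (hV : IsOpen V) (ht : t ∈ V) : ContDiffAt ℝ ∞ W.G t :=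
  hW.smooth_G.contDiffAt (hV.mem_nhds ht)

theorem contDiffAt_h (hW : W.IsSmoothOn V) (hV : IsOpen V) (ht : t ∈ V) : ContDiffAt ℝ ∞ W.h t :=
  hW.smooth_h.contDiffAt (hV.mem_nhds ht)

theorem contDiffAt_θ (hW : W.IsSmoothOn V) (hV : IsOpen V) (ht : t ∈ V) : ContDiffAt ℝ ∞ W.θ t :=
  hW.smooth_θ.contDiffAt (hV.mem_nhds ht)

theorem contDiffAt_α (hW : W.IsSmoothOn V) (hV : IsOpen V) (ht : t ∈ V) :
    ContDiffAt ℝ ∞ W.α t :=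
  ((hW.contDiffAt_G hV ht).inv (hW.G_pos t ht).ne').mul (contDiffAt_deriv (hW.contDiffAt_θ hV ht))

theorem contDiffAt_β (hW : W.IsSmoothOn V) (hV : IsOpen V) (ht : t ∈ V) :
    ContDiffAt ℝ ∞ (W.β lam) t :=
  (contDiffAt_const.mul (Real.contDiff_sin.contDiffAt.comp t (hW.contDiffAt_θ hV ht))).div
    (hW.contDiffAt_h hV ht) (hW.h_pos t ht).ne'

theorem contDiffAt_cube_cos (hW : W.IsSmoothOn V) (hV : IsOpen V) (ht : t ∈ V) :
    ContDiffAt ℝ ∞ (fun t => W.h t ^ 3 * Real.cos (W.θ t)) t :=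
  ((hW.contDiffAt_h hV ht).pow 3).mul
    (Real.contDiff_cos.contDiffAt.comp t (hW.contDiffAt_θ hV ht))

theorem contDiffAt_cube_sin (hW : W.IsSmoothOn V) (hV : IsOpen V) (ht : t ∈ V) :
    ContDiffAt ℝ ∞ (fun t => W.h t ^ 3 * Real.sin (W.θ t)) t :=
  ((hW.contDiffAt_h hV ht).pow 3).mul
    (Real.contDiff_sin.contDiffAt.comp t (hW.contDiffAt_θ hV ht))

theorem hasDerivAt_θ (hW : W.IsSmoothOn V) (hV : IsOpen V) (ht : t ∈ V) :
    HasDerivAt W.θ (W.G t * W.α t) t := by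
  have h := ((hW.contDiffAt_θ hV ht).differentiableAt (by simp)).hasDerivAt
  convert! h using 1
  unfold WarpedData.α WarpedData.ndiff
  rw [mul_inv_cancel_left₀ (hW.G_pos t ht).ne']

theorem hasDerivAt_h (hW : W.IsSmoothOn V) (hV : IsOpen V) (ht : t ∈ V) :
    HasDerivAt W.h (deriv W.h t) t :=
  ((hW.contDiffAt_h hV ht).differentiableAt (by simp)).hasDerivAt

theorem hasDerivAt_cube_cos (hW : W.IsSmoothOn V) (hV : IsOpen V) (ht : t ∈ V)
    (hc : deriv W.h t = -(lam * W.G t * Real.cos (W.θ t))) {f : ℝ → ℝ} {f' : ℝ}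
    (hf : HasDerivAt f f' t) :
    HasDerivAt (fun t => f t * (W.h t ^ 3 * Real.cos (W.θ t)))
      (f' * (W.h t ^ 3 * Real.cos (W.θ t)) - f t * (3 * lam * W.G t * W.h t ^ 2 *
        Real.cos (W.θ t) ^ 2 + W.h t ^ 3 * Real.sin (W.θ t) * (W.G t * W.α t))) t := by
  have h1 := hf.mul (((hW.hasDerivAt_h hV ht).pow 3).mul (hW.hasDerivAt_θ hV ht).cos)
  refine h1.congr_deriv ?_
  rw [hc]
  simp only [Pi.mul_apply, Pi.pow_apply]
  push_cast
  ring

theorem hasDerivAt_cube_sin (hW : W.IsSmoothOn V) (hV : IsOpen V) (ht : t ∈ V)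
    (hc : deriv W.h t = -(lam * W.G t * Real.cos (W.θ t))) {f : ℝ → ℝ} {f' : ℝ}
    (hf : HasDerivAt f f' t) :
    HasDerivAt (fun t => f t * (W.h t ^ 3 * Real.sin (W.θ t)))
      (f' * (W.h t ^ 3 * Real.sin (W.θ t)) + f t * (-(3 * lam * W.G t * W.h t ^ 2 *
        Real.cos (W.θ t) * Real.sin (W.θ t)) +
          W.h t ^ 3 * Real.cos (W.θ t) * (W.G t * W.α t))) t := by
  have h1 := hf.mul (((hW.hasDerivAt_h hV ht).pow 3).mul (hW.hasDerivAt_θ hV ht).sin)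
  refine h1.congr_deriv ?_
  rw [hc]
  simp only [Pi.mul_apply, Pi.pow_apply]
  push_cast
  ring

theorem hasDerivAt_β (hW : W.IsSmoothOn V) (hV : IsOpen V) (ht : t ∈ V)
    (hc : deriv W.h t = -(lam * W.G t * Real.cos (W.θ t))) :
    HasDerivAt (W.β lam) (W.G t * (lam * Real.cos (W.θ t) / W.h t * (W.α t + W.β lam t))) t := by
  have h1 := ((hW.hasDerivAt_θ hV ht).sin.const_mul lam).div (hW.hasDerivAt_h hV ht)
    (hW.h_pos t ht).ne'
  refine h1.congr_deriv ?_
  have := (hW.h_pos t ht).ne'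
  rw [hc]
  unfold WarpedData.β
  field_simp
  ring

end WarpedData.IsSmoothOn

end Coefficients

section PhaseForms

open Filter Topology

variable {N : Type*} [TopologicalSpace N] [ChartedSpace (EuclideanSpace ℝ (Fin 6)) N]
  [IsManifold (𝓡 6) ∞ N]
variable {L : Type*} [TopologicalSpace L] [ChartedSpace ℝ L]

/-- The `3`-form `f Re(F³ Ω) + m G h² dr ∧ ω`. -/
def phaseThree (S : SU3Structure N) (r : OpenPartialHomeomorph L ℝ) (W : WarpedData)
    (f m : ℝ → ℝ) : DForm I₇ (N × L) 3 ℝ :=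
  baseThree S r (fun t => f t * (W.h t ^ 3 * Real.cos (W.θ t)))
    (fun t => -(f t * (W.h t ^ 3 * Real.sin (W.θ t)))) (fun t => m t * (W.G t * W.h t ^ 2))

/-- The `4`-form `(m / 2) h⁴ ω² + f Im(F³ Ω) ∧ G dr`. -/
def phaseFour (S : SU3Structure N) (r : OpenPartialHomeomorph L ℝ) (W : WarpedData)
    (m f : ℝ → ℝ) : DForm I₇ (N × L) 4 ℝ :=
  baseFour S r (fun t => m t * (1 / 2 * W.h t ^ 4))
    (fun t => -(f t * (W.G t * (W.h t ^ 3 * Real.sin (W.θ t)))))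
    (fun t => -(f t * (W.G t * (W.h t ^ 3 * Real.cos (W.θ t)))))

variable {S : SU3Structure N} {r : OpenPartialHomeomorph L ℝ} {W : WarpedData} {z : N × L}
  {lam : ℝ}

theorem warpedφ_eq_phaseThree : warpedφ S r W = phaseThree S r W 1 1 := by
  rw [warpedφ_eq]
  unfold phaseThree
  simp only [Pi.one_apply, one_mul]

theorem warpedψ_eq_phaseFour : warpedψ S r W = phaseFour S r W 1 1 := by
  rw [warpedψ_eq]
  unfold phaseFour
  simp only [Pi.one_apply, one_mul]

theorem baseThree_congr {a b c a' b' c' : ℝ → ℝ} (ha : a (r z.2) = a' (r z.2))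
    (hb : b (r z.2) = b' (r z.2)) (hc : c (r z.2) = c' (r z.2)) :
    baseThree S r a b c z = baseThree S r a' b' c' z := by
  unfold baseThree
  simp only [Pi.add_apply, coordSmul, ha, hb, hc]

theorem baseFour_congr {p q s p' q' s' : ℝ → ℝ} (hp : p (r z.2) = p' (r z.2))
    (hq : q (r z.2) = q' (r z.2)) (hs : s (r z.2) = s' (r z.2)) :
    baseFour S r p q s z = baseFour S r p' q' s' z := by
  unfold baseFour
  simp only [Pi.add_apply, coordSmul, hp, hq, hs]

theorem smul_phaseThree (c f m : ℝ → ℝ) :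
    c (r z.2) • phaseThree S r W f m z = phaseThree S r W (fun t => c t * f t)
      (fun t => c t * m t) z := by
  unfold phaseThree baseThree coordSmul
  simp only [Pi.add_apply, smul_add, smul_smul, mul_assoc, mul_neg]

theorem phaseThree_add_smul (c : ℝ) (f m f' m' : ℝ → ℝ) :
    phaseThree S r W f m + c • phaseThree S r W f' m' =
      phaseThree S r W (fun t => f t + c * f' t) fun t => m t + c * m' t := by
  funext z
  unfold phaseThree baseThree coordSmul
  simp only [Pi.add_apply, Pi.smul_apply]
  module

theorem IsWarpedFrame.eq_of_baseFour_eq {e : Fin 7 → TangentSpace I₇ z}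
    {ε : Fin 7 → TangentSpace I₇ z →L[ℝ] ℝ} (h : IsWarpedFrame S r W z e ε)
    (hG : W.G (r z.2) ≠ 0) (hh : W.h (r z.2) ≠ 0) {p q s p' q' s' p'' q'' s'' : ℝ → ℝ} {c : ℝ}
    (h0 : baseFour S r p q s z = baseFour S r p' q' s' z + c • baseFour S r p'' q'' s'' z) :
    p (r z.2) = p' (r z.2) + c * p'' (r z.2) ∧ q (r z.2) = q' (r z.2) + c * q'' (r z.2) ∧
      s (r z.2) = s' (r z.2) + c * s'' (r z.2) := by
  have h1 : baseFour S r (fun t => p t - (p' t + c * p'' t)) (fun t => q t - (q' t + c * q'' t))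
      (fun t => s t - (s' t + c * s'' t)) z = 0 := by
    rw [← sub_eq_zero] at h0
    rw [← h0]
    unfold baseFour coordSmul
    simp only [Pi.add_apply]
    module
  obtain ⟨h2, h3, h4⟩ := h.baseFour_eq_zero hG hh h1
  exact ⟨sub_eq_zero.1 h2, sub_eq_zero.1 h3, sub_eq_zero.1 h4⟩

theorem IsWarpedFrame.star_phaseFour {e : Fin 7 → TangentSpace I₇ z}
    {ε : Fin 7 → TangentSpace I₇ z →L[ℝ] ℝ} (h : IsWarpedFrame S r W z e ε)
    (hG : W.G (r z.2) ≠ 0) (hh : W.h (r z.2) ≠ 0) (m f : ℝ → ℝ) :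
    star (k := 4) (m := 3) (warpedMetric S r W) (warpedVol S r W) (phaseFour S r W m f) z =
      phaseThree S r W f m z := by
  refine (h.star_baseFour hG hh _ _ _).trans (baseThree_congr ?_ ?_ ?_) <;> field_simp

theorem IsWarpedFrame.framePairing_phaseFour {e : Fin 7 → TangentSpace I₇ z}
    {ε : Fin 7 → TangentSpace I₇ z →L[ℝ] ℝ} (h : IsWarpedFrame S r W z e ε)
    (hG : W.G (r z.2) ≠ 0) (hh : W.h (r z.2) ≠ 0) (m f m' f' : ℝ → ℝ) :
    framePairing e (phaseFour S r W m f z) (phaseFour S r W m' f' z) =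
      3 * (m (r z.2) * m' (r z.2)) + 4 * (f (r z.2) * f' (r z.2)) := by
  refine (h.framePairing_baseFour hG hh _ _ _ _ _ _).trans ?_
  field_simp
  linear_combination (16 * (f (r z.2) * f' (r z.2))) * Real.sin_sq_add_cos_sq (W.θ (r z.2))

variable [IsManifold 𝓘(ℝ, ℝ) ∞ L]

theorem smoothFormAt_phaseThree (hr : r ∈ IsManifold.maximalAtlas 𝓘(ℝ, ℝ) ∞ L)
    (hz : z.2 ∈ r.source) (hW : W.IsSmoothOn r.target) {f m : ℝ → ℝ}
    (hf : ContDiffAt ℝ ∞ f (r z.2)) (hm : ContDiffAt ℝ ∞ m (r z.2)) :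
    SmoothFormAt (phaseThree S r W f m) z := by
  have ht := r.map_source hz
  exact smoothFormAt_baseThree hr hz (hf.mul (hW.contDiffAt_cube_cos r.open_target ht))
    (hf.mul (hW.contDiffAt_cube_sin r.open_target ht)).neg
    (hm.mul ((hW.contDiffAt_G r.open_target ht).mul ((hW.contDiffAt_h r.open_target ht).pow 2)))

theorem SU3Structure.IsOfType.d_phaseThree (hS : S.IsOfType lam)
    (hr : r ∈ IsManifold.maximalAtlas 𝓘(ℝ, ℝ) ∞ L)
    (hz : z.2 ∈ r.source) (hW : W.IsSmoothOn r.target)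
    (hc : deriv W.h (r z.2) = -(lam * W.G (r z.2) * Real.cos (W.θ (r z.2))))
    {f m : ℝ → ℝ} (hf : ContDiffAt ℝ ∞ f (r z.2)) (hm : ContDiffAt ℝ ∞ m (r z.2)) :
    d (phaseThree S r W f m) z = baseFour S r
      (fun t => -(2 * lam * (f t * (W.h t ^ 3 * Real.sin (W.θ t)))))
      (fun t => deriv f t * (W.h t ^ 3 * Real.cos (W.θ t)) - f t * (3 * lam * W.G t * W.h t ^ 2 *
        Real.cos (W.θ t) ^ 2 + W.h t ^ 3 * Real.sin (W.θ t) * (W.G t * W.α t)) +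
        3 * lam * (m t * (W.G t * W.h t ^ 2)))
      (fun t => -(deriv f t * (W.h t ^ 3 * Real.sin (W.θ t)) + f t * (-(3 * lam * W.G t *
        W.h t ^ 2 * Real.cos (W.θ t) * Real.sin (W.θ t)) +
          W.h t ^ 3 * Real.cos (W.θ t) * (W.G t * W.α t)))) z := by
  have ht := r.map_source hz
  have hf' := (hf.differentiableAt (by simp)).hasDerivAt
  refine (hS.d_baseThree hr hz (hf.mul (hW.contDiffAt_cube_cos r.open_target ht))
    (hf.mul (hW.contDiffAt_cube_sin r.open_target ht)).neg
    (hm.mul ((hW.contDiffAt_G r.open_target ht).mul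
      ((hW.contDiffAt_h r.open_target ht).pow 2)))).trans (baseFour_congr ?_ ?_ ?_)
  · ring
  · change deriv (fun t => f t * (W.h t ^ 3 * Real.cos (W.θ t))) (r z.2) + _ = _
    rw [(hW.hasDerivAt_cube_cos r.open_target ht hc hf').deriv]
  · exact (hW.hasDerivAt_cube_sin r.open_target ht hc hf').neg.deriv

theorem SU3Structure.IsOfType.deriv_h (hS : S.IsOfType lam)
    (hr : r ∈ IsManifold.maximalAtlas 𝓘(ℝ, ℝ) ∞ L)
    (hW : W.IsSmoothOn r.target) (hψ : IsCoclosed S r W) (hz : z.2 ∈ r.source) :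
    deriv W.h (r z.2) = -(lam * W.G (r z.2) * Real.cos (W.θ (r z.2))) := by
  have ht := r.map_source hz
  have hG := hW.contDiffAt_G r.open_target ht
  have hh := hW.h_pos _ ht
  obtain ⟨e, ε, h⟩ := exists_isWarpedFrame (S := S) hr hz (hW.G_pos _ ht).ne' hh.ne'
  have h0 := hψ z hz
  rw [warpedψ_eq, hS.d_baseFour hr hz
    (contDiffAt_const.mul ((hW.contDiffAt_h r.open_target ht).pow 4))
    (hG.mul (hW.contDiffAt_cube_sin r.open_target ht)).neg
    (hG.mul (hW.contDiffAt_cube_cos r.open_target ht)).neg, smul_eq_zero] at h0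
  have h1 := h0.resolve_right h.drWedge_omega_sq_ne_zero
  have h2 := (((hW.hasDerivAt_h r.open_target ht).pow 4).const_mul (1 / 2 : ℝ)).deriv
  simp only [Pi.pow_apply] at h2
  rw [h2] at h1
  have h3 : 2 * W.h (r z.2) ^ 3 *
      (deriv W.h (r z.2) + lam * W.G (r z.2) * Real.cos (W.θ (r z.2))) = 0 := by
    rw [← h1]; push_cast; ring
  have h4 := (mul_eq_zero.1 h3).resolve_left (by positivity)
  linarith

end PhaseForms


section Soliton

open Filter Topology

theorem eventually_mem_source {N L : Type*} [TopologicalSpace N] [TopologicalSpace L]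
    {r : OpenPartialHomeomorph L ℝ} {z : N × L} (hz : z.2 ∈ r.source) :
    ∀ᶠ w in 𝓝 z, w.2 ∈ r.source :=
  (r.open_source.preimage continuous_snd).mem_nhds hz

variable {N : Type*} [TopologicalSpace N] [ChartedSpace (EuclideanSpace ℝ (Fin 6)) N]
  [IsManifold (𝓡 6) ∞ N]
variable {L : Type*} [TopologicalSpace L] [ChartedSpace ℝ L] [IsManifold 𝓘(ℝ, ℝ) ∞ L]
variable {S : SU3Structure N} {r : OpenPartialHomeomorph L ℝ} {W : WarpedData} {z : N × L}
  {lam : ℝ}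

theorem d_zero {k : ℕ} (z : N × L) : d (0 : DForm I₇ (N × L) k ℝ) z = 0 := by
  have h := d_smul (0 : ℝ) (0 : DForm I₇ (N × L) k ℝ) z
  rwa [zero_smul, zero_smul] at h

theorem SU3Structure.IsOfType.d_warpedφ (hS : S.IsOfType lam)
    (hr : r ∈ IsManifold.maximalAtlas 𝓘(ℝ, ℝ) ∞ L) (hW : W.IsSmoothOn r.target)
    (hψ : IsCoclosed S r W) (hz : z.2 ∈ r.source) :
    d (warpedφ S r W) z =
      phaseFour S r W (fun t => -4 * W.β lam t) (fun t => W.α t - 3 * W.β lam t) z := by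
  have hh := (hW.h_pos _ (r.map_source hz)).ne'
  have h1 : ContDiffAt ℝ ∞ (1 : ℝ → ℝ) (r z.2) := contDiffAt_const
  rw [warpedφ_eq_phaseThree, hS.d_phaseThree hr hz hW (hS.deriv_h hr hW hψ hz) h1 h1]
  refine baseFour_congr ?_ ?_ ?_
  · simp only [Pi.one_apply, WarpedData.β]
    field_simp
    ring
  · have h1 : deriv (1 : ℝ → ℝ) (r z.2) = 0 := deriv_const _ _
    simp only [Pi.one_apply, WarpedData.β, h1, Real.cos_sq']
    field_simp
    ring
  · have h1 : deriv (1 : ℝ → ℝ) (r z.2) = 0 := deriv_const _ _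
    simp only [Pi.one_apply, WarpedData.β, h1]
    field_simp
    ring

theorem SU3Structure.IsOfType.traceTorsion_eq (hS : S.IsOfType lam)
    (hr : r ∈ IsManifold.maximalAtlas 𝓘(ℝ, ℝ) ∞ L) (hW : W.IsSmoothOn r.target)
    (hψ : IsCoclosed S r W) (hz : z.2 ∈ r.source) :
    traceTorsion (warpedMetric S r W) (warpedφ S r W) (warpedψ S r W) z =
      W.α (r z.2) - 6 * W.β lam (r z.2) := by
  have ht := r.map_source hz
  have hG := (hW.G_pos _ ht).ne'
  have hh := (hW.h_pos _ ht).ne'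
  obtain ⟨e, ε, h⟩ := exists_isWarpedFrame (S := S) hr hz hG hh
  have hφ : SmoothFormAt (warpedφ S r W) z := by
    rw [warpedφ_eq_phaseThree]
    exact smoothFormAt_phaseThree hr hz hW contDiffAt_const contDiffAt_const
  rw [traceTorsion_eq_framePairing (warpedMetric_symm S r W) _ hφ h.orthonormal,
    hS.d_warpedφ hr hW hψ hz, warpedψ_eq_phaseFour, h.framePairing_phaseFour hG hh]
  simp only [Pi.one_apply]
  ring

theorem SU3Structure.IsOfType.codiff₄_warpedψ (hS : S.IsOfType lam)
    (hr : r ∈ IsManifold.maximalAtlas 𝓘(ℝ, ℝ) ∞ L) (hW : W.IsSmoothOn r.target)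
    (hψ : IsCoclosed S r W) (hz : z.2 ∈ r.source) :
    codiff₄ (warpedMetric S r W) (warpedVol S r W) (warpedψ S r W) z =
      phaseThree S r W (fun t => W.α t - 3 * W.β lam t) (fun t => -4 * W.β lam t) z := by
  have hstar (w : N × L) (hw : w.2 ∈ r.source) :
      star (k := 4) (m := 3) (warpedMetric S r W) (warpedVol S r W) (warpedψ S r W) w =
        warpedφ S r W w := by
    have ht := r.map_source hw
    obtain ⟨e, ε, h⟩ := exists_isWarpedFrame (S := S) hr hw (hW.G_pos _ ht).ne' (hW.h_pos _ ht).ne'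
    rw [warpedψ_eq_phaseFour, warpedφ_eq_phaseThree]
    exact h.star_phaseFour (hW.G_pos _ ht).ne' (hW.h_pos _ ht).ne' 1 1
  have hd : d (star (k := 4) (m := 3) (warpedMetric S r W) (warpedVol S r W) (warpedψ S r W)) z =
      phaseFour S r W (fun t => -4 * W.β lam t) (fun t => W.α t - 3 * W.β lam t) z :=
    (d_congr ((eventually_mem_source hz).mono hstar)).trans (hS.d_warpedφ hr hW hψ hz)
  have ht := r.map_source hz
  obtain ⟨e, ε, h⟩ := exists_isWarpedFrame (S := S) hr hz (hW.G_pos _ ht).ne' (hW.h_pos _ ht).ne'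
  rw [← h.star_phaseFour (hW.G_pos _ ht).ne' (hW.h_pos _ ht).ne']
  exact congrArg (hodgeStar (k := 4) (m := 3) (warpedMetric S r W z) (warpedVol S r W z)) hd

theorem codiff₅_d_warpedψ (hψ : IsCoclosed S r W) (hz : z.2 ∈ r.source) :
    codiff₅ (warpedMetric S r W) (warpedVol S r W) (d (warpedψ S r W)) z = 0 := by
  have h : ∀ w : N × L, w.2 ∈ r.source →
      star (k := 5) (m := 2) (warpedMetric S r W) (warpedVol S r W) (d (warpedψ S r W)) w =
        (0 : DForm I₇ (N × L) 2 ℝ) w := by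
    intro w hw
    unfold WarpedCoflow.star
    rw [hψ w hw]
    have h0 := hodgeStar_smul (k := 5) (m := 2) (warpedMetric S r W w) (warpedVol S r W w) 0 0
    rwa [zero_smul, zero_smul] at h0
  have hd := (d_congr ((eventually_mem_source hz).mono h)).trans (d_zero z)
  unfold codiff₅
  rw [Pi.neg_apply, neg_eq_zero]
  have h0 := hodgeStar_smul (k := 3) (m := 4) (warpedMetric S r W z) (warpedVol S r W z) 0 0
  rw [zero_smul, zero_smul] at h0
  exact (congrArg (hodgeStar (k := 3) (m := 4) (warpedMetric S r W z) (warpedVol S r W z)) hd).trans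
    h0

theorem SU3Structure.IsOfType.coflowRHS_eq (hS : S.IsOfType lam)
    (hr : r ∈ IsManifold.maximalAtlas 𝓘(ℝ, ℝ) ∞ L) (hW : W.IsSmoothOn r.target)
    (hψ : IsCoclosed S r W) (hz : z.2 ∈ r.source) (k C : ℝ) :
    coflowRHS S r W k C z = d (phaseThree S r W
      (fun t => W.α t - 3 * W.β lam t + k * (C - (W.α t - 6 * W.β lam t)))
      (fun t => -4 * W.β lam t + k * (C - (W.α t - 6 * W.β lam t)))) z := by
  have ht := r.map_source hz
  have hα := hW.contDiffAt_α r.open_target ht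
  have hβ := hW.contDiffAt_β (lam := lam) r.open_target ht
  have hm : ContDiffAt ℝ ∞ (fun t => C - (W.α t - 6 * W.β lam t)) (r z.2) :=
    contDiffAt_const.sub (hα.sub (contDiffAt_const.mul hβ))
  rw [← phaseThree_add_smul, d_add (smoothFormAt_phaseThree hr hz hW
    (hα.sub (contDiffAt_const.mul hβ)) (contDiffAt_const.mul hβ))
    ((smoothFormAt_phaseThree hr hz hW hm hm).const_smul k), d_smul]
  unfold coflowRHS hodgeLaplacian
  rw [Pi.add_apply, Pi.add_apply, Pi.smul_apply, codiff₅_d_warpedψ hψ hz, add_zero,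
    d_congr ((eventually_mem_source hz).mono fun w hw => hS.codiff₄_warpedψ hr hW hψ hw)]
  congr 2
  refine d_congr ((eventually_mem_source hz).mono fun w hw => ?_)
  rw [hS.traceTorsion_eq hr hW hψ hw, warpedφ_eq_phaseThree,
    smul_phaseThree (fun t => C - (W.α t - 6 * W.β lam t))]
  simp only [Pi.one_apply, mul_one]

theorem SU3Structure.IsOfType.solitonRHS_eq (hS : S.IsOfType lam)
    (hr : r ∈ IsManifold.maximalAtlas 𝓘(ℝ, ℝ) ∞ L) (hW : W.IsSmoothOn r.target)
    (hψ : IsCoclosed S r W) (hz : z.2 ∈ r.source) {l : ℝ → ℝ} (hl : ContDiffOn ℝ ∞ l r.target)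
    (mu : ℝ) :
    solitonRHS S r W l mu z = baseFour S r
      (fun t => -(2 * lam * (l t * (W.h t ^ 3 * Real.cos (W.θ t)))))
      (fun t => -(deriv l t * (W.h t ^ 3 * Real.sin (W.θ t)) + l t * (-(3 * lam * W.G t *
        W.h t ^ 2 * Real.cos (W.θ t) * Real.sin (W.θ t)) +
          W.h t ^ 3 * Real.cos (W.θ t) * (W.G t * W.α t))))
      (fun t => -(deriv l t * (W.h t ^ 3 * Real.cos (W.θ t)) - l t * (3 * lam * W.G t *
        W.h t ^ 2 * Real.cos (W.θ t) ^ 2 + W.h t ^ 3 * Real.sin (W.θ t) * (W.G t * W.α t)))) z +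
      (4 * mu) • phaseFour S r W 1 1 z := by
  have ht := r.map_source hz
  have hc := hS.deriv_h hr hW hψ hz
  have hlt : ContDiffAt ℝ ∞ l (r z.2) := hl.contDiffAt (r.open_target.mem_nhds ht)
  have hl' := (hlt.differentiableAt (by simp)).hasDerivAt
  have h (w : N × L) (hw : w.2 ∈ r.source) :
      interiorProd (k := 3) ((l (r w.2) * (W.G (r w.2))⁻¹) • ddr N r w) (warpedψ S r W w) =
        baseThree S r (fun t => -(l t * (W.h t ^ 3 * Real.sin (W.θ t))))
          (fun t => -(l t * (W.h t ^ 3 * Real.cos (W.θ t)))) 0 w := by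
    have hG := (hW.G_pos _ (r.map_source hw)).ne'
    rw [warpedψ_eq]
    refine (interiorProd_baseFour hr hw (fun t => l t * (W.G t)⁻¹) _ _ _).trans
      (baseThree_congr ?_ ?_ rfl) <;> field_simp
  unfold solitonRHS
  rw [Pi.add_apply, Pi.smul_apply, warpedψ_eq_phaseFour, ← warpedψ_eq_phaseFour,
    d_congr ((eventually_mem_source hz).mono h), warpedψ_eq_phaseFour]
  congr 1
  refine (hS.d_baseThree hr hz (hlt.mul (hW.contDiffAt_cube_sin r.open_target ht)).neg
    (hlt.mul (hW.contDiffAt_cube_cos r.open_target ht)).neg contDiffAt_const).trans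
    (baseFour_congr ?_ ?_ ?_)
  · ring
  · have h1 := (hW.hasDerivAt_cube_sin r.open_target ht hc hl').neg.deriv
    exact (congrArg₂ (· + ·) h1 (mul_zero _)).trans (add_zero _)
  · exact (hW.hasDerivAt_cube_cos r.open_target ht hc hl').neg.deriv

theorem solitonSystem_of_isSoliton [Nonempty N] (hS : S.IsOfType lam)
    (hr : r ∈ IsManifold.maximalAtlas 𝓘(ℝ, ℝ) ∞ L) {k C mu : ℝ} {l : ℝ → ℝ}
    (h : IsSoliton S r W k C l mu) : SolitonSystem W lam k C l mu r.target := by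
  have key : ∀ t ∈ r.target,
      ((1 - k) * W.α t ^ 2 + 3 * W.β lam t ^ 2 + 6 * k * W.α t * W.β lam t + k * C * W.α t =
        W.ndiff l t + mu) ∧
      ((k - 1) * W.ndiff (fun s => W.α s - 6 * W.β lam s) t = W.α t * l t) ∧
      (3 * (1 - 2 * k) * W.β lam t ^ 2 + (k - 1) * W.α t * W.β lam t - k * C * W.β lam t =
        -(lam * Real.cos (W.θ t) / W.h t * l t) + mu) ∧
      W.ndiff (W.β lam) t = lam * Real.cos (W.θ t) / W.h t * (W.α t + W.β lam t) := by
    intro t ht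
    obtain ⟨x⟩ := ‹Nonempty N›
    have hW := h.smooth
    have hz : ((x, r.symm t) : N × L).2 ∈ r.source := r.map_target ht
    have hzt : r ((x, r.symm t) : N × L).2 = t := r.right_inv ht
    have hG := hW.G_pos t ht
    have hh := hW.h_pos t ht
    have hα := hW.contDiffAt_α r.open_target ht
    have hβ := hW.contDiffAt_β (lam := lam) r.open_target ht
    have hc : deriv W.h t = -(lam * W.G t * Real.cos (W.θ t)) := by
      have := hS.deriv_h hr hW h.coclosed hz
      rwa [hzt] at this
    have hf : ContDiffAt ℝ ∞
        (fun t => W.α t - 3 * W.β lam t + k * (C - (W.α t - 6 * W.β lam t))) t :=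
      (hα.sub (contDiffAt_const.mul hβ)).add
        (contDiffAt_const.mul (contDiffAt_const.sub (hα.sub (contDiffAt_const.mul hβ))))
    have hm : ContDiffAt ℝ ∞
        (fun t => -4 * W.β lam t + k * (C - (W.α t - 6 * W.β lam t))) t :=
      (contDiffAt_const.mul hβ).add
        (contDiffAt_const.mul (contDiffAt_const.sub (hα.sub (contDiffAt_const.mul hβ))))
    have hα' := (hα.differentiableAt (by simp)).hasDerivAt
    have hβ' := hW.hasDerivAt_β r.open_target ht hc
    have hf' : deriv (fun t => W.α t - 3 * W.β lam t + k * (C - (W.α t - 6 * W.β lam t))) t = _ :=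
      ((hα'.sub (hβ'.const_mul 3)).add
        (((hα'.sub (hβ'.const_mul 6)).const_sub C).const_mul k)).deriv
    have hn' : deriv (fun t => W.α t - 6 * W.β lam t) t = _ := (hα'.sub (hβ'.const_mul 6)).deriv
    have heq := h.eq (x, r.symm t) hz
    rw [hS.coflowRHS_eq hr hW h.coclosed hz, hS.solitonRHS_eq hr hW h.coclosed hz h.smooth_l,
      hS.d_phaseThree hr hz hW (hS.deriv_h hr hW h.coclosed hz) (by rw [hzt]; exact hf)
        (by rw [hzt]; exact hm)] at heq
    obtain ⟨e, ε, hF⟩ := exists_isWarpedFrame (S := S) (W := W) hr hz (by rw [hzt]; exact hG.ne')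
      (by rw [hzt]; exact hh.ne')
    obtain ⟨h1, h2, h3⟩ := hF.eq_of_baseFour_eq (by rw [hzt]; exact hG.ne')
      (by rw [hzt]; exact hh.ne') heq
    rw [hzt] at h1 h2 h3
    rw [hf'] at h2 h3
    simp only [Pi.one_apply, one_mul] at h1 h2 h3
    have htrig := Real.sin_sq_add_cos_sq (W.θ t)
    have hB : lam * Real.sin (W.θ t) = W.β lam t * W.h t := by
      unfold WarpedData.β; field_simp
    unfold WarpedData.ndiff
    rw [hn', hβ'.deriv]
    have hX : lam * Real.cos (W.θ t) = lam * Real.cos (W.θ t) / W.h t * W.h t := by field_simp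
    generalize lam * Real.cos (W.θ t) / W.h t = X at *
    generalize W.β lam t = B at *
    generalize W.α t = A at *
    generalize deriv W.α t = A' at *
    generalize deriv l t = l' at *
    generalize l t = l at *
    generalize W.G t = G at *
    generalize W.h t = h at *
    generalize Real.sin (W.θ t) = Sn at *
    generalize Real.cos (W.θ t) = Cs at *
    have E1 : h ^ 4 * ((A - 3 * B + k * (C - (A - 6 * B))) * B - (l * X - mu)) = 0 := by
      linear_combination (-1 / 2) * h1 - (A - 3 * B + k * (C - (A - 6 * B))) * h ^ 3 * hB +
        l * h ^ 3 * hX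
    have E2 : h ^ 3 * ((1 - k) * A' + (6 * k - 6) * (G * (X * (A + B))) + l * G * A) = 0 := by
      linear_combination Cs * h2 - Sn * h3 -
        ((A' - 3 * (G * (X * (A + B))) + k * -(A' - 6 * (G * (X * (A + B))))) * h ^ 3 -
          3 * (A - 3 * B + k * (C - (A - 6 * B))) * lam * G * h ^ 2 * Cs + l * h ^ 3 * G * A) *
          htrig + 3 * (A + B) * G * h ^ 2 * hX
    have E3 : h ^ 3 * (-(A - 3 * B + k * (C - (A - 6 * B))) * (G * A) + l' - 3 * l * G * X +
        4 * mu * G + 3 * B * G * (-4 * B + k * (C - (A - 6 * B)))) = 0 := by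
      linear_combination Sn * h2 + Cs * h3 -
        (-(A - 3 * B + k * (C - (A - 6 * B))) * h ^ 3 * G * A + l' * h ^ 3 -
          3 * l * lam * G * h ^ 2 * Cs + 4 * mu * G * h ^ 3) * htrig + 3 * l * G * h ^ 2 * hX -
        3 * (-4 * B + k * (C - (A - 6 * B))) * G * h ^ 2 * hB
    have F1 := (mul_eq_zero.1 E1).resolve_left (by positivity)
    have F2 := (mul_eq_zero.1 E2).resolve_left (by positivity)
    have F3 := (mul_eq_zero.1 E3).resolve_left (by positivity)
    have hGi : G⁻¹ * G = 1 := inv_mul_cancel₀ hG.ne'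
    refine ⟨?_, ?_, ?_, ?_⟩
    · have hl' : l' = G * ((1 - k) * A ^ 2 + 3 * B ^ 2 + 6 * k * A * B + k * C * A - mu) := by
        linear_combination F3 - 3 * G * F1
      rw [hl', inv_mul_cancel_left₀ hG.ne']
      ring
    · linear_combination (-G⁻¹) * F2 + A * l * hGi
    · linear_combination -F1
    · rw [inv_mul_cancel_left₀ hG.ne']
  refine ⟨fun t ht => (key t ht).1, fun t ht => (key t ht).2.1, fun t ht hne => ?_,
    fun t ht => (key t ht).2.2.1⟩
  rw [(key t ht).2.2.1, (key t ht).2.2.2]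
  congr 2
  field_simp

end Soliton

end WarpedCoflow

end

theorem mainTheorem5
    {N : Type*} [TopologicalSpace N] [ChartedSpace (EuclideanSpace ℝ (Fin 6)) N]
    [IsManifold (𝓡 6) ∞ N] [Nonempty N]
    {L : Type*} [TopologicalSpace L] [ChartedSpace ℝ L] [IsManifold 𝓘(ℝ, ℝ) ∞ L]
    (S : WarpedCoflow.SU3Structure N) (lam : ℝ) (hS : S.IsOfType lam)
    (r : OpenPartialHomeomorph L ℝ) (hr : r ∈ IsManifold.maximalAtlas 𝓘(ℝ, ℝ) ∞ L)
    (k C mu : ℝ) :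
    (∀ (W : WarpedCoflow.WarpedData) (l : ℝ → ℝ),
      WarpedCoflow.IsSoliton S r W k C l mu →
        WarpedCoflow.SolitonSystem W lam k C l mu r.target) ∧
    (∀ (J : Set ℝ), J.OrdConnected → J.Nontrivial →
      ∀ (W : ℝ → WarpedCoflow.WarpedData) (l : ℝ → ℝ → ℝ),
        WarpedCoflow.IsSolitonSolution S r W k C l mu J →
          ∀ t ∈ J, WarpedCoflow.SolitonSystem (W t) lam k C (l t) mu r.target) := by
  refine ⟨fun W l h => WarpedCoflow.solitonSystem_of_isSoliton hS hr h,
    fun J hJ hJ' W l h t ht => WarpedCoflow.solitonSystem_of_isSoliton hS hr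
      ⟨h.smooth t ht, h.smooth_l t ht, h.coclosed t ht, fun z hz => ?_⟩⟩
  have hu : UniqueDiffWithinAt ℝ J t :=
    uniqueDiffWithinAt_iff_accPt.2 (hJ.isPreconnected.preperfect_of_nontrivial hJ' t ht)
  ext v
  exact hu.eq_deriv _ (h.flow t ht z hz v) (h.soliton t ht z hz v)
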